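/- Let $G$ be a finite simple graph. $G$ is a cactus if it is connected and each of its edges lies on at most one cycle; a cactus is a Christmas cactus graph if each of its vertices lies in at most two blocks (a block is a maximal connected subgraph without an articulation of its own; bridges count as blocks). A configuration is a multiset of vertices (the positions of the guards), and two configurations are traversable if the guards of the first can move simultaneously, each staying where it is or going to a neighbouring vertex, so that the second results; in particular a configuration is traversable to itself. A strategy of order $k$ is a nonempty set $\mathbb{C}$ of configurations, each with exactly $k$ guards. It defends against vertex attacks if for all $C\in\mathbb{C}$ and $v\in V(G)$ there is $C'\in\mathbb{C}$ traversable with $C$ such that $v\in C'$; it evicts vertices if for all $C\in\mathbb{C}$ and $v\in V(G)$ there is $C'\in\mathbb{C}$ traversable with $C$ such that $v\notin C'$; it evicts cycle edges if for all $C\in\mathbb{C}$ and every edge $uv$ lying on a cycle of $G$ there is $C'\in\mathbb{C}$ traversable with $C$ such that $u,v\notin C'$. The m-eternal guard number $\Gamma^\infty_{\mathrm m}(G)$ is the least order of a strategy defending against vertex attacks. The m-eternal domination number $\gamma^\infty_{\mathrm m}(G)$ is the least order of such a strategy in which no configuration has two guards on the same vertex. The m-eternal domination number with eviction $\gamma^\infty_{\mathrm{me}}(G)$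 is the least order of a strategy in which no configuration has two guards on the same vertex and which defends against vertex attacks, evicts vertices and evicts cycle edges. **Theorem.** Every Christmas cactus graph $G$ satisfies $\Gamma^\infty_{\mathrm m}(G)=\gamma^\infty_{\mathrm m}(G)$, and if $G$ has at least two vertices, then also $\gamma^\infty_{\mathrm m}(G)=\gamma^\infty_{\mathrm{me}}(G)$ (on a single vertex no strategy with eviction exists). Moreover, there is an algorithm (one program for a random access machine with unit cost per step) that, given any Christmas cactus graph on $n$ vertices and $m$ edges by its list of edges, computes this common value in time $O(n+m)$. -/

import Mathlib

/-! ### Cacti and Christmas cacti -/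

namespace SimpleGraph

variable {V : Type*}

/-- A cactus: a connected graph in which every edge lies on at most one cycle. Two closed walks
that are cycles describe the same cycle iff they use the same edges. -/
def IsCactus (G : SimpleGraph V) : Prop :=
  G.Connected ∧
    ∀ (e : Sym2 V) (a b : V) (p : G.Walk a a) (q : G.Walk b b), p.IsCycle → q.IsCycle →
      e ∈ p.edges → e ∈ q.edges → ∀ f : Sym2 V, f ∈ p.edges ↔ f ∈ q.edges

/-- `B` induces a connected graph without an articulation of its own. -/
def IsNonseparable (G : SimpleGraph V) (B : Set V) : Prop :=
  (G.induce B).Connected ∧ ∀ v ∈ B, (G.induce (B \ {v})).Preconnected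

/-- (Vertex sets of) blocks: maximal connected subgraphs without an articulation of their own.
Maximal ones are induced, so they are given by their vertex sets. The blocks of a cactus with at
least two vertices are its cycles and its bridges (as subgraphs with two vertices). -/
def IsBlock (G : SimpleGraph V) (B : Set V) : Prop :=
  Maximal G.IsNonseparable B

/-- A Christmas cactus: a cactus in which every vertex lies in at most two blocks. -/
def IsChristmasCactus (G : SimpleGraph V) : Prop :=
  G.IsCactus ∧ ∀ v : V, {B : Set V | G.IsBlock B ∧ v ∈ B}.encard ≤ 2

/-! ### Guards, strategies and the three numbers

A configuration is a multiset of vertices. -/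

/-- The guards of `C` can move, each staying or going to a neighbour, so that `C'` results. -/
def MutuallyTraversable (G : SimpleGraph V) (C C' : Multiset V) : Prop :=
  Multiset.Rel (fun u v => u = v ∨ G.Adj u v) C C'

/-- `S` is the (nonempty) set of configurations of a strategy of order `k`. The edges of the
strategy are the traversable pairs of configurations of `S`. -/
def IsStrategy (S : Set (Multiset V)) (k : ℕ) : Prop :=
  S.Nonempty ∧ ∀ C ∈ S, C.card = k

/-- Every attacked vertex can be occupied in the next configuration. -/
def DefendsVertices (G : SimpleGraph V) (S : Set (Multiset V)) : Prop :=
  ∀ C ∈ S, ∀ v : V, ∃ C' ∈ S, G.MutuallyTraversable C C' ∧ v ∈ C'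

/-- Every vertex can be cleared of guards in the next configuration. -/
def EvictsVertices (G : SimpleGraph V) (S : Set (Multiset V)) : Prop :=
  ∀ C ∈ S, ∀ v : V, ∃ C' ∈ S, G.MutuallyTraversable C C' ∧ v ∉ C'

/-- The edge `e` lies on some cycle. -/
def IsCycleEdge (G : SimpleGraph V) (e : Sym2 V) : Prop :=
  ∃ (a : V) (p : G.Walk a a), p.IsCycle ∧ e ∈ p.edges

/-- Both ends of every edge lying on a cycle can be cleared of guards in the next configuration. -/
def EvictsCycleEdges (G : SimpleGraph V) (S : Set (Multiset V)) : Prop :=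
  ∀ C ∈ S, ∀ u v : V, G.IsCycleEdge s(u, v) →
    ∃ C' ∈ S, G.MutuallyTraversable C C' ∧ u ∉ C' ∧ v ∉ C'

/-- The m-eternal guard number: the least order of a strategy defending against vertex attacks
(`⊤` if there is none). -/
noncomputable def mEternalGuardNumber (G : SimpleGraph V) : ℕ∞ :=
  ⨅ (k : ℕ) (_ : ∃ S : Set (Multiset V), IsStrategy S k ∧ G.DefendsVertices S), (k : ℕ∞)

/-- The m-eternal domination number: in addition no vertex ever holds two guards. -/
noncomputable def mEternalDominationNumber (G : SimpleGraph V) : ℕ∞ :=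
  ⨅ (k : ℕ) (_ : ∃ S : Set (Multiset V), IsStrategy S k ∧ (∀ C ∈ S, C.Nodup) ∧
    G.DefendsVertices S), (k : ℕ∞)

/-- The m-eternal domination number with eviction: in addition vertices and edges on cycles can
be evicted. -/
noncomputable def mEternalEvictionNumber (G : SimpleGraph V) : ℕ∞ :=
  ⨅ (k : ℕ) (_ : ∃ S : Set (Multiset V), IsStrategy S k ∧ (∀ C ∈ S, C.Nodup) ∧
    G.DefendsVertices S ∧ G.EvictsVertices S ∧ G.EvictsCycleEdges S), (k : ℕ∞)

end SimpleGraph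

/-! ### A random access machine with a step count

Registers `0, 1, 2, …` and arrays `0, 1, 2, …` hold natural numbers. A program names registers and
arrays by numerals, so it uses finitely many of them; the cells of an array are addressed
indirectly, through registers. The only arithmetic is adding and subtracting one, so that in `t`
steps no number exceeds `t` plus the largest number in the program and its input: unit cost per
step hides no work in long numbers. -/

namespace RAM

/-- The memory of the machine. -/
structure State where
  reg : ℕ → ℕ
  arr : ℕ → ℕ → ℕ

/-- Tests on two registers. -/
inductive Test where
  | eq (r s : ℕ)
  | lt (r s : ℕ)

/-- The outcome of a test. -/
def Test.Holds : Test → State → Prop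
  | .eq r s, σ => σ.reg r = σ.reg s
  | .lt r s, σ => σ.reg r < σ.reg s

/-- Basic instructions. -/
inductive Instr where
  /-- `r := k` for a literal `k` -/
  | const (r k : ℕ)
  /-- `r := s` -/
  | copy (r s : ℕ)
  /-- `r := r + 1` -/
  | inc (r : ℕ)
  /-- `r := max (r - 1) 0` -/
  | dec (r : ℕ)
  /-- `r := a[s]` -/
  | load (r a s : ℕ)
  /-- `a[s] := r` -/
  | store (a s r : ℕ)

/-- Overwrite register `r`. -/
def State.setReg (σ : State) (r x : ℕ) : State :=
  { σ with reg := Function.update σ.reg r x }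

/-- Overwrite cell `i` of array `a`. -/
def State.setArr (σ : State) (a i x : ℕ) : State :=
  { σ with arr := Function.update σ.arr a (Function.update (σ.arr a) i x) }

/-- The effect of a basic instruction. -/
def Instr.apply : Instr → State → State
  | .const r k, σ => σ.setReg r k
  | .copy r s, σ => σ.setReg r (σ.reg s)
  | .inc r, σ => σ.setReg r (σ.reg r + 1)
  | .dec r, σ => σ.setReg r (σ.reg r - 1)
  | .load r a s, σ => σ.setReg r (σ.arr a (σ.reg s))
  | .store a s r, σ => σ.setArr a (σ.reg s) (σ.reg r)

/-- Programs. -/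
inductive Program where
  | instr (i : Instr)
  | seq (P Q : Program)
  | ite (b : Test) (P Q : Program)
  | while (b : Test) (P : Program)

/-- `Exec P σ t τ`: the program `P`, started in `σ`, halts after exactly `t` steps in `τ`. Each
basic instruction and each evaluation of a test is one step. -/
inductive Exec : Program → State → ℕ → State → Prop
  | instr (i : Instr) (σ : State) : Exec (.instr i) σ 1 (i.apply σ)
  | seq {P Q : Program} {σ τ ρ : State} {t u : ℕ} :
      Exec P σ t τ → Exec Q τ u ρ → Exec (.seq P Q) σ (t + u) ρ
  | ite_true {b : Test} {P Q : Program} {σ τ : State} {t : ℕ} :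
      b.Holds σ → Exec P σ t τ → Exec (.ite b P Q) σ (1 + t) τ
  | ite_false {b : Test} {P Q : Program} {σ τ : State} {t : ℕ} :
      ¬ b.Holds σ → Exec Q σ t τ → Exec (.ite b P Q) σ (1 + t) τ
  | while_true {b : Test} {P : Program} {σ τ ρ : State} {t u : ℕ} :
      b.Holds σ → Exec P σ t τ → Exec (.while b P) τ u ρ → Exec (.while b P) σ (1 + t + u) ρ
  | while_false {b : Test} {P : Program} {σ : State} :
      ¬ b.Holds σ → Exec (.while b P) σ 1 σ

/-- `l` lists the edges of `G`, each exactly once, in any order and each with any orientation. -/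
def IsEdgeList {n : ℕ} (G : SimpleGraph (Fin n)) (l : List (Fin n × Fin n)) : Prop :=
  (l.map fun e => s(e.1, e.2)).Nodup ∧ ∀ u v : Fin n, G.Adj u v ↔ s(u, v) ∈ l.map fun e => s(e.1, e.2)

/-- The initial state on a graph with vertices `0, …, n - 1` given by the edge list `l`: register 0
holds the number of vertices, register 1 the number of edges, and cell `i` of arrays 0 and 1 hold
the two ends of the `i`-th edge. Everything else is `0`. -/
def input (n : ℕ) (l : List (Fin n × Fin n)) : State where
  reg
    | 0 => n
    | 1 => l.length
    | _ => 0
  arr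
    | 0, i => (l.map fun e => (e.1 : ℕ)).getD i 0
    | 1, i => (l.map fun e => (e.2 : ℕ)).getD i 0
    | _, _ => 0

end RAM

/-! The inequalities between the three numbers in one direction are immediate, since each kind of
strategy is also one of the weaker kind. So it suffices to find one number `k` such that no strategy
with multisets of guards has order below `k`, while `k` guards suffice with single occupation and
eviction. `LowerBound` and `UpperBound` express the two halves for an arbitrary move relation on a
set of vertices, because the graphs met on the way need not be subgraphs of the given one.

The number `k` is found by cutting off pieces that hang at a vertex `p`, where all vertices of a
piece other than `p` carry at most one pendant. A neighbour of `p` across a bridge that carries a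
pendant is removed together with it, at the price of one guard. On a cycle through `p`, each vertex
with a pendant can be removed with its pendant, which shortens the cycle and costs one guard; three
consecutive vertices without pendants also cost one guard; if one or two vertices without pendants
are left over, they are worth a single pendant at `p`. So a cycle costs its number of pendants plus
a third, rounded down, of its number of vertices without pendant, and it leaves a pendant at `p` iff
the latter number is not divisible by three.

For the lower bounds a set `H` that contains a closed neighbourhood always holds a guard; this guard
is dropped and `H` is contracted (`LowerBound.contract`), which is used in `LowerBound.remove_one`
and `LowerBound.remove_zeros`. For the upper bounds strategies are extended back over the removed
pieces (`UpperBound.attach`, `UpperBound.subdivide`, `UpperBound.triangle`, `UpperBound.glue`,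
`UpperBound.glue_cycle`). Here eviction is the right strengthening of the induction hypothesis: an
edge can be subdivided because both its ends can be cleared, and two strategies can be glued at a
vertex because that vertex can be both occupied and cleared. The single vertex, where eviction
fails, is carried along as an exception in `WeakUpperBound`.

The order of the reductions comes from a depth-first search (`Search`, with the invariant
`Search.Inv`), in which a vertex is reduced when it is finished. That an edge lies on at most one
cycle means that at most one open cycle passes through a vertex of the stack and its parent. That a
vertex lies in at most two blocks means that it receives at most one pendant, or two at the root. At
the end a path with one, two or three vertices remains, which needs 1, 1 or 2 guards (`Inv.final`).

For an open cycle only the number of its vertices without pendant modulo three and a running total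
are needed, so a machine performs each step of the search in constant time (`Holds.step`), and there
are linearly many steps. -/

/-! ### Guards on a move relation -/

namespace Guards

variable {W : Type*}

/-- If the partners of `x` and `y` may be matched with each other, `x` and `y` can be dropped. -/
theorem rel_of_rel_cons {r r' : W → W → Prop} {x y : W} {C D : Multiset W}
    (h : Multiset.Rel r' (x ::ₘ C) (y ::ₘ D)) (hm : ∀ a ∈ C, ∀ b ∈ D, r' a b → r a b)
    (hxy : ∀ a ∈ C, ∀ b ∈ D, r' x b → r' a y → r a b) : Multiset.Rel r C D := by
  obtain ⟨b, D', hb, hD', he⟩ := Multiset.rel_cons_left.1 h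
  rcases Multiset.cons_eq_cons.1 he with ⟨rfl, rfl⟩ | ⟨-, E, rfl, rfl⟩
  · exact hD'.mono hm
  · obtain ⟨a, C', ha, hC', rfl⟩ := Multiset.rel_cons_right.1 hD'
    exact Multiset.Rel.cons (hxy a (Multiset.mem_cons_self _ _) b (Multiset.mem_cons_self _ _) hb ha)
      (hC'.mono fun u hu v hv => hm u (Multiset.mem_cons_of_mem hu) v (Multiset.mem_cons_of_mem hv))

/-- Every strategy on `A` that defends against vertex attacks has order at least `k`. -/
def LowerBound (r : W → W → Prop) (A : Set W) (k : ℕ) : Prop :=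
  ∀ (S : Set (Multiset W)) (j : ℕ), S.Nonempty → (∀ C ∈ S, C.card = j) →
    (∀ C ∈ S, ∀ x ∈ C, x ∈ A) →
    (∀ C ∈ S, ∀ v ∈ A, ∃ C' ∈ S, Multiset.Rel r C C' ∧ v ∈ C') → k ≤ j

/-- `S` is a strategy of order `k` on `A` without multiple guards which defends against vertex
attacks and evicts the vertices of `A` and the pairs in `F`. -/
structure IsEvictionStrategy (r : W → W → Prop) (A : Set W) (F : W → W → Prop) (k : ℕ)
    (S : Set (Multiset W)) : Prop where
  nonempty : S.Nonempty
  card : ∀ C ∈ S, C.card = k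
  nodup : ∀ C ∈ S, C.Nodup
  sub : ∀ C ∈ S, ∀ x ∈ C, x ∈ A
  defend : ∀ C ∈ S, ∀ v ∈ A, ∃ C' ∈ S, Multiset.Rel r C C' ∧ v ∈ C'
  evict : ∀ C ∈ S, ∀ v ∈ A, ∃ C' ∈ S, Multiset.Rel r C C' ∧ v ∉ C'
  evictPair : ∀ C ∈ S, ∀ u v, F u v → ∃ C' ∈ S, Multiset.Rel r C C' ∧ u ∉ C' ∧ v ∉ C'

/-- `k` guards suffice for a strategy with eviction. -/
def UpperBound (r : W → W → Prop) (A : Set W) (F : W → W → Prop) (k : ℕ) : Prop :=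
  ∃ S, IsEvictionStrategy r A F k S

/-- As `UpperBound`, but a single guard is admitted on a single vertex. -/
def WeakUpperBound (r : W → W → Prop) (A : Set W) (F : W → W → Prop) (k : ℕ) : Prop :=
  UpperBound r A F k ∨ (k = 1 ∧ ∃ a, A = {a})

theorem UpperBound.mono_pairs {r : W → W → Prop} {A : Set W} {F F' : W → W → Prop} {k : ℕ}
    (h : UpperBound r A F k) (hF : ∀ x y, F' x y → F x y) : UpperBound r A F' k := by
  obtain ⟨S, hS⟩ := h
  exact ⟨S, hS.1, hS.2, hS.3, hS.4, hS.5, hS.6, fun C hC u v huv => hS.7 C hC u v (hF u v huv)⟩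

theorem WeakUpperBound.mono_pairs {r : W → W → Prop} {A : Set W} {F F' : W → W → Prop} {k : ℕ}
    (h : WeakUpperBound r A F k) (hF : ∀ x y, F' x y → F x y) : WeakUpperBound r A F' k :=
  h.imp_left fun h => h.mono_pairs hF

/-! ### Lower bounds -/

/-- Guards are pushed forward along `f`. As `f` need not be injective, several guards may land on
one vertex; this is why lower bounds are about multisets. -/
theorem LowerBound.of_hom {r r' : W → W → Prop} {A A' : Set W} {k : ℕ} (h : LowerBound r A k)
    (f : W → W) (hf : ∀ x ∈ A', f x ∈ A) (hr : ∀ x ∈ A', ∀ y ∈ A', r' x y → r (f x) (f y))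
    (hs : ∀ v ∈ A, ∃ w ∈ A', f w = v) : LowerBound r' A' k := by
  intro S j hne hcard hsub hdef
  refine h (Multiset.map f '' S) j (hne.image _) ?_ ?_ ?_
  · rintro _ ⟨C, hC, rfl⟩
    rw [Multiset.card_map, hcard C hC]
  · rintro _ ⟨C, hC, rfl⟩ x hx
    obtain ⟨y, hy, rfl⟩ := Multiset.mem_map.1 hx
    exact hf y (hsub C hC y hy)
  · rintro _ ⟨C, hC, rfl⟩ v hv
    obtain ⟨w, hw, rfl⟩ := hs v hv
    obtain ⟨C', hC', hrel, hmem⟩ := hdef C hC w hw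
    exact ⟨_, ⟨C', hC', rfl⟩, Multiset.rel_map.2 (hrel.mono fun a ha b hb =>
      hr a (hsub C hC a ha) b (hsub C' hC' b hb)), Multiset.mem_map_of_mem f hmem⟩

/-- A set `H` that always holds a guard can be contracted, together with one of its guards, if the
closed neighbourhood of `H` goes to a clique. -/
theorem LowerBound.contract {r r' : W → W → Prop} {A A' : Set W} {k : ℕ} (h : LowerBound r A k)
    (f : W → W) (H : Set W) (v : W) (hv : v ∈ A') (hvH : ∀ x ∈ A', r' x v → x ∈ H)
    (hf : ∀ x ∈ A', f x ∈ A) (hr : ∀ x ∈ A', ∀ y ∈ A', r' x y → r (f x) (f y))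
    (hH : ∀ g ∈ H, ∀ g' ∈ H, ∀ x ∈ A', ∀ y ∈ A', r' g y → r' x g' → r (f x) (f y))
    (hs : ∀ v ∈ A, ∃ w ∈ A', w ∉ H ∧ f w = v) : LowerBound r' A' (k + 1) := by
  intro S j hne hcard hsub hdef
  -- An attack on `v` can only be answered by a guard that stood in the closed neighbourhood of `v`,
  -- hence in `H`.
  have hguard : ∀ C ∈ S, ∃ g ∈ H, ∃ C₁, C = g ::ₘ C₁ := by
    intro C hC
    obtain ⟨C', hC', hrel, hmem⟩ := hdef C hC v hv
    obtain ⟨C₂, rfl⟩ := Multiset.exists_cons_of_mem hmem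
    obtain ⟨g, C₁, hg, -, rfl⟩ := Multiset.rel_cons_right.1 hrel
    exact ⟨g, hvH g (hsub _ hC g (Multiset.mem_cons_self _ _)) hg, C₁, rfl⟩
  have hj : 0 < j := by
    obtain ⟨C, hC⟩ := hne
    obtain ⟨g, -, C₁, rfl⟩ := hguard C hC
    rw [← hcard _ hC]; simp
  -- All ways of choosing the dropped guard in `H` are admitted at once, so the choices made in
  -- consecutive configurations need not fit together.
  have := h {D | ∃ g ∈ H, ∃ C₁, g ::ₘ C₁ ∈ S ∧ D = C₁.map f} (j - 1) ?_ ?_ ?_ ?_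
  · omega
  · obtain ⟨C, hC⟩ := hne
    obtain ⟨g, hg, C₁, rfl⟩ := hguard C hC
    exact ⟨_, g, hg, C₁, hC, rfl⟩
  · rintro _ ⟨g, hg, C₁, hC, rfl⟩
    have := hcard _ hC
    rw [Multiset.card_cons] at this
    rw [Multiset.card_map]; omega
  · rintro _ ⟨g, hg, C₁, hC, rfl⟩ x hx
    obtain ⟨y, hy, rfl⟩ := Multiset.mem_map.1 hx
    exact hf y (hsub _ hC y (Multiset.mem_cons_of_mem hy))
  · rintro _ ⟨g, hg, C₁, hC, rfl⟩ w hw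
    obtain ⟨w', hw', hwH, rfl⟩ := hs w hw
    obtain ⟨C', hC', hrel, hmem⟩ := hdef _ hC w' hw'
    obtain ⟨g', hg', C₂, rfl⟩ := hguard C' hC'
    refine ⟨_, ⟨g', hg', C₂, hC', rfl⟩, ?_, ?_⟩
    · have h1 : ∀ x ∈ C₁, x ∈ A' := fun x hx => hsub _ hC x (Multiset.mem_cons_of_mem hx)
      have h2 : ∀ x ∈ C₂, x ∈ A' := fun x hx => hsub _ hC' x (Multiset.mem_cons_of_mem hx)
      exact Multiset.rel_map.2 (rel_of_rel_cons hrel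
        (fun a ha b hb => hr a (h1 a ha) b (h2 b hb))
        fun a ha b hb => hH g hg g' hg' a (h1 a ha) b (h2 b hb))
    · refine Multiset.mem_map_of_mem f ?_
      -- The attacked vertex was pulled back to a vertex outside `H`, so the guard that answers is
      -- not the dropped one.
      rcases Multiset.mem_cons.1 hmem with rfl | h
      · exact absurd hg' hwH
      · exact h

theorem LowerBound.one {r : W → W → Prop} {A : Set W} {a : W} (ha : a ∈ A) :
    LowerBound r A 1 := by
  intro S j ⟨C, hC⟩ hcard hsub hdef
  obtain ⟨C', hC', -, hmem⟩ := hdef C hC a ha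
  rw [← hcard C' hC']
  exact Multiset.card_pos_iff_exists_mem.2 ⟨a, hmem⟩

/-! ### Upper bounds -/

/-- The move relation is not assumed to be reflexive, so standing still is not available. Any attack
provides a move, and an empty `A` leaves only the empty configuration. -/
theorem IsEvictionStrategy.exists_rel {r : W → W → Prop} {A : Set W} {F : W → W → Prop} {k : ℕ}
    {S : Set (Multiset W)} (hS : IsEvictionStrategy r A F k S) {C : Multiset W} (hC : C ∈ S) :
    ∃ C' ∈ S, Multiset.Rel r C C' := by
  by_cases hA : A.Nonempty
  · obtain ⟨a, ha⟩ := hA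
    obtain ⟨C', hC', h1, -⟩ := hS.defend C hC a ha
    exact ⟨C', hC', h1⟩
  · have : C = 0 := Multiset.eq_zero_of_forall_notMem fun x hx => hA ⟨x, hS.sub C hC x hx⟩
    exact ⟨C, hC, by rw [this]; exact Multiset.Rel.zero⟩

/-- Injectivity is needed twice: no two guards meet in the image, and a guard on `f v` can only come
from `v`, so that eviction carries over. -/
theorem UpperBound.image {r r' : W → W → Prop} {A A' : Set W} {F F' : W → W → Prop} {k : ℕ}
    (h : UpperBound r A F k) (f : W → W) (hf : Set.InjOn f A) (hA : A' = f '' A)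
    (hr : ∀ x ∈ A, ∀ y ∈ A, r x y → r' (f x) (f y))
    (hF : ∀ x y, F' x y → ∃ x₀ ∈ A, ∃ y₀ ∈ A, F x₀ y₀ ∧ f x₀ = x ∧ f y₀ = y) :
    UpperBound r' A' F' k := by
  obtain ⟨S, hS⟩ := h
  have hmem : ∀ C ∈ S, ∀ x ∈ A, f x ∈ C.map f → x ∈ C := by
    intro C hC x hx hmem
    obtain ⟨y, hy, hxy⟩ := Multiset.mem_map.1 hmem
    rwa [← hf (hS.sub C hC y hy) hx hxy]
  have hrel : ∀ C ∈ S, ∀ C' ∈ S, Multiset.Rel r C C' → Multiset.Rel r' (C.map f) (C'.map f) :=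
    fun C hC C' hC' hr' => Multiset.rel_map.2 (hr'.mono fun a ha b hb =>
      hr a (hS.sub C hC a ha) b (hS.sub C' hC' b hb))
  subst hA
  refine ⟨Multiset.map f '' S, hS.nonempty.image _, ?_, ?_, ?_, ?_, ?_, ?_⟩
  · rintro _ ⟨C, hC, rfl⟩
    rw [Multiset.card_map, hS.card C hC]
  · rintro _ ⟨C, hC, rfl⟩
    exact (hS.nodup C hC).map_on fun x hx y hy =>
      fun h => hf (hS.sub C hC x hx) (hS.sub C hC y hy) h
  · rintro _ ⟨C, hC, rfl⟩ x hx
    obtain ⟨y, hy, rfl⟩ := Multiset.mem_map.1 hx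
    exact ⟨y, hS.sub C hC y hy, rfl⟩
  · rintro _ ⟨C, hC, rfl⟩ _ ⟨v, hv, rfl⟩
    obtain ⟨C', hC', h1, h2⟩ := hS.defend C hC v hv
    exact ⟨_, ⟨C', hC', rfl⟩, hrel C hC C' hC' h1, Multiset.mem_map_of_mem f h2⟩
  · rintro _ ⟨C, hC, rfl⟩ _ ⟨v, hv, rfl⟩
    obtain ⟨C', hC', h1, h2⟩ := hS.evict C hC v hv
    exact ⟨_, ⟨C', hC', rfl⟩, hrel C hC C' hC' h1, fun h => h2 (hmem C' hC' v hv h)⟩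
  · rintro _ ⟨C, hC, rfl⟩ u v huv
    obtain ⟨x, hx, y, hy, hxy, rfl, rfl⟩ := hF u v huv
    obtain ⟨C', hC', h1, h2, h3⟩ := hS.evictPair C hC x y hxy
    exact ⟨_, ⟨C', hC', rfl⟩, hrel C hC C' hC' h1, fun h => h2 (hmem C' hC' x hx h),
      fun h => h3 (hmem C' hC' y hy h)⟩

/-- A path of length one whose first vertex is attached arbitrarily needs one more guard. -/
theorem UpperBound.attach {r r' : W → W → Prop} {A : Set W} {F : W → W → Prop} {k : ℕ}
    (h : UpperBound r A F k) {u l : W} (hu : u ∉ A) (hl : l ∉ A) (hul : u ≠ l)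
    (hr : ∀ x ∈ A, ∀ y ∈ A, r x y → r' x y) (hF : ∀ x y, F x y → x ∈ A ∧ y ∈ A)
    (huu : r' u u) (hll : r' l l) (hul' : r' u l) (hlu : r' l u) :
    UpperBound r' (insert u (insert l A))
      (fun x y => F x y ∨ (x ∈ A ∧ y = u) ∨ (x = u ∧ y ∈ A)) (k + 1) := by
  obtain ⟨S, hS⟩ := h
  have hrel : ∀ C ∈ S, ∀ C' ∈ S, Multiset.Rel r C C' → ∀ e e', (e = u ∨ e = l) →
      (e' = u ∨ e' = l) → Multiset.Rel r' (e ::ₘ C) (e' ::ₘ C') := by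
    intro C hC C' hC' h e e' he he'
    refine Multiset.Rel.cons ?_ (h.mono fun a ha b hb =>
      hr a (hS.sub C hC a ha) b (hS.sub C' hC' b hb))
    rcases he with rfl | rfl <;> rcases he' with rfl | rfl <;> assumption
  have hnu : ∀ C ∈ S, u ∉ C := fun C hC h => hu (hS.sub C hC u h)
  have hnl : ∀ C ∈ S, l ∉ C := fun C hC h => hl (hS.sub C hC l h)
  -- The extra guard moves along the edge from `u` to `l` independently of the others. So `u` can be
  -- cleared in the same move as any one vertex of `A`.
  refine ⟨{D | ∃ C ∈ S, ∃ e, (e = u ∨ e = l) ∧ D = e ::ₘ C}, ?_, ?_, ?_, ?_, ?_, ?_, ?_⟩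
  · obtain ⟨C, hC⟩ := hS.nonempty
    exact ⟨_, C, hC, u, Or.inl rfl, rfl⟩
  · rintro _ ⟨C, hC, e, he, rfl⟩
    rw [Multiset.card_cons, hS.card C hC]
  · rintro _ ⟨C, hC, e, he, rfl⟩
    refine Multiset.nodup_cons.2 ⟨?_, hS.nodup C hC⟩
    rcases he with rfl | rfl
    exacts [hnu C hC, hnl C hC]
  · rintro _ ⟨C, hC, e, he, rfl⟩ x hx
    rcases Multiset.mem_cons.1 hx with rfl | hx
    · rcases he with rfl | rfl <;> simp
    · exact Set.mem_insert_of_mem _ (Set.mem_insert_of_mem _ (hS.sub C hC x hx))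
  · rintro _ ⟨C, hC, e, he, rfl⟩ v hv
    rcases hv with rfl | rfl | hv
    · obtain ⟨a, ha⟩ := hS.exists_rel hC
      exact ⟨_, ⟨a, ha.1, v, Or.inl rfl, rfl⟩, hrel C hC a ha.1 ha.2 e v he (Or.inl rfl), by simp⟩
    · obtain ⟨a, ha⟩ := hS.exists_rel hC
      exact ⟨_, ⟨a, ha.1, v, Or.inr rfl, rfl⟩, hrel C hC a ha.1 ha.2 e v he (Or.inr rfl), by simp⟩
    · obtain ⟨C', hC', h1, h2⟩ := hS.defend C hC v hv
      exact ⟨_, ⟨C', hC', u, Or.inl rfl, rfl⟩, hrel C hC C' hC' h1 e u he (Or.inl rfl),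
        Multiset.mem_cons_of_mem h2⟩
  · rintro _ ⟨C, hC, e, he, rfl⟩ v hv
    obtain ⟨a, ha⟩ := hS.exists_rel hC
    rcases hv with rfl | rfl | hv
    · exact ⟨_, ⟨a, ha.1, l, Or.inr rfl, rfl⟩, hrel C hC a ha.1 ha.2 e l he (Or.inr rfl),
        by simp [hul, hnu a ha.1]⟩
    · exact ⟨_, ⟨a, ha.1, u, Or.inl rfl, rfl⟩, hrel C hC a ha.1 ha.2 e u he (Or.inl rfl),
        by simp [hul.symm, hnl a ha.1]⟩
    · obtain ⟨C', hC', h1, h2⟩ := hS.evict C hC v hv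
      refine ⟨_, ⟨C', hC', u, Or.inl rfl, rfl⟩, hrel C hC C' hC' h1 e u he (Or.inl rfl), ?_⟩
      rw [Multiset.mem_cons]
      rintro (rfl | h)
      exacts [hu hv, h2 h]
  · have key : ∀ C ∈ S, ∀ e, (e = u ∨ e = l) → ∀ v ∈ A,
        ∃ C' ∈ {D | ∃ C ∈ S, ∃ e, (e = u ∨ e = l) ∧ D = e ::ₘ C},
          Multiset.Rel r' (e ::ₘ C) C' ∧ u ∉ C' ∧ v ∉ C' := by
      intro C hC e he v hv
      obtain ⟨C', hC', h1, h2⟩ := hS.evict C hC v hv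
      refine ⟨_, ⟨C', hC', l, Or.inr rfl, rfl⟩, hrel C hC C' hC' h1 e l he (Or.inr rfl), ?_, ?_⟩
      · simp [hul, hnu C' hC']
      · rw [Multiset.mem_cons]
        rintro (rfl | h)
        exacts [hl hv, h2 h]
    rintro _ ⟨C, hC, e, he, rfl⟩ x y (hxy | ⟨hx, rfl⟩ | ⟨rfl, hy⟩)
    · obtain ⟨C', hC', h1, h2, h3⟩ := hS.evictPair C hC x y hxy
      obtain ⟨hx, hy⟩ := hF x y hxy
      refine ⟨_, ⟨C', hC', u, Or.inl rfl, rfl⟩, hrel C hC C' hC' h1 e u he (Or.inl rfl), ?_, ?_⟩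
      · rw [Multiset.mem_cons]
        rintro (rfl | h)
        exacts [hu hx, h2 h]
      · rw [Multiset.mem_cons]
        rintro (rfl | h)
        exacts [hu hy, h3 h]
    · obtain ⟨C', hC', h1, h2, h3⟩ := key C hC e he x hx
      exact ⟨C', hC', h1, h3, h2⟩
    · exact key C hC e he y hy

/-- A guard that would cross the edge between `z` and `z'` goes to `u` instead, while the guard on
`u` goes on to the other end. As no vertex holds two guards, at most one guard crosses in each
direction. -/
theorem rel_cons_of_insert {r : W → W → Prop} {z z' u : W} (hrefl : ∀ x, r x x)
    (hzu : r z u) (huz : r u z) (hzu' : r z' u) (huz' : r u z')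
    {C D : Multiset W} (hC : C.Nodup)
    (h : Multiset.Rel (fun x y => r x y ∨ (x = z ∧ y = z') ∨ (x = z' ∧ y = z)) C D) :
    Multiset.Rel r (u ::ₘ C) (u ::ₘ D) := by
  have hno : ∀ {C D : Multiset W}, z ∉ C → z' ∉ C →
      Multiset.Rel (fun x y => r x y ∨ (x = z ∧ y = z') ∨ (x = z' ∧ y = z)) C D →
      Multiset.Rel r C D := by
    intro C D h1 h2 h
    refine h.mono fun a ha b _ hab => ?_
    rcases hab with h | ⟨rfl, -⟩ | ⟨rfl, -⟩
    exacts [h, absurd ha h1, absurd ha h2]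
  have pass : ∀ {x y : W} {C D : Multiset W}, r x u → r u y → Multiset.Rel r C D →
      Multiset.Rel r (u ::ₘ x ::ₘ C) (u ::ₘ y ::ₘ D) := by
    intro x y C D hx hy h
    rw [Multiset.cons_swap u y]
    exact Multiset.Rel.cons hy (Multiset.Rel.cons hx h)
  by_cases hz : z ∈ C
  · obtain ⟨C₁, rfl⟩ := Multiset.exists_cons_of_mem hz
    obtain ⟨b, D₁, hb, hD₁, rfl⟩ := Multiset.rel_cons_left.1 h
    obtain ⟨hzC, hC₁⟩ := Multiset.nodup_cons.1 hC
    by_cases hz' : z' ∈ C₁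
    · obtain ⟨C₂, rfl⟩ := Multiset.exists_cons_of_mem hz'
      obtain ⟨b', D₂, hb', hD₂, rfl⟩ := Multiset.rel_cons_left.1 hD₁
      have h2 := hno (fun h => hzC (Multiset.mem_cons_of_mem h)) (Multiset.nodup_cons.1 hC₁).1 hD₂
      have hb1 : r z b ∨ b = z' := by
        rcases hb with h | ⟨-, h⟩ | ⟨-, rfl⟩
        exacts [Or.inl h, Or.inr h, Or.inl (hrefl _)]
      have hb2 : r z' b' ∨ b' = z := by
        rcases hb' with h | ⟨-, rfl⟩ | ⟨-, h⟩
        exacts [Or.inl h, Or.inl (hrefl _), Or.inr h]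
      rcases hb1 with hb1 | rfl <;> rcases hb2 with hb2 | rfl
      · exact Multiset.Rel.cons (hrefl u) (Multiset.Rel.cons hb1 (Multiset.Rel.cons hb2 h2))
      · rw [Multiset.cons_swap b' z', Multiset.cons_swap b b']
        exact pass hzu' huz (Multiset.Rel.cons hb1 h2)
      · exact pass hzu huz' (Multiset.Rel.cons hb2 h2)
      -- If two guards cross in opposite directions, both may as well stay.
      · rw [Multiset.cons_swap b' b]
        exact Multiset.Rel.cons (hrefl u) (Multiset.Rel.cons (hrefl _) (Multiset.Rel.cons (hrefl _) h2))
    · have h1 := hno hzC hz' hD₁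
      rcases hb with h | ⟨-, rfl⟩ | ⟨-, rfl⟩
      · exact Multiset.Rel.cons (hrefl u) (Multiset.Rel.cons h h1)
      · exact pass hzu huz' h1
      · exact pass hzu huz h1
  · by_cases hz' : z' ∈ C
    · obtain ⟨C₁, rfl⟩ := Multiset.exists_cons_of_mem hz'
      obtain ⟨b, D₁, hb, hD₁, rfl⟩ := Multiset.rel_cons_left.1 h
      have h1 := hno (fun h => hz (Multiset.mem_cons_of_mem h)) (Multiset.nodup_cons.1 hC).1 hD₁
      rcases hb with h | ⟨rfl, -⟩ | ⟨-, rfl⟩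
      · exact Multiset.Rel.cons (hrefl u) (Multiset.Rel.cons h h1)
      · exact absurd (Multiset.mem_cons_self _ _) hz
      · exact pass hzu' huz h1
    · exact Multiset.Rel.cons (hrefl u) (hno hz hz' h)

/-- Subdividing an edge that can be evicted by a vertex `u` with a pendant `l` needs one more
guard. -/
theorem UpperBound.subdivide {r r' : W → W → Prop} {A : Set W} {F : W → W → Prop} {k : ℕ}
    {z z' u l : W} (h : UpperBound r' A F k) (hF : ∀ x y, F x y → x ∈ A ∧ y ∈ A) (hz : F z z')
    (hr : ∀ x ∈ A, ∀ y ∈ A, r' x y → r x y ∨ (x = z ∧ y = z') ∨ (x = z' ∧ y = z))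
    (hu : u ∉ A) (hl : l ∉ A) (hul : u ≠ l) (hrefl : ∀ x, r x x)
    (hzu : r z u) (huz : r u z) (hzu' : r z' u) (huz' : r u z') (rul : r u l) (rlu : r l u) :
    UpperBound r (insert u (insert l A))
      (fun x y => F x y ∨ (x = z ∧ y = u) ∨ (x = u ∧ y = z')) (k + 1) := by
  obtain ⟨S, hS⟩ := h
  have hnu : ∀ C ∈ S, u ∉ C := fun C hC h => hu (hS.sub C hC u h)
  have hnl : ∀ C ∈ S, l ∉ C := fun C hC h => hl (hS.sub C hC l h)
  have hrel : ∀ C ∈ S, ∀ C' ∈ S, Multiset.Rel r' C C' →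
      Multiset.Rel (fun x y => r x y ∨ (x = z ∧ y = z') ∨ (x = z' ∧ y = z)) C C' :=
    fun C hC C' hC' h => h.mono fun a ha b hb =>
      hr a (hS.sub C hC a ha) b (hS.sub C' hC' b hb)
  have huu : ∀ C ∈ S, ∀ C' ∈ S, Multiset.Rel r' C C' →
      Multiset.Rel r (u ::ₘ C) (u ::ₘ C') := fun C hC C' hC' h =>
    rel_cons_of_insert hrefl hzu huz hzu' huz' (hS.nodup C hC) (hrel C hC C' hC' h)
  have hfrom : ∀ C ∈ S, z ∉ C → z' ∉ C → ∀ C' ∈ S, Multiset.Rel r' C C' → ∀ e e', r e e' →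
      Multiset.Rel r (e ::ₘ C) (e' ::ₘ C') := by
    intro C hC h1 h2 C' hC' h e e' he
    refine Multiset.Rel.cons he ((hrel C hC C' hC' h).mono fun a ha b _ hab => ?_)
    rcases hab with h | ⟨rfl, -⟩ | ⟨rfl, -⟩
    exacts [h, absurd ha h1, absurd ha h2]
  have hto : ∀ C ∈ S, ∀ C' ∈ S, z ∉ C' → z' ∉ C' → Multiset.Rel r' C C' → ∀ e e', r e e' →
      Multiset.Rel r (e ::ₘ C) (e' ::ₘ C') := by
    intro C hC C' hC' h1 h2 h e e' he
    refine Multiset.Rel.cons he ((hrel C hC C' hC' h).mono fun a _ b hb hab => ?_)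
    rcases hab with h | ⟨-, rfl⟩ | ⟨-, rfl⟩
    exacts [h, absurd hb h2, absurd hb h1]
  -- The extra guard may stand on `l` only while both ends of the subdivided edge are empty. Then
  -- nobody crosses this edge in the move before or after, so no help from `u` is needed. Such
  -- configurations are reached by evicting the pair `z`, `z'`.
  set T : Set (Multiset W) :=
    {D | ∃ C ∈ S, ∃ e, (e = u ∨ (e = l ∧ z ∉ C ∧ z' ∉ C)) ∧ D = e ::ₘ C} with hT
  have hmu : ∀ C ∈ S, u ::ₘ C ∈ T := fun C hC => ⟨C, hC, u, Or.inl rfl, rfl⟩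
  have hml : ∀ C ∈ S, z ∉ C → z' ∉ C → l ::ₘ C ∈ T :=
    fun C hC h h' => ⟨C, hC, l, Or.inr ⟨rfl, h, h'⟩, rfl⟩
  have tou : ∀ C ∈ S, ∀ e, (e = u ∨ (e = l ∧ z ∉ C ∧ z' ∉ C)) → ∀ C' ∈ S, Multiset.Rel r' C C' →
      Multiset.Rel r (e ::ₘ C) (u ::ₘ C') := by
    rintro C hC e (rfl | ⟨rfl, h1, h2⟩) C' hC' h
    · exact huu C hC C' hC' h
    · exact hfrom C hC h1 h2 C' hC' h _ _ rlu
  have tol : ∀ C ∈ S, ∀ e, (e = u ∨ (e = l ∧ z ∉ C ∧ z' ∉ C)) →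
      ∃ C' ∈ S, z ∉ C' ∧ z' ∉ C' ∧ Multiset.Rel r (e ::ₘ C) (l ::ₘ C') := by
    intro C hC e he
    obtain ⟨C', hC', h1, h2, h3⟩ := hS.evictPair C hC z z' hz
    refine ⟨C', hC', h2, h3, hto C hC C' hC' h2 h3 h1 e l ?_⟩
    rcases he with rfl | ⟨rfl, -⟩
    exacts [rul, hrefl _]
  have hzz := hF z z' hz
  have hne : ∀ v ∈ A, v ≠ u ∧ v ≠ l := fun v hv => ⟨fun h => hu (h ▸ hv), fun h => hl (h ▸ hv)⟩
  refine ⟨T, ?_, ?_, ?_, ?_, ?_, ?_, ?_⟩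
  · obtain ⟨C, hC⟩ := hS.nonempty
    exact ⟨_, hmu C hC⟩
  · rintro _ ⟨C, hC, e, he, rfl⟩
    rw [Multiset.card_cons, hS.card C hC]
  · rintro _ ⟨C, hC, e, he, rfl⟩
    refine Multiset.nodup_cons.2 ⟨?_, hS.nodup C hC⟩
    rcases he with rfl | ⟨rfl, -⟩
    exacts [hnu C hC, hnl C hC]
  · rintro _ ⟨C, hC, e, he, rfl⟩ x hx
    rcases Multiset.mem_cons.1 hx with rfl | hx
    · rcases he with rfl | ⟨rfl, -⟩ <;> simp
    · exact Set.mem_insert_of_mem _ (Set.mem_insert_of_mem _ (hS.sub C hC x hx))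
  · rintro _ ⟨C, hC, e, he, rfl⟩ v (rfl | rfl | hv)
    · obtain ⟨C', hC', h1⟩ := hS.exists_rel hC
      exact ⟨_, hmu C' hC', tou C hC e he C' hC' h1, by simp⟩
    · obtain ⟨C', hC', h1, h2, h3⟩ := tol C hC e he
      exact ⟨_, hml C' hC' h1 h2, h3, by simp⟩
    · obtain ⟨C', hC', h1, h2⟩ := hS.defend C hC v hv
      exact ⟨_, hmu C' hC', tou C hC e he C' hC' h1, by simp [h2]⟩
  · rintro _ ⟨C, hC, e, he, rfl⟩ v (rfl | rfl | hv)
    · obtain ⟨C', hC', h1, h2, h3⟩ := tol C hC e he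
      exact ⟨_, hml C' hC' h1 h2, h3, by simp [hul, hnu C' hC']⟩
    · obtain ⟨C', hC', h1⟩ := hS.exists_rel hC
      exact ⟨_, hmu C' hC', tou C hC e he C' hC' h1, by simp [hul.symm, hnl C' hC']⟩
    · obtain ⟨C', hC', h1, h2⟩ := hS.evict C hC v hv
      exact ⟨_, hmu C' hC', tou C hC e he C' hC' h1, by simp [h2, hne v hv]⟩
  · rintro _ ⟨C, hC, e, he, rfl⟩ x y (hxy | ⟨rfl, rfl⟩ | ⟨rfl, rfl⟩)
    · obtain ⟨C', hC', h1, h2, h3⟩ := hS.evictPair C hC x y hxy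
      have := hF x y hxy
      exact ⟨_, hmu C' hC', tou C hC e he C' hC' h1, by simp [h2, hne x this.1],
        by simp [h3, hne y this.2]⟩
    · obtain ⟨C', hC', h1, h2, h3⟩ := tol C hC e he
      exact ⟨_, hml C' hC' h1 h2, h3, by simp [h1, hne _ hzz.1], by simp [hul, hnu C' hC']⟩
    · obtain ⟨C', hC', h1, h2, h3⟩ := tol C hC e he
      exact ⟨_, hml C' hC' h1 h2, h3, by simp [hul, hnu C' hC'], by simp [h2, hne _ hzz.2]⟩

/-- A pendant `y` at `a` can be replaced by a triangle `a, y, u` with a pendant `l` at `u`. -/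
theorem UpperBound.triangle {r r' : W → W → Prop} {A : Set W} {F : W → W → Prop} {k : ℕ}
    {a y u l : W} (h : UpperBound r' (insert y A) F k) (ha : a ∈ A) (hy : y ∉ A)
    (hF : ∀ x y, F x y → x ∈ A ∧ y ∈ A)
    (hr : ∀ x ∈ insert y A, ∀ y' ∈ insert y A, r' x y' → r x y')
    (hfrom : ∀ x ∈ insert y A, r' y x → x = a ∨ x = y)
    (hto : ∀ x ∈ insert y A, r' x y → x = a ∨ x = y)
    (huA : u ∉ A) (hlA : l ∉ A) (huy : u ≠ y) (hly : l ≠ y) (hul : u ≠ l) (hrefl : ∀ x, r x x)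
    (rua : r u a) (rau : r a u) (ruy : r u y) (ryu : r y u) (rul : r u l) (rlu : r l u) :
    UpperBound r (insert u (insert l (insert y A))) (fun x x' => F x x' ∨ (x = a ∧ x' = y) ∨
      (x = y ∧ x' = a) ∨ (x = y ∧ x' = u) ∨ (x = u ∧ x' = y) ∨ (x = u ∧ x' = a) ∨
      (x = a ∧ x' = u)) (k + 1) := by
  obtain ⟨S, hS⟩ := h
  have hnu : ∀ C ∈ S, u ∉ C := fun C hC h => (hS.sub C hC u h).elim huy huA
  have hnl : ∀ C ∈ S, l ∉ C := fun C hC h => (hS.sub C hC l h).elim hly hlA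
  have hne : ∀ v ∈ A, v ≠ u ∧ v ≠ l := fun v hv => ⟨fun h => huA (h ▸ hv), fun h => hlA (h ▸ hv)⟩
  have hay : a ≠ y := fun h => hy (h ▸ ha)
  have hrel : ∀ C ∈ S, ∀ C' ∈ S, Multiset.Rel r' C C' → Multiset.Rel r C C' :=
    fun C hC C' hC' h => h.mono fun a ha b hb =>
      hr a (hS.sub C hC a ha) b (hS.sub C' hC' b hb)
  have hsub1 : ∀ {x : W} {C : Multiset W}, x ::ₘ C ∈ S → x ∈ insert y A := fun h =>
    hS.sub _ h _ (Multiset.mem_cons_self _ _)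
  -- Besides the configurations with an extra guard on `u` or `l` there are those in which the guard
  -- of `y` stands on `u` and the extra guard on `l`; they leave the edge from `a` to `y` clear.
  set T : Set (Multiset W) := {D | (∃ C ∈ S, ∃ e, (e = u ∨ e = l) ∧ D = e ::ₘ C) ∨
    ∃ C, y ::ₘ C ∈ S ∧ a ∉ C ∧ D = u ::ₘ l ::ₘ C} with hT
  have hm : ∀ C ∈ S, ∀ e, (e = u ∨ e = l) → e ::ₘ C ∈ T :=
    fun C hC e he => Or.inl ⟨C, hC, e, he, rfl⟩
  have ree : ∀ e e', (e = u ∨ e = l) → (e' = u ∨ e' = l) → r e e' := by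
    rintro e e' (rfl | rfl) (rfl | rfl) <;> first | assumption | exact hrefl _
  -- every configuration comes with one of `S` from which the normal ones can be reached
  have step : ∀ D ∈ T, ∃ C ∈ S, ∀ C' ∈ S, Multiset.Rel r' C C' → ∀ e', (e' = u ∨ e' = l) →
      Multiset.Rel r D (e' ::ₘ C') := by
    rintro D (⟨C, hC, e, he, rfl⟩ | ⟨C, hC, haC, rfl⟩)
    · exact ⟨C, hC, fun C' hC' h e' he' => Multiset.Rel.cons (ree e e' he he') (hrel C hC C' hC' h)⟩
    · refine ⟨_, hC, fun C' hC' h e' he' => ?_⟩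
      obtain ⟨b, D', hb, hD', rfl⟩ := Multiset.rel_cons_left.1 h
      rw [Multiset.cons_swap]
      refine Multiset.Rel.cons (ree l e' (Or.inr rfl) he') (Multiset.Rel.cons ?_ ?_)
      · rcases hfrom b (hsub1 hC') hb with rfl | rfl
        exacts [rua, ruy]
      · exact hD'.mono fun x hx x' hx' h =>
          hr x (hS.sub _ hC x (Multiset.mem_cons_of_mem hx)) x'
            (hS.sub _ hC' x' (Multiset.mem_cons_of_mem hx')) h
  have special : ∀ D ∈ T, ∃ D' ∈ T, Multiset.Rel r D D' ∧ a ∉ D' ∧ y ∉ D' := by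
    rintro D (⟨C, hC, e, he, rfl⟩ | ⟨C, hC, haC, rfl⟩)
    · obtain ⟨C', hC', h1, h2⟩ := hS.evict C hC a (Set.mem_insert_of_mem _ ha)
      -- The vertex `y` may be attacked next and is within reach of `a` and itself only. As `a` is
      -- empty, `y` is occupied.
      have hyC' : y ∈ C' := by
        obtain ⟨C'', hC'', h3, h4⟩ := hS.defend C' hC' y (Set.mem_insert _ _)
        obtain ⟨E, rfl⟩ := Multiset.exists_cons_of_mem h4
        obtain ⟨x, E', hx, -, rfl⟩ := Multiset.rel_cons_right.1 h3
        rcases hto x (hsub1 hC') hx with rfl | rfl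
        · exact absurd (Multiset.mem_cons_self _ _) h2
        · exact Multiset.mem_cons_self _ _
      obtain ⟨E, rfl⟩ := Multiset.exists_cons_of_mem hyC'
      have haE : a ∉ E := fun h => h2 (Multiset.mem_cons_of_mem h)
      have hyE : y ∉ E := (Multiset.nodup_cons.1 (hS.nodup _ hC')).1
      refine ⟨u ::ₘ l ::ₘ E, Or.inr ⟨E, hC', haE, rfl⟩, ?_, ?_, ?_⟩
      · obtain ⟨b, C₁, hb, hC₁, rfl⟩ := Multiset.rel_cons_right.1 h1
        rw [Multiset.cons_swap u l]
        refine Multiset.Rel.cons (ree e l he (Or.inr rfl)) (Multiset.Rel.cons ?_ ?_)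
        · rcases hto b (hsub1 hC) hb with rfl | rfl
          exacts [rau, ryu]
        · exact hC₁.mono fun x hx x' hx' h =>
            hr x (hS.sub _ hC x (Multiset.mem_cons_of_mem hx)) x'
              (hS.sub _ hC' x' (Multiset.mem_cons_of_mem hx')) h
      · simp [haE, hne a ha]
      · simp [hyE, huy.symm, hly.symm]
    · have hyC : y ∉ C := (Multiset.nodup_cons.1 (hS.nodup _ hC)).1
      exact ⟨_, Or.inr ⟨C, hC, haC, rfl⟩, Multiset.rel_refl_of_refl_on fun x _ => hrefl x,
        by simp [haC, hne a ha], by simp [hyC, huy.symm, hly.symm]⟩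
  have evictuv : ∀ D ∈ T, ∀ v ∈ insert y A, ∃ D' ∈ T, Multiset.Rel r D D' ∧ u ∉ D' ∧ v ∉ D' := by
    intro D hD v hv
    obtain ⟨C, hC, hstep⟩ := step D hD
    obtain ⟨C', hC', h1, h2⟩ := hS.evict C hC v hv
    refine ⟨_, hm C' hC' l (Or.inr rfl), hstep C' hC' h1 l (Or.inr rfl), ?_, ?_⟩
    · simp [hul, hnu C' hC']
    · have : v ≠ l := by
        rintro rfl
        exact hv.elim hly hlA
      simp [this, h2]
  refine ⟨T, ?_, ?_, ?_, ?_, ?_, ?_, ?_⟩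
  · obtain ⟨C, hC⟩ := hS.nonempty
    exact ⟨_, hm C hC u (Or.inl rfl)⟩
  · rintro _ (⟨C, hC, e, he, rfl⟩ | ⟨C, hC, -, rfl⟩)
    · rw [Multiset.card_cons, hS.card C hC]
    · have := hS.card _ hC
      rw [Multiset.card_cons] at this
      simp [this]
  · rintro _ (⟨C, hC, e, he, rfl⟩ | ⟨C, hC, -, rfl⟩)
    · refine Multiset.nodup_cons.2 ⟨?_, hS.nodup C hC⟩
      rcases he with rfl | rfl
      exacts [hnu C hC, hnl C hC]
    · have h1 := hnu _ hC
      have h2 := hnl _ hC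
      have h3 := hS.nodup _ hC
      simp only [Multiset.mem_cons, not_or, Multiset.nodup_cons] at h1 h2 h3 ⊢
      exact ⟨⟨hul, h1.2⟩, h2.2, h3.2⟩
  · rintro _ (⟨C, hC, e, he, rfl⟩ | ⟨C, hC, -, rfl⟩) x hx
    · rcases Multiset.mem_cons.1 hx with rfl | hx
      · rcases he with rfl | rfl <;> simp
      · exact Set.mem_insert_of_mem _ (Set.mem_insert_of_mem _ (hS.sub C hC x hx))
    · rcases Multiset.mem_cons.1 hx with rfl | hx
      · simp
      rcases Multiset.mem_cons.1 hx with rfl | hx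
      · simp
      exact Set.mem_insert_of_mem _ (Set.mem_insert_of_mem _
        (hS.sub _ hC x (Multiset.mem_cons_of_mem hx)))
  · intro D hD v hv
    obtain ⟨C, hC, hstep⟩ := step D hD
    rcases hv with rfl | rfl | hv
    · obtain ⟨C', hC', h1⟩ := hS.exists_rel hC
      exact ⟨_, hm C' hC' v (Or.inl rfl), hstep C' hC' h1 v (Or.inl rfl), by simp⟩
    · obtain ⟨C', hC', h1⟩ := hS.exists_rel hC
      exact ⟨_, hm C' hC' v (Or.inr rfl), hstep C' hC' h1 v (Or.inr rfl), by simp⟩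
    · obtain ⟨C', hC', h1, h2⟩ := hS.defend C hC v hv
      exact ⟨_, hm C' hC' u (Or.inl rfl), hstep C' hC' h1 u (Or.inl rfl), by simp [h2]⟩
  · intro D hD v hv
    obtain ⟨C, hC, hstep⟩ := step D hD
    rcases hv with rfl | rfl | hv
    · obtain ⟨D', hD', h1, h2, -⟩ := evictuv D hD a (Set.mem_insert_of_mem _ ha)
      exact ⟨D', hD', h1, h2⟩
    · obtain ⟨C', hC', h1⟩ := hS.exists_rel hC
      exact ⟨_, hm C' hC' u (Or.inl rfl), hstep C' hC' h1 u (Or.inl rfl),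
        by simp [hul.symm, hnl C' hC']⟩
    · obtain ⟨D', hD', h1, -, h2⟩ := evictuv D hD v hv
      exact ⟨D', hD', h1, h2⟩
  · intro D hD x x' hxx
    rcases hxx with h | ⟨rfl, rfl⟩ | ⟨rfl, rfl⟩ | ⟨rfl, rfl⟩ | ⟨rfl, rfl⟩ | ⟨rfl, rfl⟩ | ⟨rfl, rfl⟩
    · obtain ⟨C, hC, hstep⟩ := step D hD
      obtain ⟨C', hC', h1, h2, h3⟩ := hS.evictPair C hC x x' h
      have := hF x x' h
      exact ⟨_, hm C' hC' u (Or.inl rfl), hstep C' hC' h1 u (Or.inl rfl),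
        by simp [h2, hne x this.1], by simp [h3, hne x' this.2]⟩
    · exact special D hD
    · obtain ⟨D', h1, h2, h3, h4⟩ := special D hD
      exact ⟨D', h1, h2, h4, h3⟩
    · obtain ⟨D', h1, h2, h3, h4⟩ := evictuv D hD _ (Set.mem_insert x A)
      exact ⟨D', h1, h2, h4, h3⟩
    · exact evictuv D hD _ (Set.mem_insert _ _)
    · exact evictuv D hD _ (Set.mem_insert_of_mem _ ha)
    · obtain ⟨D', h1, h2, h3, h4⟩ := evictuv D hD _ (Set.mem_insert_of_mem _ ha)
      exact ⟨D', h1, h2, h4, h3⟩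

/-- Gluing a graph `M` with its own strategy at a vertex `a` that carries a pendant `x`; the
pendant is lost. -/
theorem UpperBound.glue {r r₀ r₁ : W → W → Prop} {A M : Set W} {F F₁ : W → W → Prop} {k m : ℕ}
    {a x : W} (h : UpperBound r₀ (insert x A) F k) (h₁ : UpperBound r₁ M F₁ (m + 1))
    (hx : x ∉ A) (haA : a ∈ A) (haM : a ∈ M) (hAM : ∀ y ∈ A, y ∈ M → y = a)
    (hF : ∀ x y, F x y → x ∈ A ∧ y ∈ A) (hF₁ : ∀ x y, F₁ x y → x ∈ M ∧ y ∈ M)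
    (hrefl : ∀ x, r x x) (hr : ∀ x ∈ A, ∀ y ∈ A, r₀ x y → r x y)
    (hr₁ : ∀ x ∈ M, ∀ y ∈ M, r₁ x y → r x y)
    (hfrom : ∀ y ∈ insert x A, r₀ x y → y = a ∨ y = x)
    (hto : ∀ y ∈ insert x A, r₀ y x → y = a ∨ y = x) :
    UpperBound r (A ∪ M) (fun y z => F y z ∨ F₁ y z) (k + m) := by
  obtain ⟨S, hS⟩ := h
  obtain ⟨S₁, hS₁⟩ := h₁
  have hax : a ≠ x := fun h => hx (h ▸ haA)
  have hxM : ∀ {E : Multiset W}, x ::ₘ E ∈ S → x ∉ E ∧ ∀ y ∈ E, y ∈ A := by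
    intro E hE
    have h1 := (Multiset.nodup_cons.1 (hS.nodup _ hE)).1
    exact ⟨h1, fun y hy => (hS.sub _ hE y (Multiset.mem_cons_of_mem hy)).resolve_left
      fun h => h1 (h ▸ hy)⟩
  have haE : ∀ {E : Multiset W}, a ::ₘ E ∈ S → a ∉ E := fun hE =>
    (Multiset.nodup_cons.1 (hS.nodup _ hE)).1
  have haE₁ : ∀ {E : Multiset W}, a ::ₘ E ∈ S₁ → a ∉ E := fun hE =>
    (Multiset.nodup_cons.1 (hS₁.nodup _ hE)).1
  have hsub : ∀ {E : Multiset W}, E ∈ S → x ∉ E → ∀ y ∈ E, y ∈ A := fun hE hxE y hy =>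
    (hS.sub _ hE y hy).resolve_left fun h => hxE (h ▸ hy)
  -- The pendant is within reach of `a` and itself only, so one of the two always holds a guard.
  have hdom : ∀ C ∈ S, x ∉ C → a ∈ C := by
    intro C hC hxC
    obtain ⟨C', hC', h1, h2⟩ := hS.defend C hC x (Set.mem_insert _ _)
    obtain ⟨E, rfl⟩ := Multiset.exists_cons_of_mem h2
    obtain ⟨y, E', hy, -, rfl⟩ := Multiset.rel_cons_right.1 h1
    rcases hto y (hS.sub _ hC y (Multiset.mem_cons_self _ _)) hy with rfl | rfl
    · exact Multiset.mem_cons_self _ _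
    · exact absurd (Multiset.mem_cons_self _ _) hxC
  -- A guard on `x` stands for a guard that is busy in `M`: it is dropped, and the guards of `M`
  -- leave `a` empty. If there is none on `x`, both strategies occupy `a`, and the two guards there
  -- are merged. Either way one guard is saved.
  set T : Set (Multiset W) := {E | (∃ C D, x ::ₘ C ∈ S ∧ D ∈ S₁ ∧ a ∉ D ∧ E = C + D) ∨
    ∃ C D, a ::ₘ C ∈ S ∧ x ∉ C ∧ a ::ₘ D ∈ S₁ ∧ E = a ::ₘ (C + D)} with hT
  -- the joint configuration of `C` and `D`
  have pair : ∀ C ∈ S, ∀ D ∈ S₁, (x ∈ C ↔ a ∉ D) → ∃ E ∈ T,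
      (∀ y, y ∈ E ↔ (y ∈ C ∧ y ≠ x) ∨ (y ∈ D ∧ y ≠ a)) ∧
      (x ∈ C → ∃ C₀, C = x ::ₘ C₀ ∧ E = C₀ + D) ∧
      (x ∉ C → ∃ C₀ D₀, C = a ::ₘ C₀ ∧ D = a ::ₘ D₀ ∧ E = a ::ₘ (C₀ + D₀)) := by
    intro C hC D hD hCD
    by_cases hxC : x ∈ C
    · obtain ⟨C₀, rfl⟩ := Multiset.exists_cons_of_mem hxC
      have haD := hCD.1 hxC
      refine ⟨C₀ + D, Or.inl ⟨C₀, D, hC, hD, haD, rfl⟩, ?_, fun _ => ⟨C₀, rfl, rfl⟩,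
        fun h => absurd hxC h⟩
      intro y
      have h1 : y ∈ C₀ → y ≠ x := fun h h' => (hxM hC).1 (h' ▸ h)
      have h2 : y ∈ D → y ≠ a := fun h h' => haD (h' ▸ h)
      simp only [Multiset.mem_add, Multiset.mem_cons]
      tauto
    · have haD : a ∈ D := by
        by_contra h
        exact hxC (hCD.2 h)
      obtain ⟨D₀, rfl⟩ := Multiset.exists_cons_of_mem haD
      obtain ⟨C₀, rfl⟩ := Multiset.exists_cons_of_mem (hdom C hC hxC)
      have hxC₀ : x ∉ C₀ := fun h => hxC (Multiset.mem_cons_of_mem h)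
      refine ⟨_, Or.inr ⟨C₀, D₀, hC, hxC₀, hD, rfl⟩, ?_, fun h => absurd h hxC,
        fun _ => ⟨C₀, D₀, rfl, rfl, rfl⟩⟩
      intro y
      have h1 : y ∈ C₀ → y ≠ x := fun h h' => hxC₀ (h' ▸ h)
      have h2 : y ∈ D₀ → y ≠ a := fun h h' => haE₁ hD (h' ▸ h)
      simp only [Multiset.mem_add, Multiset.mem_cons]
      constructor
      · rintro (rfl | h | h)
        exacts [Or.inl ⟨Or.inl rfl, hax⟩, Or.inl ⟨Or.inr h, h1 h⟩, Or.inr ⟨Or.inr h, h2 h⟩]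
      · rintro (⟨h, -⟩ | ⟨h, h'⟩)
        · tauto
        · tauto
  have relA : ∀ {X Y : Multiset W}, (∀ y ∈ X, y ∈ A) → (∀ y ∈ Y, y ∈ A) → Multiset.Rel r₀ X Y →
      Multiset.Rel r X Y := fun hX hY h =>
    h.mono fun u hu v hv => hr u (hX u hu) v (hY v hv)
  have relM : ∀ {X Y : Multiset W}, X ∈ S₁ → Y ∈ S₁ → Multiset.Rel r₁ X Y →
      Multiset.Rel r X Y := fun hX hY h =>
    h.mono fun u hu v hv => hr₁ u (hS₁.sub _ hX u hu) v (hS₁.sub _ hY v hv)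
  -- the moves
  have move : ∀ E ∈ T, ∃ C ∈ S, ∃ D ∈ S₁, (x ∈ C ↔ a ∉ D) ∧
      ∀ C' ∈ S, ∀ D' ∈ S₁, (x ∈ C' ↔ a ∉ D') → (Multiset.Rel r₀ C C' ∨ C' = C) →
      (Multiset.Rel r₁ D D' ∨ D' = D) → (x ∉ C → x ∉ C' → C' = C ∨ D' = D) →
      ∃ E' ∈ T, Multiset.Rel r E E' ∧
        ∀ y, y ∈ E' ↔ (y ∈ C' ∧ y ≠ x) ∨ (y ∈ D' ∧ y ≠ a) := by
    have relM' : ∀ {X Y : Multiset W}, X ∈ S₁ → Y ∈ S₁ → (Multiset.Rel r₁ X Y ∨ Y = X) →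
        Multiset.Rel r X Y := by
      rintro X Y hX hY (h | rfl)
      · exact relM hX hY h
      · exact Multiset.rel_refl_of_refl_on fun x _ => hrefl x
    rintro E (⟨C, D, hC, hD, haD, rfl⟩ | ⟨C, D, hC, hxC, hD, rfl⟩)
    · refine ⟨_, hC, D, hD, by simp [haD], ?_⟩
      intro C' hC' D' hD' hCD' h1 h2 _
      obtain ⟨E', hE', hmem, hE1, hE2⟩ := pair C' hC' D' hD' hCD'
      refine ⟨E', hE', ?_, hmem⟩
      by_cases hxC' : x ∈ C'
      · obtain ⟨C₀, rfl, rfl⟩ := hE1 hxC'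
        refine Multiset.Rel.add ?_ (relM' hD hD' h2)
        rcases h1 with h1 | h1
        · refine rel_of_rel_cons h1
            (fun u hu v hv => hr u ((hxM hC).2 u hu) v ((hxM hC').2 v hv)) ?_
          intro u hu v hv h h'
          have hua := (hto u (Or.inr ((hxM hC).2 u hu)) h').resolve_right
            fun h => (hxM hC).1 (h ▸ hu)
          have hva := (hfrom v (Or.inr ((hxM hC').2 v hv)) h).resolve_right
            fun h => (hxM hC').1 (h ▸ hv)
          rw [hua, hva]
          exact hrefl a
        · rw [(Multiset.cons_inj_right x).1 h1]
          exact Multiset.rel_refl_of_refl_on fun x _ => hrefl x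
      · obtain ⟨C₀, D₀, rfl, rfl, rfl⟩ := hE2 hxC'
        have h1 := h1.resolve_right fun h => hxC' (h ▸ Multiset.mem_cons_self _ _)
        rw [← Multiset.add_cons]
        have hA : ∀ v ∈ C₀, v ∈ A := fun v hv => hsub hC' hxC' v (Multiset.mem_cons_of_mem hv)
        refine Multiset.Rel.add (rel_of_rel_cons h1
          (fun u hu v hv => hr u ((hxM hC).2 u hu) v (hA v hv)) ?_) (relM' hD hD' h2)
        intro u hu v hv h h'
        rcases hfrom v (Or.inr (hA v hv)) h with rfl | rfl
        exacts [absurd hv (haE hC'), absurd (hA _ hv) hx]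
    · have hxaC : x ∉ a ::ₘ C := by simp [hxC, hax.symm]
      refine ⟨_, hC, _, hD, by simp [hxC, hax.symm], ?_⟩
      intro C' hC' D' hD' hCD' h1 h2 h3
      obtain ⟨E', hE', hmem, hE1, hE2⟩ := pair C' hC' D' hD' hCD'
      refine ⟨E', hE', ?_, hmem⟩
      have hA : ∀ v ∈ C, v ∈ A := fun v hv => hsub hC hxaC v (Multiset.mem_cons_of_mem hv)
      by_cases hxC' : x ∈ C'
      · obtain ⟨C₀, rfl, rfl⟩ := hE1 hxC'
        have h1 := h1.resolve_right fun h => hxaC (h ▸ Multiset.mem_cons_self _ _)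
        rw [← Multiset.add_cons]
        refine Multiset.Rel.add (rel_of_rel_cons h1
          (fun u hu v hv => hr u (hA u hu) v ((hxM hC').2 v hv)) ?_) (relM' hD hD' h2)
        intro u hu v hv h h'
        rcases hto u (Or.inr (hA u hu)) h' with rfl | rfl
        exacts [absurd hu (haE hC), absurd (hA _ hu) hx]
      · obtain ⟨C₀, D₀, rfl, rfl, rfl⟩ := hE2 hxC'
        -- When the guard on `a` is shared before and after the move, it can serve only one of the
        -- two strategies, so the other one has to stand still.
        rcases h3 hxaC hxC' with h | h
        · rw [(Multiset.cons_inj_right a).1 h, ← Multiset.add_cons, ← Multiset.add_cons]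
          exact Multiset.Rel.add (Multiset.rel_refl_of_refl_on fun x _ => hrefl x)
            (relM' hD hD' h2)
        · rw [(Multiset.cons_inj_right a).1 h, ← Multiset.cons_add, ← Multiset.cons_add]
          refine Multiset.Rel.add ?_ (Multiset.rel_refl_of_refl_on fun x _ => hrefl x)
          rcases h1 with h1 | h1
          · exact relA (hsub hC hxaC) (hsub hC' hxC') h1
          · rw [h1]
            exact Multiset.rel_refl_of_refl_on fun x _ => hrefl x
  -- adapting the configuration on `M` to a move on `A`, and conversely
  have follow : ∀ C ∈ S, ∀ D ∈ S₁, (x ∈ C ↔ a ∉ D) → ∀ C' ∈ S, ∃ D' ∈ S₁, (x ∈ C' ↔ a ∉ D') ∧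
      (Multiset.Rel r₁ D D' ∨ D' = D) ∧ (x ∉ C → x ∉ C' → D' = D) := by
    intro C hC D hD hCD C' hC'
    by_cases hxC : x ∈ C <;> by_cases hxC' : x ∈ C'
    · exact ⟨D, hD, by tauto, Or.inr rfl, fun _ _ => rfl⟩
    · obtain ⟨D', hD', h1, h2⟩ := hS₁.defend D hD a haM
      exact ⟨D', hD', by tauto, Or.inl h1, by tauto⟩
    · obtain ⟨D', hD', h1, h2⟩ := hS₁.evict D hD a haM
      exact ⟨D', hD', by tauto, Or.inl h1, by tauto⟩
    · exact ⟨D, hD, by tauto, Or.inr rfl, fun _ _ => rfl⟩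
  have lead : ∀ C ∈ S, ∀ D ∈ S₁, (x ∈ C ↔ a ∉ D) → ∀ D' ∈ S₁, ∃ C' ∈ S, (x ∈ C' ↔ a ∉ D') ∧
      (Multiset.Rel r₀ C C' ∨ C' = C) ∧ (x ∉ C → x ∉ C' → C' = C) := by
    intro C hC D hD hCD D' hD'
    by_cases haD : a ∈ D <;> by_cases haD' : a ∈ D'
    · exact ⟨C, hC, by tauto, Or.inr rfl, fun _ _ => rfl⟩
    · obtain ⟨C', hC', h1, h2⟩ := hS.defend C hC x (Set.mem_insert _ _)
      exact ⟨C', hC', by tauto, Or.inl h1, by tauto⟩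
    · obtain ⟨C', hC', h1, h2⟩ := hS.evict C hC x (Set.mem_insert _ _)
      exact ⟨C', hC', by tauto, Or.inl h1, by tauto⟩
    · exact ⟨C, hC, by tauto, Or.inr rfl, fun _ _ => rfl⟩
  have onA : ∀ E ∈ T, ∀ P : Multiset W → Prop,
      (∀ C ∈ S, ∃ C' ∈ S, Multiset.Rel r₀ C C' ∧ P C') → ∃ C' ∈ S, P C' ∧ ∃ D' ∈ S₁, ∃ E' ∈ T,
        (x ∈ C' ↔ a ∉ D') ∧ Multiset.Rel r E E' ∧
        ∀ y, y ∈ E' ↔ (y ∈ C' ∧ y ≠ x) ∨ (y ∈ D' ∧ y ≠ a) := by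
    intro E hE P hP
    obtain ⟨C, hC, D, hD, hCD, hmove⟩ := move E hE
    obtain ⟨C', hC', h1, h2⟩ := hP C hC
    obtain ⟨D', hD', h3, h4, h5⟩ := follow C hC D hD hCD C' hC'
    obtain ⟨E', hE', h6, h7⟩ := hmove C' hC' D' hD' h3 (Or.inl h1) h4
      fun h h' => Or.inr (h5 h h')
    exact ⟨C', hC', h2, D', hD', E', hE', h3, h6, h7⟩
  have onM : ∀ E ∈ T, ∀ P : Multiset W → Prop,
      (∀ D ∈ S₁, ∃ D' ∈ S₁, Multiset.Rel r₁ D D' ∧ P D') → ∃ C' ∈ S, ∃ D' ∈ S₁, P D' ∧ ∃ E' ∈ T,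
        (x ∈ C' ↔ a ∉ D') ∧ Multiset.Rel r E E' ∧
        ∀ y, y ∈ E' ↔ (y ∈ C' ∧ y ≠ x) ∨ (y ∈ D' ∧ y ≠ a) := by
    intro E hE P hP
    obtain ⟨C, hC, D, hD, hCD, hmove⟩ := move E hE
    obtain ⟨D', hD', h1, h2⟩ := hP D hD
    obtain ⟨C', hC', h3, h4, h5⟩ := lead C hC D hD hCD D' hD'
    obtain ⟨E', hE', h6, h7⟩ := hmove C' hC' D' hD' h3 h4 (Or.inl h1)
      fun h h' => Or.inl (h5 h h')
    exact ⟨C', hC', D', hD', h2, E', hE', h3, h6, h7⟩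
  have notA : ∀ D ∈ S₁, ∀ y ∈ A, ¬ (y ∈ D ∧ y ≠ a) := fun D hD y hy h =>
    h.2 (hAM y hy (hS₁.sub D hD y h.1))
  have notM : ∀ C ∈ S, ∀ y ∈ M, y ≠ a → ¬ (y ∈ C ∧ y ≠ x) := fun C hC y hy hya h =>
    hya (hAM y ((hS.sub C hC y h.1).resolve_left h.2) hy)
  -- clearing `a` and a vertex of `M`
  have clear : ∀ E ∈ T, ∀ h, F₁ a h ∨ F₁ h a → ∃ E' ∈ T, Multiset.Rel r E E' ∧ a ∉ E' ∧ h ∉ E' := by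
    intro E hE h hh
    obtain ⟨C, hC, D, hD, hCD, hmove⟩ := move E hE
    have hhM : h ∈ M := hh.elim (fun hh => (hF₁ _ _ hh).2) fun hh => (hF₁ _ _ hh).1
    obtain ⟨D', hD', h1, h2, h3⟩ : ∃ D' ∈ S₁, Multiset.Rel r₁ D D' ∧ a ∉ D' ∧ h ∉ D' := by
      rcases hh with hh | hh
      · exact hS₁.evictPair D hD a h hh
      · obtain ⟨D', hD', h1, h2, h3⟩ := hS₁.evictPair D hD h a hh
        exact ⟨D', hD', h1, h3, h2⟩
    obtain ⟨C', hC', h4, h5⟩ := hS.evict C hC a (Set.mem_insert_of_mem _ haA)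
    have hxC' : x ∈ C' := by
      by_contra hxC'
      exact h5 (hdom C' hC' hxC')
    obtain ⟨E', hE', h6, h7⟩ := hmove C' hC' D' hD' (by tauto) (Or.inl h4) (Or.inl h1) (by tauto)
    refine ⟨E', hE', h6, ?_, ?_⟩
    · rw [h7]; tauto
    · rw [h7]
      rintro (h' | h')
      · by_cases hha : h = a
        · subst hha
          exact h5 (by tauto)
        · exact notM C' hC' _ hhM hha (by tauto)
      · tauto
  refine ⟨T, ?_, ?_, ?_, ?_, ?_, ?_, ?_⟩
  · obtain ⟨C, hC⟩ := hS.nonempty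
    obtain ⟨C', hC', -, h1⟩ := hS.defend C hC x (Set.mem_insert _ _)
    obtain ⟨D, hD⟩ := hS₁.nonempty
    obtain ⟨D', hD', -, h2⟩ := hS₁.evict D hD a haM
    obtain ⟨E, hE, -⟩ := pair C' hC' D' hD' (by tauto)
    exact ⟨E, hE⟩
  · rintro _ (⟨C, D, hC, hD, haD, rfl⟩ | ⟨C, D, hC, hxC, hD, rfl⟩)
    · have := hS.card _ hC
      have := hS₁.card _ hD
      simp only [Multiset.card_cons, Multiset.card_add] at *
      omega
    · have := hS.card _ hC
      have := hS₁.card _ hD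
      simp only [Multiset.card_cons, Multiset.card_add] at *
      omega
  · rintro _ (⟨C, D, hC, hD, haD, rfl⟩ | ⟨C, D, hC, hxC, hD, rfl⟩)
    · refine Multiset.nodup_add.2 ⟨(Multiset.nodup_cons.1 (hS.nodup _ hC)).2, hS₁.nodup _ hD, ?_⟩
      refine Multiset.disjoint_left.2 fun {y} h1 h2 => ?_
      exact haD (hAM y ((hxM hC).2 y h1) (hS₁.sub _ hD y h2) ▸ h2)
    · have h1 := Multiset.nodup_cons.1 (hS.nodup _ hC)
      have h2 := Multiset.nodup_cons.1 (hS₁.nodup _ hD)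
      have hA : ∀ v ∈ C, v ∈ A := fun v hv => hsub hC (by simp [hxC, hax.symm]) v
        (Multiset.mem_cons_of_mem hv)
      refine Multiset.nodup_cons.2 ⟨by simp [h1.1, h2.1], Multiset.nodup_add.2 ⟨h1.2, h2.2, ?_⟩⟩
      refine Multiset.disjoint_left.2 fun {y} h3 h4 => ?_
      exact h2.1 (hAM y (hA y h3) (hS₁.sub _ hD y (Multiset.mem_cons_of_mem h4)) ▸ h4)
  · rintro _ (⟨C, D, hC, hD, haD, rfl⟩ | ⟨C, D, hC, hxC, hD, rfl⟩) y hy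
    · rcases Multiset.mem_add.1 hy with h | h
      exacts [Or.inl ((hxM hC).2 y h), Or.inr (hS₁.sub _ hD y h)]
    · rcases Multiset.mem_cons.1 hy with rfl | hy
      · exact Or.inl haA
      rcases Multiset.mem_add.1 hy with h | h
      exacts [Or.inl (hsub hC (by simp [hxC, hax.symm]) y (Multiset.mem_cons_of_mem h)),
        Or.inr (hS₁.sub _ hD y (Multiset.mem_cons_of_mem h))]
  · intro E hE v hv
    by_cases hvA : v ∈ A
    · obtain ⟨C', hC', h1, D', hD', E', hE', h2, h3, h4⟩ := onA E hE (fun C' => v ∈ C')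
        fun C hC => hS.defend C hC v (Set.mem_insert_of_mem _ hvA)
      refine ⟨E', hE', h3, (h4 v).2 (Or.inl ⟨h1, ?_⟩)⟩
      rintro rfl
      exact hx hvA
    · have hvM := hv.resolve_left hvA
      obtain ⟨C', hC', D', hD', h1, E', hE', h2, h3, h4⟩ := onM E hE (fun D' => v ∈ D')
        fun D hD => hS₁.defend D hD v hvM
      refine ⟨E', hE', h3, (h4 v).2 (Or.inr ⟨h1, ?_⟩)⟩
      rintro rfl
      exact hvA haA
  · intro E hE v hv
    by_cases hvA : v ∈ A
    · obtain ⟨C', hC', h1, D', hD', E', hE', h2, h3, h4⟩ := onA E hE (fun C' => v ∉ C')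
        fun C hC => hS.evict C hC v (Set.mem_insert_of_mem _ hvA)
      refine ⟨E', hE', h3, ?_⟩
      rw [h4]
      have := notA D' hD' v hvA
      tauto
    · have hvM := hv.resolve_left hvA
      obtain ⟨C', hC', D', hD', h1, E', hE', h2, h3, h4⟩ := onM E hE (fun D' => v ∉ D')
        fun D hD => hS₁.evict D hD v hvM
      refine ⟨E', hE', h3, ?_⟩
      rw [h4]
      have := notM C' hC' v hvM (fun h => hvA (h ▸ haA))
      tauto
  · rintro E hE u v (huv | huv)
    · obtain ⟨hu, hv⟩ := hF u v huv
      obtain ⟨C', hC', h1, D', hD', E', hE', h2, h3, h4⟩ := onA E hE (fun C' => u ∉ C' ∧ v ∉ C')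
        fun C hC => hS.evictPair C hC u v huv
      have := notA D' hD' u hu
      have := notA D' hD' v hv
      refine ⟨E', hE', h3, ?_, ?_⟩ <;> rw [h4] <;> tauto
    · by_cases hua : u = a
      · subst hua
        exact clear E hE v (Or.inl huv)
      by_cases hva : v = a
      · subst hva
        obtain ⟨E', hE', h1, h2, h3⟩ := clear E hE u (Or.inr huv)
        exact ⟨E', hE', h1, h3, h2⟩
      obtain ⟨hu, hv⟩ := hF₁ u v huv
      obtain ⟨C', hC', D', hD', h1, E', hE', h2, h3, h4⟩ := onM E hE (fun D' => u ∉ D' ∧ v ∉ D')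
        fun D hD => hS₁.evictPair D hD u v huv
      have := notM C' hC' u hu hua
      have := notM C' hC' v hv hva
      refine ⟨E', hE', h3, ?_, ?_⟩ <;> rw [h4] <;> tauto

/-- Gluing, at `a`, a set `N` guarded by its own guards: they can take any configuration of `Z`
when `a` is occupied and are in the configuration `B` otherwise. -/
theorem UpperBound.glue_self_guarded {r r₀ : W → W → Prop} {A N : Set W} {F F₁ : W → W → Prop}
    {k c : ℕ} {a : W} {Z : Set (Multiset W)} {B : Multiset W} (h : UpperBound r₀ A F k)
    (ha : a ∈ A) (hB : B ∈ Z) (hcard : ∀ D ∈ Z, D.card = c) (hnodup : ∀ D ∈ Z, D.Nodup)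
    (hsub : ∀ D ∈ Z, ∀ x ∈ D, x ∈ N) (hAN : ∀ x ∈ A, x ∉ N)
    (hF : ∀ x y, F x y → x ∈ A ∧ y ∈ A) (hF₁ : ∀ x y, F₁ x y → x ∈ N ∧ y ∈ N)
    (hrefl : ∀ x, r x x) (hr : ∀ x ∈ A, ∀ y ∈ A, r₀ x y → r x y)
    (htoB : ∀ D ∈ Z, Multiset.Rel r D B) (hfromB : ∀ D ∈ Z, Multiset.Rel r B D)
    (hdef : ∀ D ∈ Z, ∀ v ∈ N, ∃ D' ∈ Z, Multiset.Rel r (a ::ₘ D) (a ::ₘ D') ∧ v ∈ D')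
    (hev : ∀ D ∈ Z, ∀ v ∈ N, ∃ D' ∈ Z, Multiset.Rel r (a ::ₘ D) (a ::ₘ D') ∧ v ∉ D')
    (hevp : ∀ D ∈ Z, ∀ u v, F₁ u v →
      ∃ D' ∈ Z, Multiset.Rel r (a ::ₘ D) (a ::ₘ D') ∧ u ∉ D' ∧ v ∉ D') :
    UpperBound r (A ∪ N) (fun x y => F x y ∨ F₁ x y ∨ (x = a ∧ y ∈ N ∧ y ∉ B) ∨
      (y = a ∧ x ∈ N ∧ x ∉ B)) (k + c) := by
  obtain ⟨S, hS⟩ := h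
  -- While `a` is empty the guards of `N` stay in `B`. From there they reach any configuration of
  -- `Z` without help, in the same move in which `a` gets occupied.
  set T : Set (Multiset W) := {E | ∃ C ∈ S, ∃ D ∈ Z, (a ∉ C → D = B) ∧ E = C + D} with hT
  have relA : ∀ C ∈ S, ∀ C' ∈ S, Multiset.Rel r₀ C C' → Multiset.Rel r C C' :=
    fun C hC C' hC' h => h.mono fun a ha b hb =>
      hr a (hS.sub C hC a ha) b (hS.sub C' hC' b hb)
  have onA : ∀ E ∈ T, ∀ P : Multiset W → Prop,
      (∀ C ∈ S, ∃ C' ∈ S, Multiset.Rel r₀ C C' ∧ P C') →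
      ∃ C' ∈ S, P C' ∧ C' + B ∈ T ∧ Multiset.Rel r E (C' + B) := by
    rintro _ ⟨C, hC, D, hD, -, rfl⟩ P hP
    obtain ⟨C', hC', h1, h2⟩ := hP C hC
    exact ⟨C', hC', h2, ⟨C', hC', B, hB, fun _ => rfl, rfl⟩,
      (relA C hC C' hC' h1).add (htoB D hD)⟩
  have onN : ∀ E ∈ T, ∀ P : Multiset W → Prop,
      (∀ D ∈ Z, ∃ D' ∈ Z, Multiset.Rel r (a ::ₘ D) (a ::ₘ D') ∧ P D') →
      ∃ C' ∈ S, ∃ D' ∈ Z, P D' ∧ C' + D' ∈ T ∧ Multiset.Rel r E (C' + D') := by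
    rintro _ ⟨C, hC, D, hD, hCD, rfl⟩ P hP
    obtain ⟨D', hD', h1, h2⟩ := hP D hD
    by_cases haC : a ∈ C
    · refine ⟨C, hC, D', hD', h2, ⟨C, hC, D', hD', fun h => absurd haC h, rfl⟩, ?_⟩
      obtain ⟨C₀, rfl⟩ := Multiset.exists_cons_of_mem haC
      -- The guard on `a` takes part in the move inside `N`, and the remaining guards on `A` stand
      -- still.
      rw [Multiset.cons_add, Multiset.cons_add, ← Multiset.add_cons, ← Multiset.add_cons]
      exact (Multiset.rel_refl_of_refl_on fun x _ => hrefl x).add h1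
    · obtain ⟨C', hC', h3, h4⟩ := hS.defend C hC a ha
      rw [hCD haC]
      exact ⟨C', hC', D', hD', h2, ⟨C', hC', D', hD', fun h => absurd h4 h, rfl⟩,
        (relA C hC C' hC' h3).add (hfromB D' hD')⟩
  have notN : ∀ C ∈ S, ∀ v ∈ N, v ∉ C := fun C hC v hv h => hAN v (hS.sub C hC v h) hv
  have notA : ∀ D ∈ Z, ∀ v ∈ A, v ∉ D := fun D hD v hv h => hAN v hv (hsub D hD v h)
  have clear : ∀ E ∈ T, ∀ v ∈ N, v ∉ B → ∃ E' ∈ T, Multiset.Rel r E E' ∧ a ∉ E' ∧ v ∉ E' := by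
    intro E hE v hv hvB
    obtain ⟨C', hC', h1, h2, h3⟩ := onA E hE (fun C' => a ∉ C') fun C hC => hS.evict C hC a ha
    exact ⟨_, h2, h3, by simp [h1, notA B hB a ha], by simp [hvB, notN C' hC' v hv]⟩
  refine ⟨T, ?_, ?_, ?_, ?_, ?_, ?_, ?_⟩
  · obtain ⟨C, hC⟩ := hS.nonempty
    exact ⟨_, C, hC, B, hB, fun _ => rfl, rfl⟩
  · rintro _ ⟨C, hC, D, hD, -, rfl⟩
    rw [Multiset.card_add, hS.card C hC, hcard D hD]
  · rintro _ ⟨C, hC, D, hD, -, rfl⟩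
    exact Multiset.nodup_add.2 ⟨hS.nodup C hC, hnodup D hD,
      Multiset.disjoint_left.2 fun {y} h1 h2 => hAN y (hS.sub C hC y h1) (hsub D hD y h2)⟩
  · rintro _ ⟨C, hC, D, hD, -, rfl⟩ x hx
    exact (Multiset.mem_add.1 hx).imp (hS.sub C hC x) (hsub D hD x)
  · rintro E hE v (hv | hv)
    · obtain ⟨C', hC', h1, h2, h3⟩ := onA E hE (fun C' => v ∈ C') fun C hC => hS.defend C hC v hv
      exact ⟨_, h2, h3, by simp [h1]⟩
    · obtain ⟨C', hC', D', hD', h1, h2, h3⟩ := onN E hE (fun D' => v ∈ D')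
        fun D hD => hdef D hD v hv
      exact ⟨_, h2, h3, by simp [h1]⟩
  · rintro E hE v (hv | hv)
    · obtain ⟨C', hC', h1, h2, h3⟩ := onA E hE (fun C' => v ∉ C') fun C hC => hS.evict C hC v hv
      exact ⟨_, h2, h3, by simp [h1, notA B hB v hv]⟩
    · obtain ⟨C', hC', D', hD', h1, h2, h3⟩ := onN E hE (fun D' => v ∉ D')
        fun D hD => hev D hD v hv
      exact ⟨_, h2, h3, by simp [h1, notN C' hC' v hv]⟩
  · rintro E hE u v (huv | huv | ⟨rfl, hv, hvB⟩ | ⟨rfl, hu, huB⟩)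
    · obtain ⟨hu, hv⟩ := hF u v huv
      obtain ⟨C', hC', h1, h2, h3⟩ := onA E hE (fun C' => u ∉ C' ∧ v ∉ C')
        fun C hC => hS.evictPair C hC u v huv
      exact ⟨_, h2, h3, by simp [h1.1, notA B hB u hu], by simp [h1.2, notA B hB v hv]⟩
    · obtain ⟨hu, hv⟩ := hF₁ u v huv
      obtain ⟨C', hC', D', hD', h1, h2, h3⟩ := onN E hE (fun D' => u ∉ D' ∧ v ∉ D')
        fun D hD => hevp D hD u v huv
      exact ⟨_, h2, h3, by simp [h1.1, notN C' hC' u hu], by simp [h1.2, notN C' hC' v hv]⟩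
    · exact clear E hE v hv hvB
    · obtain ⟨E', h1, h2, h3, h4⟩ := clear E hE u hu huB
      exact ⟨E', h1, h2, h4, h3⟩

theorem map_range_succ {f : ℕ → W} (j : ℕ) : (Multiset.range (j + 1)).map f =
    f 0 ::ₘ (Multiset.range j).map fun i => f (i + 1) := by
  induction j with
  | zero => simp
  | succ j ih =>
    rw [Multiset.range_succ, Multiset.map_cons, ih, Multiset.range_succ (j), Multiset.map_cons,
      Multiset.cons_swap]

theorem rel_map_range {r : W → W → Prop} {f g : ℕ → W} {j : ℕ} (h : ∀ i < j, r (f i) (g i)) :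
    Multiset.Rel r ((Multiset.range j).map f) ((Multiset.range j).map g) :=
  Multiset.rel_map.2 (Multiset.rel_refl_of_refl_on fun i hi => h i (Multiset.mem_range.1 hi))

/-- A third of the vertices of a cycle, rounded up, suffices for a strategy with eviction. -/
theorem UpperBound.cycle {r : W → W → Prop} {q : ℕ → W} {k : ℕ} (hk : 3 ≤ k)
    (hq : ∀ i j, q i = q j ↔ i ≡ j [MOD k]) (hrefl : ∀ x, r x x)
    (hr : ∀ i, r (q i) (q (i + 1))) (hr' : ∀ i, r (q (i + 1)) (q i)) :
    UpperBound r (Set.range q) (fun x y => ∃ s, x = q s ∧ y = q (s + 1)) ((k + 2) / 3) := by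
  obtain ⟨m, hm⟩ : ∃ m, m = (k + 2) / 3 := ⟨_, rfl⟩
  rw [← hm]
  -- Every third vertex is guarded, starting from `t`. Unless `k` is divisible by three, the gap
  -- between the last and the first guard is shorter than the others.
  set D : ℕ → Multiset W := fun t => (Multiset.range m).map fun i => q (t + 3 * i) with hD
  have hqk : ∀ i, q (i + k) = q i := fun i => (hq _ _).2 (by simp [Nat.ModEq])
  have hoff : ∀ t s, ∃ o < k, q s = q (t + o) := by
    intro t s
    refine ⟨(s + (k - t % k)) % k, Nat.mod_lt _ (by omega), (hq _ _).2 ?_⟩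
    have h1 : t ≡ t % k [MOD k] := (Nat.mod_modEq t k).symm
    have h2 : (s + (k - t % k)) % k ≡ s + (k - t % k) [MOD k] := Nat.mod_modEq _ _
    refine ((h1.add h2).trans ?_).symm
    have : t % k < k := Nat.mod_lt _ (by omega)
    rw [show t % k + (s + (k - t % k)) = s + k by omega]
    simp [Nat.ModEq]
  have hmem : ∀ t o, o < k → (q (t + o) ∈ D t ↔ o % 3 = 0) := by
    intro t o ho
    simp only [hD, Multiset.mem_map, Multiset.mem_range, hq]
    constructor
    · rintro ⟨i, hi, h⟩
      have h := Nat.ModEq.add_left_cancel' t h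
      have : 3 * i = o := by
        rw [Nat.ModEq, Nat.mod_eq_of_lt (by omega), Nat.mod_eq_of_lt ho] at h
        exact h
      omega
    · intro h
      exact ⟨o / 3, by omega, by rw [show 3 * (o / 3) = o by omega]⟩
  have hmem' : ∀ t o s, o < k → s = t + o → (q s ∈ D t ↔ o % 3 = 0) := by
    rintro t o s ho rfl
    exact hmem t o ho
  have hup : ∀ t, Multiset.Rel r (D t) (D (t + 1)) := fun t => rel_map_range fun i _ => by
    rw [show t + 1 + 3 * i = t + 3 * i + 1 by omega]
    exact hr _
  -- Turning back by one is written as adding `k - 1`, since positions are natural numbers modulo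
  -- `k`.
  have hdown : ∀ t, Multiset.Rel r (D t) (D (t + k - 1)) := fun t => rel_map_range fun i _ => by
    rw [← hqk (t + 3 * i), show t + 3 * i + k = t + k - 1 + 3 * i + 1 by omega]
    exact hr' _
  have hself : ∀ t, Multiset.Rel r (D t) (D t) := fun t =>
    Multiset.rel_refl_of_refl_on fun x _ => hrefl x
  have hpair : ∀ t s, ∃ t', Multiset.Rel r (D t) (D t') ∧ q s ∉ D t' ∧ q (s + 1) ∉ D t' := by
    intro t s
    obtain ⟨o, ho, hs⟩ := hoff t s
    have hs' : q (s + 1) = q (t + o + 1) := (hq _ _).2 (((hq _ _).1 hs).add_right 1)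
    rw [hs, hs']
    have h0 : o % 3 = 1 → o + 1 < k → ∃ t', Multiset.Rel r (D t) (D t') ∧ q (t + o) ∉ D t' ∧
        q (t + o + 1) ∉ D t' := by
      intro h1 h2
      refine ⟨t, hself t, ?_, ?_⟩
      · rw [hmem' t o _ ho rfl]; omega
      · rw [hmem' t (o + 1) _ h2 (by omega)]; omega
    have h1 : o % 3 = 0 → o + 2 < k → ∃ t', Multiset.Rel r (D t) (D t') ∧ q (t + o) ∉ D t' ∧
        q (t + o + 1) ∉ D t' := by
      intro h1 h2
      refine ⟨t + k - 1, hdown t, ?_, ?_⟩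
      · rw [← hqk, hmem' (t + k - 1) (o + 1) _ (by omega) (by omega)]; omega
      · rw [← hqk, hmem' (t + k - 1) (o + 2) _ (by omega) (by omega)]; omega
    have h2 : o % 3 = 2 → ∃ t', Multiset.Rel r (D t) (D t') ∧ q (t + o) ∉ D t' ∧
        q (t + o + 1) ∉ D t' := by
      intro h1
      refine ⟨t + 1, hup t, ?_, ?_⟩
      · rw [hmem' (t + 1) (o - 1) _ (by omega) (by omega)]; omega
      · rw [hmem' (t + 1) o _ (by omega) (by omega)]; omega
    -- In the first three cases standing still or turning the whole configuration by one clears the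
    -- pair. The others concern the short gap. For `k` congruent to 2 one guard next to the gap
    -- moves and all others stand still; for `k` congruent to 1 the last guard moves back while all
    -- others move forward.
    rcases (by omega : o % 3 = 1 ∧ o + 1 < k ∨ o % 3 = 0 ∧ o + 2 < k ∨ o % 3 = 2 ∨
      k % 3 = 2 ∧ o + 2 = k ∨ k % 3 = 2 ∧ o + 1 = k ∨ k % 3 = 1 ∧ o + 1 = k) with
      ⟨h, h'⟩ | ⟨h, h'⟩ | h | ⟨h, h'⟩ | ⟨h, h'⟩ | ⟨h, h'⟩
    · exact h0 h h'
    · exact h1 h h'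
    · exact h2 h
    · refine ⟨t + k - 3, ?_, ?_, ?_⟩
      · obtain ⟨j, hj⟩ : ∃ j, m = j + 1 := ⟨m - 1, by omega⟩
        have e1 : D t = q (t + k - 2) ::ₘ (Multiset.range j).map fun i => q (t + 3 * i) := by
          simp only [hD, hj, Multiset.range_succ, Multiset.map_cons]
          congr 2; omega
        have e2 : D (t + k - 3) = q (t + k - 3) ::ₘ
            (Multiset.range j).map fun i => q (t + 3 * i) := by
          simp only [hD, hj, map_range_succ]
          congr 1
          refine Multiset.map_congr rfl fun i _ => ?_
          rw [← hqk (t + 3 * i)]; congr 1; omega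
        rw [e1, e2]
        refine Multiset.Rel.cons ?_ (Multiset.rel_refl_of_refl_on fun x _ => hrefl x)
        rw [show t + k - 2 = t + k - 3 + 1 by omega]
        exact hr' _
      · rw [hmem' (t + k - 3) 1 _ (by omega) (by omega)]; omega
      · rw [hmem' (t + k - 3) 2 _ (by omega) (by omega)]; omega
    · refine ⟨t + 3, ?_, ?_, ?_⟩
      · obtain ⟨j, hj⟩ : ∃ j, m = j + 1 := ⟨m - 1, by omega⟩
        have e1 : D t = q t ::ₘ (Multiset.range j).map fun i => q (t + 3 * (i + 1)) := by
          simp only [hD, hj, map_range_succ]; simp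
        have e2 : D (t + 3) = q (t + 1) ::ₘ (Multiset.range j).map fun i => q (t + 3 * (i + 1)) := by
          simp only [hD, hj, Multiset.range_succ, Multiset.map_cons]
          congr 1
          · rw [← hqk (t + 1)]; congr 1; omega
          · refine Multiset.map_congr rfl fun i _ => ?_
            congr 1; omega
        rw [e1, e2]
        exact Multiset.Rel.cons (hr t) (Multiset.rel_refl_of_refl_on fun x _ => hrefl x)
      · rw [hmem' (t + 3) (k - 4) _ (by omega) (by omega)]; omega
      · rw [hmem' (t + 3) (k - 3) _ (by omega) (by omega)]; omega
    · refine ⟨t + k - 2, ?_, ?_, ?_⟩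
      · obtain ⟨j, hj⟩ : ∃ j, m = j + 1 := ⟨m - 1, by omega⟩
        have e1 : D t = q (t + k - 1) ::ₘ (Multiset.range j).map fun i => q (t + 3 * i) := by
          simp only [hD, hj, Multiset.range_succ, Multiset.map_cons]
          congr 2; omega
        have e2 : D (t + k - 2) = q (t + k - 2) ::ₘ
            (Multiset.range j).map fun i => q (t + 3 * i + 1) := by
          simp only [hD, hj, map_range_succ]
          congr 1
          refine Multiset.map_congr rfl fun i _ => ?_
          rw [← hqk (t + 3 * i + 1)]; congr 1; omega
        rw [e1, e2]
        refine Multiset.Rel.cons ?_ (rel_map_range fun i _ => hr _)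
        rw [show t + k - 1 = t + k - 2 + 1 by omega]
        exact hr' _
      · rw [hmem' (t + k - 2) 1 _ (by omega) (by omega)]; omega
      · rw [hmem' (t + k - 2) 2 _ (by omega) (by omega)]; omega
  refine ⟨Set.range D, ⟨D 0, 0, rfl⟩, ?_, ?_, ?_, ?_, ?_, ?_⟩
  · rintro _ ⟨t, rfl⟩
    simp [hD]
  · rintro _ ⟨t, rfl⟩
    refine (Multiset.nodup_range m).map_on fun i hi j hj h => ?_
    rw [Multiset.mem_range] at hi hj
    have h := Nat.ModEq.add_left_cancel' t ((hq _ _).1 h)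
    rw [Nat.ModEq, Nat.mod_eq_of_lt (by omega), Nat.mod_eq_of_lt (by omega)] at h
    omega
  · rintro _ ⟨t, rfl⟩ x hx
    obtain ⟨i, -, rfl⟩ := Multiset.mem_map.1 hx
    exact ⟨_, rfl⟩
  · rintro _ ⟨t, rfl⟩ _ ⟨s, rfl⟩
    obtain ⟨o, ho, hs⟩ := hoff t s
    rw [hs]
    rcases (by omega : o % 3 = 0 ∨ o % 3 = 1 ∨ o % 3 = 2) with h | h | h
    · exact ⟨_, ⟨t, rfl⟩, hself t, (hmem' t o _ ho rfl).2 h⟩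
    · exact ⟨_, ⟨t + 1, rfl⟩, hup t, (hmem' (t + 1) (o - 1) _ (by omega) (by omega)).2 (by omega)⟩
    · refine ⟨_, ⟨t + k - 1, rfl⟩, hdown t, ?_⟩
      by_cases h' : o + 1 < k
      · rw [← hqk]
        exact (hmem' (t + k - 1) (o + 1) _ h' (by omega)).2 (by omega)
      · exact (hmem' (t + k - 1) 0 _ (by omega) (by omega)).2 (by omega)
  · rintro _ ⟨t, rfl⟩ _ ⟨s, rfl⟩
    obtain ⟨t', h1, h2, -⟩ := hpair t s
    exact ⟨_, ⟨t', rfl⟩, h1, h2⟩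
  · rintro _ ⟨t, rfl⟩ _ _ ⟨s, rfl, rfl⟩
    obtain ⟨t', h1, h2, h3⟩ := hpair t s
    exact ⟨_, ⟨t', rfl⟩, h1, h2, h3⟩

/-- A cycle with `3 * j + 1` vertices through a vertex `a` needs `j` more guards. -/
theorem UpperBound.glue_cycle {r r₀ : W → W → Prop} {A : Set W} {F : W → W → Prop} {k j : ℕ}
    {q : ℕ → W} (hj : 1 ≤ j) (h : UpperBound r₀ A F k) (ha : q 0 ∈ A)
    (hq : ∀ i j', q i = q j' ↔ i ≡ j' [MOD 3 * j + 1]) (hA : ∀ i, 1 ≤ i → i ≤ 3 * j → q i ∉ A)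
    (hF : ∀ x y, F x y → x ∈ A ∧ y ∈ A) (hrefl : ∀ x, r x x)
    (hr₀ : ∀ x ∈ A, ∀ y ∈ A, r₀ x y → r x y)
    (hr : ∀ i, r (q i) (q (i + 1))) (hr' : ∀ i, r (q (i + 1)) (q i)) :
    UpperBound r (A ∪ Set.range q) (fun x y => F x y ∨ ∃ s, x = q s ∧ y = q (s + 1)) (k + j) := by
  set N : Set W := {x | ∃ i, 1 ≤ i ∧ i ≤ 3 * j ∧ q i = x} with hN
  -- Only `p` from 1 to 3 is used. Without `a` the cycle is a path of `3 * j` vertices, and `Z 2`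
  -- guards the middle vertex of each of its `j` consecutive triples.
  set Z : ℕ → Multiset W := fun p => (Multiset.range j).map fun i => q (3 * i + p) with hZ
  have hinj : ∀ {s t}, s ≤ 3 * j → t ≤ 3 * j → q s = q t → s = t := by
    intro s t hs ht h
    have := (hq _ _).1 h
    rwa [Nat.ModEq, Nat.mod_eq_of_lt (by omega), Nat.mod_eq_of_lt (by omega)] at this
  have hmem : ∀ p, 1 ≤ p → p ≤ 3 → ∀ t, 1 ≤ t → t ≤ 3 * j → (q t ∈ Z p ↔ t % 3 = p % 3) := by
    intro p hp hp' t ht ht'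
    simp only [hZ, Multiset.mem_map, Multiset.mem_range]
    constructor
    · rintro ⟨i, hi, h⟩
      have := hinj (by omega) ht' h
      omega
    · intro h
      exact ⟨(t - p) / 3, by omega, by congr 1; omega⟩
  have hlast : q (3 * j + 1) = q 0 := (hq _ _).2 (by simp [Nat.ModEq])
  have hstep : ∀ p, Multiset.Rel r (Z p) (Z (p + 1)) := fun p => rel_map_range fun i _ => hr _
  have hstep' : ∀ p, Multiset.Rel r (Z (p + 1)) (Z p) := fun p => rel_map_range fun i _ => hr' _
  have hself : ∀ C, Multiset.Rel r C C := fun C =>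
    Multiset.rel_refl_of_refl_on fun x _ => hrefl x
  -- Together with the guard on `q 0`, the first and the last of the three configurations differ by
  -- turning the cycle by one. This closes the circuit between residues 3 and 1.
  have e3 : q 0 ::ₘ Z 3 = (Multiset.range (j + 1)).map fun i => q (3 * i) := by
    rw [map_range_succ]; rfl
  have e1 : q 0 ::ₘ Z 1 = (Multiset.range (j + 1)).map fun i => q (3 * i + 1) := by
    rw [Multiset.range_succ, Multiset.map_cons, hlast]
  have hrot : ∀ p p', 1 ≤ p → p ≤ 3 → 1 ≤ p' → p' ≤ 3 →
      Multiset.Rel r (q 0 ::ₘ Z p) (q 0 ::ₘ Z p') := by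
    intro p p' h1 h2 h3 h4
    have h31 : Multiset.Rel r (q 0 ::ₘ Z 3) (q 0 ::ₘ Z 1) := by
      rw [e3, e1]; exact rel_map_range fun i _ => hr _
    have h13 : Multiset.Rel r (q 0 ::ₘ Z 1) (q 0 ::ₘ Z 3) := by
      rw [e3, e1]; exact rel_map_range fun i _ => hr' _
    interval_cases p <;> interval_cases p' <;> first
      | exact hself _
      | exact h31
      | exact h13
      | exact Multiset.Rel.cons (hrefl _) (hstep _)
      | exact Multiset.Rel.cons (hrefl _) (hstep' _)
  have hex : ∀ t, ∃ p, 1 ≤ p ∧ p ≤ 3 ∧ p % 3 = t % 3 := fun t =>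
    ⟨if t % 3 = 0 then 3 else t % 3, by split_ifs <;> omega, by split_ifs <;> omega,
      by split_ifs <;> omega⟩
  -- In the resting configuration `Z 2` both neighbours of `q 0` on the cycle are empty, so the two
  -- cycle edges at `q 0` are cleared by evicting `q 0` alone.
  have hB : ∀ t, 1 ≤ t → t ≤ 3 * j → t % 3 ≠ 2 → q t ∉ Z 2 := fun t h1 h2 h3 h =>
    h3 ((hmem 2 (by omega) (by omega) t h1 h2).1 h)
  have := UpperBound.glue_self_guarded (r := r) (N := N) (c := j)
    (F₁ := fun x y => ∃ s, 1 ≤ s ∧ s + 1 ≤ 3 * j ∧ x = q s ∧ y = q (s + 1))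
    (Z := {D | ∃ p, 1 ≤ p ∧ p ≤ 3 ∧ D = Z p}) (B := Z 2) h ha
    ⟨2, by omega, by omega, rfl⟩ ?_ ?_ ?_ ?_ hF ?_ hrefl hr₀ ?_ ?_ ?_ ?_ ?_
  · have hAN : A ∪ Set.range q = A ∪ N := by
      ext x
      constructor
      · rintro (hx | ⟨i, rfl⟩)
        · exact Or.inl hx
        · have : q i = q (i % (3 * j + 1)) := (hq _ _).2 (Nat.mod_modEq _ _).symm
          have hlt : i % (3 * j + 1) < 3 * j + 1 := Nat.mod_lt _ (by omega)
          rw [this]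
          rcases Nat.eq_zero_or_pos (i % (3 * j + 1)) with h | h
          · rw [h]; exact Or.inl ha
          · exact Or.inr ⟨_, h, by omega, rfl⟩
      · rintro (hx | ⟨i, -, -, rfl⟩)
        exacts [Or.inl hx, Or.inr ⟨_, rfl⟩]
    rw [hAN]
    refine this.mono_pairs ?_
    rintro x y (h | ⟨s, rfl, rfl⟩)
    · exact Or.inl h
    · have hs : q s = q (s % (3 * j + 1)) := (hq _ _).2 (Nat.mod_modEq _ _).symm
      have hs' : q (s + 1) = q (s % (3 * j + 1) + 1) :=
        (hq _ _).2 ((Nat.mod_modEq _ _).symm.add_right 1)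
      have hlt : s % (3 * j + 1) < 3 * j + 1 := Nat.mod_lt _ (by omega)
      rw [hs, hs']
      generalize s % (3 * j + 1) = s at *
      rcases (by omega : s = 0 ∨ s = 3 * j ∨ (1 ≤ s ∧ s + 1 ≤ 3 * j)) with rfl | rfl | ⟨h1, h2⟩
      · exact Or.inr (Or.inr (Or.inl ⟨rfl, ⟨1, by omega, by omega, rfl⟩,
          hB 1 (by omega) (by omega) (by omega)⟩))
      · exact Or.inr (Or.inr (Or.inr ⟨hlast, ⟨3 * j, by omega, by omega, rfl⟩,
          hB (3 * j) (by omega) (by omega) (by omega)⟩))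
      · exact Or.inr (Or.inl ⟨s, h1, h2, rfl, rfl⟩)
  · rintro _ ⟨p, -, -, rfl⟩
    simp [hZ]
  · rintro _ ⟨p, h1, h2, rfl⟩
    refine (Multiset.nodup_range j).map_on fun i hi i' hi' h => ?_
    rw [Multiset.mem_range] at hi hi'
    have := hinj (by omega) (by omega) h
    omega
  · rintro _ ⟨p, h1, h2, rfl⟩ x hx
    obtain ⟨i, hi, rfl⟩ := Multiset.mem_map.1 hx
    rw [Multiset.mem_range] at hi
    exact ⟨_, by omega, by omega, rfl⟩
  · rintro x hx ⟨i, h1, h2, rfl⟩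
    exact hA i h1 h2 hx
  · rintro x y ⟨s, h1, h2, rfl, rfl⟩
    exact ⟨⟨s, h1, by omega, rfl⟩, ⟨s + 1, by omega, by omega, rfl⟩⟩
  · rintro _ ⟨p, h1, h2, rfl⟩
    interval_cases p
    exacts [hstep 1, hself _, hstep' 2]
  · rintro _ ⟨p, h1, h2, rfl⟩
    interval_cases p
    exacts [hstep' 1, hself _, hstep 2]
  · rintro _ ⟨p, h1, h2, rfl⟩ _ ⟨t, h3, h4, rfl⟩
    obtain ⟨p', h5, h6, h7⟩ := hex t
    exact ⟨_, ⟨p', h5, h6, rfl⟩, hrot p p' h1 h2 h5 h6, (hmem p' h5 h6 t h3 h4).2 h7.symm⟩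
  · rintro _ ⟨p, h1, h2, rfl⟩ _ ⟨t, h3, h4, rfl⟩
    obtain ⟨p', h5, h6, h7⟩ := hex (t + 1)
    exact ⟨_, ⟨p', h5, h6, rfl⟩, hrot p p' h1 h2 h5 h6, fun h => by
      have := (hmem p' h5 h6 t h3 h4).1 h
      omega⟩
  · rintro _ ⟨p, h1, h2, rfl⟩ _ _ ⟨t, h3, h4, rfl, rfl⟩
    obtain ⟨p', h5, h6, h7⟩ := hex (t + 2)
    refine ⟨_, ⟨p', h5, h6, rfl⟩, hrot p p' h1 h2 h5 h6, fun h => ?_, fun h => ?_⟩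
    · have := (hmem p' h5 h6 t h3 (by omega)).1 h
      omega
    · have := (hmem p' h5 h6 (t + 1) (by omega) (by omega)).1 h
      omega

/-! ### Consecutive elements and words -/

/-- `x` and `y` are consecutive elements of the list. -/
def Consec : List W → W → W → Prop
  | a :: b :: l, x, y => (x = a ∧ y = b) ∨ Consec (b :: l) x y
  | _, _, _ => False

@[simp] theorem consec_nil {x y : W} : ¬ Consec [] x y := id

@[simp] theorem consec_singleton {a x y : W} : ¬ Consec [a] x y := id

@[simp] theorem consec_cons_cons {a b x y : W} {l : List W} :
    Consec (a :: b :: l) x y ↔ (x = a ∧ y = b) ∨ Consec (b :: l) x y := Iff.rfl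

theorem consec_append_cons {L₁ L₂ : List W} {z x y : W} :
    Consec (L₁ ++ z :: L₂) x y ↔ Consec (L₁ ++ [z]) x y ∨ Consec (z :: L₂) x y := by
  induction L₁ with
  | nil => simp
  | cons a L ih =>
    cases L with
    | nil => simp
    | cons b L =>
      simp only [List.cons_append, consec_cons_cons] at ih ⊢
      rw [ih, or_assoc]

theorem Consec.mem {L : List W} {x y : W} (h : Consec L x y) : x ∈ L ∧ y ∈ L := by
  induction L with
  | nil => exact h.elim
  | cons a L ih =>
    cases L with
    | nil => exact h.elim
    | cons b L =>
      rcases h with ⟨rfl, rfl⟩ | h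
      · simp
      · exact ⟨List.mem_cons_of_mem _ (ih h).1, List.mem_cons_of_mem _ (ih h).2⟩

/-- The vertices of a word, i.e. of a list of vertices that may carry a pendant, without the
pendants. -/
def spine (w : List (W × Option W)) : List W := w.map Prod.fst

/-- The vertices of a word, with the pendants. -/
def verts (w : List (W × Option W)) : List W := w.flatMap fun p => p.1 :: p.2.toList

/-- The number of letters without pendant. -/
def zeros (w : List (W × Option W)) : ℕ := w.countP fun p => p.2.isNone

/-- The number of letters with a pendant. -/
def ones (w : List (W × Option W)) : ℕ := w.countP fun p => p.2.isSome

@[simp] theorem verts_nil : verts ([] : List (W × Option W)) = [] := rfl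

@[simp] theorem verts_cons {v : W} {o : Option W} {w : List (W × Option W)} :
    verts ((v, o) :: w) = v :: (o.toList ++ verts w) := rfl

@[simp] theorem verts_append {w w' : List (W × Option W)} :
    verts (w ++ w') = verts w ++ verts w' := by simp [verts]

@[simp] theorem spine_nil : spine ([] : List (W × Option W)) = [] := rfl

@[simp] theorem spine_cons {v : W} {o : Option W} {w : List (W × Option W)} :
    spine ((v, o) :: w) = v :: spine w := rfl

@[simp] theorem spine_append {w w' : List (W × Option W)} :
    spine (w ++ w') = spine w ++ spine w' := by simp [spine]

theorem mem_spine {w : List (W × Option W)} {v : W} : v ∈ spine w ↔ ∃ o, (v, o) ∈ w := by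
  simp [spine]

theorem mem_verts_of_mem_spine {w : List (W × Option W)} {v : W} (h : v ∈ spine w) :
    v ∈ verts w := by
  obtain ⟨o, h⟩ := mem_spine.1 h
  exact List.mem_flatMap.2 ⟨_, h, by simp⟩

theorem mem_verts_of_mem {w : List (W × Option W)} {v l : W} (h : (v, some l) ∈ w) :
    l ∈ verts w :=
  List.mem_flatMap.2 ⟨_, h, by simp⟩

@[simp] theorem zeros_nil : zeros ([] : List (W × Option W)) = 0 := rfl

@[simp] theorem ones_nil : ones ([] : List (W × Option W)) = 0 := rfl

@[simp] theorem zeros_cons_none {v : W} {w : List (W × Option W)} :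
    zeros ((v, none) :: w) = zeros w + 1 := by simp [zeros]

@[simp] theorem zeros_cons_some {v l : W} {w : List (W × Option W)} :
    zeros ((v, some l) :: w) = zeros w := by simp [zeros]

@[simp] theorem ones_cons_none {v : W} {w : List (W × Option W)} :
    ones ((v, none) :: w) = ones w := by simp [ones]

@[simp] theorem ones_cons_some {v l : W} {w : List (W × Option W)} :
    ones ((v, some l) :: w) = ones w + 1 := by simp [ones]

@[simp] theorem zeros_append {w w' : List (W × Option W)} :
    zeros (w ++ w') = zeros w + zeros w' := by simp [zeros]

@[simp] theorem ones_append {w w' : List (W × Option W)} :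
    ones (w ++ w') = ones w + ones w' := by simp [ones]

theorem zeros_of_forall {w : List (W × Option W)} (h : ∀ p ∈ w, p.2 = none) :
    zeros w = w.length ∧ ones w = 0 ∧ verts w = spine w := by
  induction w with
  | nil => simp
  | cons p w ih =>
    obtain ⟨v, o⟩ := p
    obtain rfl : o = none := h _ List.mem_cons_self
    obtain ⟨h1, h2, h3⟩ := ih fun p hp => h p (List.mem_cons_of_mem _ hp)
    simp [h1, h2, h3]

/-! ### Small graphs -/

theorem UpperBound.edge {r : W → W → Prop} {a b : W} (hab : a ≠ b) (hrefl : ∀ x, r x x)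
    (h : r a b) (h' : r b a) {F : W → W → Prop} (hF : ∀ x y, ¬ F x y) :
    UpperBound r {a, b} F 1 := by
  have hrel : ∀ x ∈ ({a, b} : Set W), ∀ y ∈ ({a, b} : Set W), Multiset.Rel r {x} {y} := by
    intro x hx y hy
    refine Multiset.Rel.cons ?_ Multiset.Rel.zero
    rcases hx with rfl | rfl <;> rcases hy with rfl | rfl <;> first | assumption | exact hrefl _
  refine ⟨{C | ∃ x ∈ ({a, b} : Set W), C = {x}}, ⟨{a}, a, by simp, rfl⟩, ?_, ?_, ?_, ?_, ?_, ?_⟩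
  · rintro _ ⟨x, -, rfl⟩; simp
  · rintro _ ⟨x, -, rfl⟩; simp
  · rintro _ ⟨x, hx, rfl⟩ y hy
    rw [Multiset.mem_singleton.1 hy]; exact hx
  · rintro _ ⟨x, hx, rfl⟩ v hv
    exact ⟨_, ⟨v, hv, rfl⟩, hrel x hx v hv, by simp⟩
  · rintro _ ⟨x, hx, rfl⟩ v hv
    rcases hv with rfl | rfl
    · exact ⟨_, ⟨b, by simp, rfl⟩, hrel x hx b (by simp), by simpa⟩
    · exact ⟨_, ⟨a, by simp, rfl⟩, hrel x hx a (by simp), by simpa using hab.symm⟩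
  · intro C _ u v h
    exact absurd h (hF u v)

/-- Any two of the three placements of two guards can be reached from each other in one move. -/
theorem UpperBound.path {r : W → W → Prop} {a b c : W} (hab : a ≠ b) (hbc : b ≠ c) (hac : a ≠ c)
    (hrefl : ∀ x, r x x) (rab : r a b) (rba : r b a) (rbc : r b c) (rcb : r c b)
    {F : W → W → Prop} (hF : ∀ x y, ¬ F x y) : UpperBound r {a, b, c} F 2 := by
  set S : Set (Multiset W) := {a ::ₘ {b}, b ::ₘ {c}, a ::ₘ {c}} with hS
  have two : ∀ {x y x' y' : W}, r x x' → r y y' → Multiset.Rel r (x ::ₘ {y}) (x' ::ₘ {y'}) :=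
    fun h h' => Multiset.Rel.cons h (Multiset.Rel.cons h' Multiset.Rel.zero)
  have hrel : ∀ C ∈ S, ∀ C' ∈ S, Multiset.Rel r C C' := by
    rintro _ (rfl | rfl | rfl) _ (rfl | rfl | rfl)
    · exact two (hrefl _) (hrefl _)
    · exact two rab rbc
    · exact two (hrefl _) rbc
    · exact two rba rcb
    · exact two (hrefl _) (hrefl _)
    · exact two rba (hrefl _)
    · exact two (hrefl _) rcb
    · exact two rab (hrefl _)
    · exact two (hrefl _) (hrefl _)
  refine ⟨S, ⟨_, Or.inl rfl⟩, ?_, ?_, ?_, ?_, ?_, ?_⟩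
  · rintro _ (rfl | rfl | rfl) <;> simp
  · rintro _ (rfl | rfl | rfl) <;> simp [hab, hbc, hac]
  · rintro _ (rfl | rfl | rfl) x hx <;>
      simp only [Multiset.mem_cons, Multiset.mem_singleton] at hx <;>
      rcases hx with rfl | rfl <;> simp
  · rintro C hC _ (rfl | rfl | rfl)
    · exact ⟨_, Or.inl rfl, hrel C hC _ (Or.inl rfl), by simp⟩
    · exact ⟨_, Or.inl rfl, hrel C hC _ (Or.inl rfl), by simp⟩
    · exact ⟨_, Or.inr (Or.inl rfl), hrel C hC _ (Or.inr (Or.inl rfl)), by simp⟩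
  · rintro C hC _ (rfl | rfl | rfl)
    · exact ⟨_, Or.inr (Or.inl rfl), hrel C hC _ (Or.inr (Or.inl rfl)), by simp [hab, hac]⟩
    · exact ⟨_, Or.inr (Or.inr rfl), hrel C hC _ (Or.inr (Or.inr rfl)), by simp [hab.symm, hbc]⟩
    · exact ⟨_, Or.inl rfl, hrel C hC _ (Or.inl rfl), by simp [hac.symm, hbc.symm]⟩
  · intro C _ u v h
    exact absurd h (hF u v)

/-! ### Cycles with pendants -/

/-- The graph that is left on `A` when a piece hanging at `a` is removed: there is a pendant at `a`
iff `z` is not divisible by `3`. -/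
def ReducedBound (r₀ : W → W → Prop) (A : Set W) (F : W → W → Prop) (k : ℕ) (a : W) (z : ℕ) :
    Prop :=
  (z % 3 = 0 → WeakUpperBound r₀ A F k) ∧
  (z % 3 ≠ 0 → ∃ x ∉ A, UpperBound r₀ (insert x A) F k ∧
    (∀ y ∈ insert x A, r₀ x y → y = a ∨ y = x) ∧ (∀ y ∈ insert x A, r₀ y x → y = a ∨ y = x))

/-- If the length of `L` is divisible by three, the rest of the cycle guards itself
(`UpperBound.glue_cycle`), or the cycle is the whole graph when `A` is a single vertex. Otherwise
the strategy of the cycle is glued to the reduced graph with a pendant at `a`; the guard saved by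
gluing makes up for rounding up. -/
theorem UpperBound.plain_cycle {r r₀ : W → W → Prop} {A : Set W} {F : W → W → Prop} {k : ℕ} {a : W}
    {L : List W} (ha : a ∈ A) (hL : L.Nodup) (hLA : ∀ y ∈ L, y ∉ A) (hrefl : ∀ x, r x x)
    (hr₀ : ∀ x ∈ A, ∀ y ∈ A, r₀ x y → r x y) (hF : ∀ x y, F x y → x ∈ A ∧ y ∈ A)
    (hF' : ∀ x, ¬ F x x) (hchain : ∀ x y, Consec (a :: L ++ [a]) x y → r x y ∧ r y x)
    (hlen : 2 ≤ L.length) (h : ReducedBound r₀ A F k a L.length) :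
    UpperBound r (A ∪ {y | y ∈ L}) (fun x y => F x y ∨ Consec (a :: L ++ [a]) x y)
      (k + L.length / 3) := by
  obtain ⟨n, hn⟩ : ∃ n, n = L.length + 1 := ⟨_, rfl⟩
  have hn' : (a :: L).length = n := by simp [hn]
  have hnpos : 0 < n := by omega
  set q : ℕ → W := fun i => (a :: L)[i % n]'(by rw [hn']; exact Nat.mod_lt _ hnpos) with hqdef
  have hnd : (a :: L).Nodup := List.nodup_cons.2 ⟨fun h => hLA a h ha, hL⟩
  have hq : ∀ i j, q i = q j ↔ i ≡ j [MOD n] := fun i j => hnd.getElem_inj_iff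
  have hq0 : q 0 = a := by simp [hqdef]
  have hrange : ∀ x, x ∈ Set.range q ↔ x ∈ a :: L := by
    intro x
    constructor
    · rintro ⟨i, rfl⟩
      exact List.getElem_mem _
    · intro hx
      obtain ⟨i, hi, rfl⟩ := List.getElem_of_mem hx
      exact ⟨i, by simp [hqdef, Nat.mod_eq_of_lt (hn' ▸ hi)]⟩
  have consec_iff : ∀ (l : List W) (x y : W), Consec l x y ↔
      ∃ i, ∃ h : i + 1 < l.length, x = l[i] ∧ y = l[i + 1] := by
    intro l
    induction l with
    | nil => simp
    | cons b l ih =>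
      cases l with
      | nil => simp
      | cons c l =>
        intro x y
        rw [consec_cons_cons, ih]
        constructor
        · rintro (⟨rfl, rfl⟩ | ⟨i, h, rfl, rfl⟩)
          · exact ⟨0, by simp, by simp, by simp⟩
          · exact ⟨i + 1, by simpa using h, by simp, by simp⟩
        · rintro ⟨i, h, h1, h2⟩
          cases i with
          | zero => exact Or.inl ⟨by simpa using h1, by simpa using h2⟩
          | succ i => exact Or.inr ⟨i, by simpa using h, by simpa using h1, by simpa using h2⟩
  have hget : ∀ i (h : i < (a :: L ++ [a]).length), (a :: L ++ [a])[i] = q i := by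
    intro i h
    have hi : i < n ∨ i = n := by simp at h; omega
    rcases hi with hi | rfl
    · rw [List.getElem_append_left (by omega)]
      simp [hqdef, Nat.mod_eq_of_lt hi]
    · rw [List.getElem_append_right (by omega)]
      simp [hqdef]
  have hconsec : ∀ x y, Consec (a :: L ++ [a]) x y ↔ ∃ s, x = q s ∧ y = q (s + 1) := by
    intro x y
    rw [consec_iff]
    constructor
    · rintro ⟨i, h, rfl, rfl⟩
      exact ⟨i, hget _ _, hget _ _⟩
    · rintro ⟨s, rfl, rfl⟩
      have hlt : s % n < n := Nat.mod_lt _ hnpos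
      have h1 : q s = q (s % n) := (hq _ _).2 (Nat.mod_modEq _ _).symm
      have h2 : q (s + 1) = q (s % n + 1) := (hq _ _).2 ((Nat.mod_modEq _ _).symm.add_right 1)
      have hl : s % n + 1 < (a :: L ++ [a]).length := by simp; omega
      exact ⟨s % n, hl, by rw [hget, h1], by rw [hget, h2]⟩
  have hqr : ∀ i, r (q i) (q (i + 1)) := fun i => (hchain _ _ ((hconsec _ _).2 ⟨i, rfl, rfl⟩)).1
  have hqr' : ∀ i, r (q (i + 1)) (q i) := fun i => (hchain _ _ ((hconsec _ _).2 ⟨i, rfl, rfl⟩)).2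
  have hset : A ∪ {y | y ∈ L} = A ∪ Set.range q := by
    ext x
    simp only [Set.mem_union, hrange, List.mem_cons, Set.mem_ofPred_eq]
    constructor
    · tauto
    · rintro (h | rfl | h)
      exacts [Or.inl h, Or.inl ha, Or.inr h]
  have hcyc := UpperBound.cycle (r := r) (q := q) (k := n) (by omega) hq hrefl hqr hqr'
  rw [hset]
  simp only [hconsec]
  by_cases hz : L.length % 3 = 0
  · obtain ⟨j, hj⟩ : ∃ j, L.length = 3 * j := ⟨L.length / 3, by omega⟩
    rw [show L.length / 3 = j by omega]
    rcases h.1 hz with h | ⟨rfl, b, hb⟩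
    · refine UpperBound.glue_cycle (by omega) h (hq0 ▸ ha) (by rw [← hj, ← hn]; exact hq) ?_ hF hrefl
        hr₀ hqr hqr'
      intro i h1 h2 h3
      have hi : i < n := by omega
      have : q i ∈ L := by
        have : q i = (a :: L)[i] := by simp [hqdef, Nat.mod_eq_of_lt hi]
        rw [this, List.getElem_cons, dif_neg (by omega)]
        exact List.getElem_mem _
      exact hLA _ this h3
    · have hAa : ∀ x ∈ A, x = a := by
        rw [hb] at ha ⊢
        rintro x rfl
        exact ha.symm
      have e : A ∪ Set.range q = Set.range q := Set.union_eq_right.2 fun x hx => by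
        rw [hAa x hx]; exact ⟨0, hq0⟩
      rw [e, show 1 + j = (n + 2) / 3 by omega]
      refine hcyc.mono_pairs ?_
      rintro x y (h | h)
      · have := hF x y h
        rw [hAa x this.1, hAa y this.2] at h
        exact absurd h (hF' a)
      · exact h
  · obtain ⟨x, hxA, h, h1, h2⟩ := h.2 hz
    refine UpperBound.glue h (a := a) (by rwa [show L.length / 3 + 1 = (n + 2) / 3 by omega]) hxA ha
      ⟨0, hq0⟩ ?_ hF ?_ hrefl hr₀ (fun _ _ _ _ h => h) h1 h2
    · intro y hy hy'
      rcases List.mem_cons.1 ((hrange y).1 hy') with h | h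
      · exact h
      · exact absurd hy (hLA y h)
    · rintro y z ⟨s, rfl, rfl⟩
      exact ⟨⟨_, rfl⟩, ⟨_, rfl⟩⟩

/-- Both vertices with their pendants are attached independently, one guard each. If `A` is a single
vertex without eviction, the path `a`, `u`, `l` is the start instead, with `a` seen as a pendant at
`u`, and the rest is a triangle with a pendant. -/
theorem UpperBound.cycle_one_one {r r₀ : W → W → Prop} {A : Set W} {F : W → W → Prop} {k : ℕ}
    {a u l u' l' : W} (ha : a ∈ A) (hw : [u, l, u', l'].Nodup)
    (hwA : ∀ y ∈ [u, l, u', l'], y ∉ A)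
    (hrefl : ∀ x, r x x) (hr₀ : ∀ x ∈ A, ∀ y ∈ A, r₀ x y → r x y)
    (hF : ∀ x y, F x y → x ∈ A ∧ y ∈ A) (hF' : ∀ x, ¬ F x x)
    (hau : r a u) (hua : r u a) (huu : r u u') (huu' : r u' u) (hau' : r a u') (hua' : r u' a)
    (hul : r u l) (hlu : r l u) (hul' : r u' l') (hlu' : r l' u')
    (h : WeakUpperBound r₀ A F k) :
    UpperBound r (A ∪ {y | y ∈ [u, l, u', l']})
      (fun x y => F x y ∨ Consec [a, u, u', a] x y) (k + 2) := by
  simp only [List.nodup_cons, List.mem_cons, List.not_mem_nil, or_false, not_or, not_false_eq_true,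
    List.nodup_nil, and_true] at hw
  obtain ⟨⟨h1, h2, h3⟩, ⟨h4, h5⟩, h6⟩ := hw
  have huA : u ∉ A := hwA u (by simp)
  have hlA : l ∉ A := hwA l (by simp)
  have huA' : u' ∉ A := hwA u' (by simp)
  have hlA' : l' ∉ A := hwA l' (by simp)
  have hset : A ∪ {y | y ∈ [u, l, u', l']} = insert u' (insert l' (insert u (insert l A))) := by
    ext x; simp; tauto
  have hne : ∀ y, y ∉ A → y ≠ a := fun y hy h => hy (h ▸ ha)
  rw [hset]
  rcases h with h | ⟨rfl, b, rfl⟩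
  · have h1 := h.attach (r' := r) huA hlA h1 hr₀ hF (hrefl _) (hrefl _) hul hlu
    refine (h1.attach (r' := r) (u := u') (l := l') ?_ ?_ h6 (fun _ _ _ _ h => h) ?_ (hrefl _)
      (hrefl _) hul' hlu').mono_pairs ?_
    · simp [huA', Ne.symm h2, Ne.symm h4]
    · simp [hlA', Ne.symm h3, Ne.symm h5]
    · rintro x y (h | ⟨hx, rfl⟩ | ⟨rfl, hy⟩)
      · have := hF x y h
        simp [this.1, this.2]
      · simp [hx]
      · simp [hy]
    · rintro x y (h | h)
      · exact Or.inl (Or.inl h)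
      · simp only [consec_cons_cons, consec_singleton, or_false] at h
        rcases h with ⟨rfl, rfl⟩ | ⟨rfl, rfl⟩ | ⟨rfl, rfl⟩
        · exact Or.inl (Or.inr (Or.inl ⟨ha, rfl⟩))
        · exact Or.inr (Or.inl ⟨by simp, rfl⟩)
        · exact Or.inr (Or.inr ⟨rfl, by simp [ha]⟩)
  · obtain rfl : a = b := ha
    have hua0 := hne u huA
    have hla0 := hne l hlA
    have hua0' := hne u' huA'
    have hla0' := hne l' hlA'
    let r₁ : W → W → Prop := fun x y => x = y ∨ (x = a ∧ y = u) ∨ (x = u ∧ y = a) ∨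
      (x = u ∧ y = l) ∨ (x = l ∧ y = u)
    have hP : UpperBound r₁ (insert a {u, l}) (fun _ _ => False) 2 :=
      UpperBound.path hua0.symm h1 hla0.symm (fun _ => Or.inl rfl) (by simp [r₁]) (by simp [r₁])
        (by simp [r₁]) (by simp [r₁]) (fun _ _ => id)
    have := hP.triangle (r := r) (a := u) (u := u') (l := l') (by simp)
      (by simp [hua0.symm, hla0.symm]) (fun _ _ h => h.elim) ?_ ?_ ?_ ?_ ?_ hua0' hla0' h6 hrefl huu'
      huu hua' hau' hul' hlu'
    · have e : insert u' (insert l' (insert u (insert l ({a} : Set W)))) =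
          insert u' (insert l' (insert a {u, l})) := by
        ext x; simp; tauto
      rw [e, show 1 + 2 = 2 + 1 by omega]
      refine this.mono_pairs ?_
      rintro x y (h | h)
      · have := hF x y h
        simp only [Set.mem_singleton_iff] at this
        rw [this.1, this.2] at h
        exact absurd h (hF' a)
      · simp only [consec_cons_cons, consec_singleton, or_false] at h
        tauto
    · rintro x hx y hy (rfl | ⟨rfl, rfl⟩ | ⟨rfl, rfl⟩ | ⟨rfl, rfl⟩ | ⟨rfl, rfl⟩)
      exacts [hrefl _, hau, hua, hul, hlu]
    · rintro x hx (rfl | ⟨-, rfl⟩ | ⟨h, -⟩ | ⟨h, -⟩ | ⟨h, -⟩)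
      exacts [Or.inr rfl, Or.inl rfl, absurd h hua0.symm, absurd h hua0.symm, absurd h hla0.symm]
    · rintro x hx (rfl | ⟨-, h⟩ | ⟨h, -⟩ | ⟨-, h⟩ | ⟨-, h⟩)
      exacts [Or.inr rfl, absurd h hua0.symm, Or.inl h, absurd h hla0.symm, absurd h hua0.symm]
    · simp [Ne.symm h2, Ne.symm h4]
    · simp [Ne.symm h3, Ne.symm h5]

/-- The pendant of the reduced graph is renamed `y`, after which `UpperBound.triangle` applies. -/
theorem UpperBound.cycle_zero_one {r r₀ : W → W → Prop} {A : Set W} {F : W → W → Prop} {k : ℕ}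
    {a y u l : W} (ha : a ∈ A) (hw : [y, u, l].Nodup) (hwA : ∀ x ∈ [y, u, l], x ∉ A)
    (hrefl : ∀ x, r x x) (hr₀ : ∀ x ∈ A, ∀ y ∈ A, r₀ x y → r x y)
    (hF : ∀ x y, F x y → x ∈ A ∧ y ∈ A)
    (hau : r a u) (hua : r u a) (huy : r u y) (hyu : r y u) (hay : r a y) (hya : r y a)
    (hul : r u l) (hlu : r l u)
    (h : ReducedBound r₀ A F k a 1) :
    UpperBound r (A ∪ {x | x ∈ [y, u, l]}) (fun x x' => F x x' ∨ (x = a ∧ x' = y) ∨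
      (x = y ∧ x' = a) ∨ (x = y ∧ x' = u) ∨ (x = u ∧ x' = y) ∨ (x = u ∧ x' = a) ∨
      (x = a ∧ x' = u)) (k + 1) := by
  classical
  obtain ⟨x, hxA, h, h1, h2⟩ := h.2 (by omega)
  simp only [List.nodup_cons, List.mem_cons, List.not_mem_nil, or_false, not_or, not_false_eq_true,
    List.nodup_nil, and_true] at hw
  obtain ⟨⟨h3, h4⟩, h5⟩ := hw
  have hyA : y ∉ A := hwA y (by simp)
  have huA : u ∉ A := hwA u (by simp)
  have hlA : l ∉ A := hwA l (by simp)
  have hset : A ∪ {x | x ∈ [y, u, l]} = insert u (insert l (insert y A)) := by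
    ext x; simp; tauto
  have hne : ∀ z ∈ A, z ≠ x := fun z hz h => hxA (h ▸ hz)
  have hne' : ∀ z ∈ A, z ≠ y := fun z hz h => hyA (h ▸ hz)
  -- At `y` only those moves are kept that a pendant at `a` has.
  let r₁ : W → W → Prop := fun t t' => (t ∈ A ∧ t' ∈ A ∧ r₀ t t') ∨ (t = y ∧ (t' = a ∨ t' = y)) ∨
    (t' = y ∧ (t = a ∨ t = y))
  let f : W → W := fun t => if t = x then y else t
  have hfx : f x = y := if_pos rfl
  have hfA : ∀ t ∈ A, f t = t := fun t ht => if_neg (hne t ht)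
  have h' : UpperBound r₁ (insert y A) F k := by
    refine h.image f ?_ ?_ ?_ ?_
    · rintro s (rfl | hs) t (rfl | ht) hst
      · rfl
      · rw [hfx, hfA t ht] at hst
        exact absurd hst.symm (hne' t ht)
      · rw [hfx, hfA s hs] at hst
        exact absurd hst (hne' s hs)
      · rwa [hfA s hs, hfA t ht] at hst
    · rw [Set.image_insert_eq, hfx]
      congr 1
      ext t
      constructor
      · exact fun ht => ⟨t, ht, hfA t ht⟩
      · rintro ⟨s, hs, rfl⟩
        rwa [hfA s hs]
    · rintro s hs t ht hst
      rcases hs with rfl | hs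
      · rw [hfx]
        rcases h1 t ht hst with rfl | rfl
        · rw [hfA t ha]; exact Or.inr (Or.inl ⟨rfl, Or.inl rfl⟩)
        · rw [hfx]; exact Or.inr (Or.inl ⟨rfl, Or.inr rfl⟩)
      · rcases ht with rfl | ht
        · rw [hfx, hfA s hs]
          rcases h2 s (Or.inr hs) hst with rfl | rfl
          · exact Or.inr (Or.inr ⟨rfl, Or.inl rfl⟩)
          · exact absurd hs hxA
        · rw [hfA s hs, hfA t ht]
          exact Or.inl ⟨hs, ht, hst⟩
    · intro s t hst
      obtain ⟨hs, ht⟩ := hF s t hst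
      exact ⟨s, Or.inr hs, t, Or.inr ht, hst, hfA s hs, hfA t ht⟩
  rw [hset]
  refine h'.triangle ha hyA hF ?_ ?_ ?_ huA hlA (Ne.symm h3) (Ne.symm h4) h5 hrefl hua hau huy hyu
    hul hlu
  · rintro s hs t ht (⟨hs', ht', hst⟩ | ⟨rfl, rfl | rfl⟩ | ⟨rfl, rfl | rfl⟩)
    exacts [hr₀ s hs' t ht' hst, hya, hrefl _, hay, hrefl _]
  · rintro t ht (⟨hs', -⟩ | ⟨-, h⟩ | ⟨rfl, -⟩)
    exacts [absurd hs' hyA, h, Or.inr rfl]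
  · rintro t ht (⟨-, hs', -⟩ | ⟨rfl, -⟩ | ⟨-, h⟩)
    exacts [absurd hs' hyA, Or.inr rfl, h]

/-- Vertices with pendants are reinserted one by one by `UpperBound.subdivide`. The induction ends
at a cycle without pendants or at a triangle. -/
theorem UpperBound.cycle_word {r₀ : W → W → Prop} {A : Set W} {F : W → W → Prop} {k : ℕ} {a : W}
    (ha : a ∈ A) (hF : ∀ x y, F x y → x ∈ A ∧ y ∈ A) (hF' : ∀ x, ¬ F x x)
    (n : ℕ) (w : List (W × Option W)) (hn : w.length = n) (hlen : 2 ≤ n) (r : W → W → Prop)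
    (hw : (verts w).Nodup) (hwA : ∀ y ∈ verts w, y ∉ A) (hrefl : ∀ x, r x x)
    (hr₀ : ∀ x ∈ A, ∀ y ∈ A, r₀ x y → r x y)
    (hchain : ∀ x y, Consec (a :: spine w ++ [a]) x y → r x y ∧ r y x)
    (hpend : ∀ v l, (v, some l) ∈ w → r v l ∧ r l v)
    (h : ReducedBound r₀ A F k a (zeros w)) :
    UpperBound r (A ∪ {y | y ∈ verts w}) (fun x y => F x y ∨ Consec (a :: spine w ++ [a]) x y)
      (k + (ones w + zeros w / 3)) := by
  induction n generalizing w r with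
  | zero => omega
  | succ n ih =>
    by_cases hall : ∀ p ∈ w, p.2 = none
    · obtain ⟨h1, h2, h3⟩ := zeros_of_forall hall
      have hs : (spine w).length = w.length := by simp [spine]
      rw [h1, h2, zero_add, h3, ← hs]
      rw [h3] at hw hwA
      rw [h1, ← hs] at h
      exact UpperBound.plain_cycle ha hw hwA hrefl hr₀ hF hF' hchain (by omega) h
    · push Not at hall
      obtain ⟨⟨u, o⟩, hp, ho⟩ := hall
      obtain ⟨l, rfl⟩ := Option.ne_none_iff_exists'.1 ho
      obtain ⟨w₁, w₂, rfl⟩ := List.append_of_mem hp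
      simp only [List.length_append, List.length_cons] at hn
      -- Two letters and `a` form a triangle, which does not arise by subdividing a shorter cycle.
      by_cases hn2 : n = 1
      · have hcase : (∃ p, w₁ = [p] ∧ w₂ = []) ∨ (∃ p, w₁ = [] ∧ w₂ = [p]) := by
          rcases (by omega : w₁.length = 1 ∧ w₂.length = 0 ∨ w₁.length = 0 ∧ w₂.length = 1) with
            ⟨h1, h2⟩ | ⟨h1, h2⟩
          · obtain ⟨p, rfl⟩ := List.length_eq_one_iff.1 h1
            exact Or.inl ⟨p, rfl, List.length_eq_zero_iff.1 h2⟩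
          · obtain ⟨p, rfl⟩ := List.length_eq_one_iff.1 h2
            exact Or.inr ⟨p, List.length_eq_zero_iff.1 h1, rfl⟩
        have hul := hpend u l hp
        rcases hcase with ⟨⟨v, o⟩, rfl, rfl⟩ | ⟨⟨v, o⟩, rfl, rfl⟩
        · have h1 := hchain a v (by simp)
          have h2 := hchain v u (by simp)
          have h3 := hchain u a (by simp)
          cases o with
          | none =>
            rw [show ones ([(v, none)] ++ [(u, some l)]) + zeros ([(v, none)] ++ [(u, some l)]) / 3
              = 1 by simp]
            refine (UpperBound.cycle_zero_one (y := v) (u := u) (l := l) ha (by simpa using hw)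
              (by simpa using hwA) hrefl hr₀ hF h3.2 h3.1 h2.2 h2.1 h1.1 h1.2 hul.1 hul.2
              (by simpa using h)).mono_pairs ?_
            intro x y hxy
            simp at hxy
            tauto
          | some l₁ =>
            have hvl := hpend v l₁ (by simp)
            rw [show ones ([(v, some l₁)] ++ [(u, some l)]) +
              zeros ([(v, some l₁)] ++ [(u, some l)]) / 3 = 2 by simp]
            exact UpperBound.cycle_one_one (u := v) (l := l₁) (u' := u) (l' := l) ha hw hwA hrefl hr₀
              hF hF' h1.1 h1.2 h2.1 h2.2 h3.2 h3.1 hvl.1 hvl.2 hul.1 hul.2 (h.1 (by simp))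
        · have h1 := hchain a u (by simp)
          have h2 := hchain u v (by simp)
          have h3 := hchain v a (by simp)
          cases o with
          | none =>
            have hperm : [v, u, l].Perm [u, l, v] := by
              exact (List.perm_append_comm : ([v] ++ [u, l]).Perm ([u, l] ++ [v]))
            have := UpperBound.cycle_zero_one (y := v) (u := u) (l := l) ha
              (hperm.nodup_iff.2 (by simpa using hw))
              (fun y hy => hwA y (by simpa using hperm.mem_iff.1 hy))
              hrefl hr₀ hF h1.1 h1.2 h2.1 h2.2 h3.2 h3.1 hul.1 hul.2
              (by simpa using h)
            have e : {x | x ∈ [v, u, l]} = {y | y ∈ verts ([] ++ [(u, some l), (v, none)])} := by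
              ext x; exact hperm.mem_iff
            rw [e] at this
            rw [show ones ([] ++ [(u, some l), (v, none)]) + zeros ([] ++ [(u, some l), (v, none)]) / 3
              = 1 by simp]
            refine this.mono_pairs ?_
            intro x y hxy
            simp at hxy
            tauto
          | some l₁ =>
            have hvl := hpend v l₁ (by simp)
            rw [show ones ([] ++ [(u, some l), (v, some l₁)]) +
              zeros ([] ++ [(u, some l), (v, some l₁)]) / 3 = 2 by simp]
            exact UpperBound.cycle_one_one (u := u) (l := l) (u' := v) (l' := l₁) ha hw hwA hrefl hr₀
              hF hF' h1.1 h1.2 h2.1 h2.2 h3.2 h3.1 hul.1 hul.2 hvl.1 hvl.2 (h.1 (by simp))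
      · obtain ⟨L₁, z, hL₁⟩ : ∃ L₁ z, a :: spine w₁ = L₁ ++ [z] :=
          ⟨_, _, (List.dropLast_append_getLast (List.cons_ne_nil a (spine w₁))).symm⟩
        obtain ⟨z', L₂, hL₂⟩ : ∃ z' L₂, spine w₂ ++ [a] = z' :: L₂ :=
          List.exists_cons_of_ne_nil (by simp)
        have e1 : a :: spine (w₁ ++ (u, some l) :: w₂) ++ [a] = L₁ ++ z :: u :: z' :: L₂ := by
          rw [spine_append, spine_cons, ← List.cons_append, hL₁]
          simp [hL₂]
        have e2 : a :: spine (w₁ ++ w₂) ++ [a] = L₁ ++ z :: z' :: L₂ := by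
          rw [spine_append, ← List.cons_append, hL₁]
          simp [hL₂]
        have c1 : ∀ x y, Consec (L₁ ++ z :: u :: z' :: L₂) x y ↔ Consec (L₁ ++ [z]) x y ∨
            (x = z ∧ y = u) ∨ (x = u ∧ y = z') ∨ Consec (z' :: L₂) x y := by
          intro x y; rw [consec_append_cons, consec_cons_cons, consec_cons_cons]
        have c2 : ∀ x y, Consec (L₁ ++ z :: z' :: L₂) x y ↔ Consec (L₁ ++ [z]) x y ∨
            (x = z ∧ y = z') ∨ Consec (z' :: L₂) x y := by
          intro x y; rw [consec_append_cons, consec_cons_cons]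
        rw [e1] at hchain ⊢
        have hzu := hchain z u ((c1 _ _).2 (Or.inr (Or.inl ⟨rfl, rfl⟩)))
        have huz' := hchain u z' ((c1 _ _).2 (Or.inr (Or.inr (Or.inl ⟨rfl, rfl⟩))))
        have hul := hpend u l hp
        have hmem : ∀ x, x ∈ verts (w₁ ++ (u, some l) :: w₂) ↔
            x = u ∨ x = l ∨ x ∈ verts (w₁ ++ w₂) := by
          intro x; simp; tauto
        have hnd : u ∉ verts (w₁ ++ w₂) ∧ l ∉ verts (w₁ ++ w₂) ∧ u ≠ l ∧
            (verts (w₁ ++ w₂)).Nodup := by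
          have hperm : (verts (w₁ ++ (u, some l) :: w₂)).Perm (u :: l :: verts (w₁ ++ w₂)) := by
            simp only [verts_append, verts_cons, Option.toList_some, List.cons_append, List.nil_append]
            exact (List.perm_middle.trans (List.Perm.cons u List.perm_middle))
          have := hperm.nodup_iff.1 hw
          simp only [List.nodup_cons, List.mem_cons, not_or] at this
          tauto
        obtain ⟨hu, hl, hul', hnd⟩ := hnd
        have hsub : ∀ x ∈ a :: spine (w₁ ++ w₂) ++ [a], x ∈ A ∪ {y | y ∈ verts (w₁ ++ w₂)} := by
          intro x hx
          simp only [List.cons_append, List.mem_cons, List.mem_append] at hx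
          rcases hx with rfl | h | rfl | h
          · exact Or.inl ha
          · exact Or.inr (mem_verts_of_mem_spine h)
          · exact Or.inl ha
          · simp at h
        -- The shorter cycle runs along a new edge from `z` to `z'`, so the move relation has to
        -- vary in the induction.
        have key := ih (w₁ ++ w₂) (by simp; omega) (by omega)
          (fun x y => r x y ∨ (x = z ∧ y = z') ∨ (x = z' ∧ y = z)) hnd
          (fun y hy => hwA y ((hmem y).2 (Or.inr (Or.inr hy)))) (fun x => Or.inl (hrefl x))
          (fun x hx y hy h => Or.inl (hr₀ x hx y hy h)) ?_ ?_ (by simpa using h)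
        · rw [e2] at key hsub
          have := key.subdivide (r := r) (z := z) (z' := z') (u := u) (l := l) ?_ ?_
            (fun x _ y _ h => h) ?_ ?_ hul' hrefl hzu.1 hzu.2 huz'.2 huz'.1 hul.1 hul.2
          · have hset : A ∪ {y | y ∈ verts (w₁ ++ (u, some l) :: w₂)} =
                insert u (insert l (A ∪ {y | y ∈ verts (w₁ ++ w₂)})) := by
              ext x
              simp only [Set.mem_union, Set.mem_ofPred_eq, hmem, Set.mem_insert_iff]
              tauto
            rw [hset]
            have hcount : k + (ones (w₁ ++ (u, some l) :: w₂) + zeros (w₁ ++ (u, some l) :: w₂) / 3)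
                = k + (ones (w₁ ++ w₂) + zeros (w₁ ++ w₂) / 3) + 1 := by
              simp; omega
            rw [hcount]
            refine this.mono_pairs ?_
            rintro x y (h | h)
            · exact Or.inl (Or.inl h)
            · rcases (c1 x y).1 h with h | h | h | h
              · exact Or.inl (Or.inr ((c2 x y).2 (Or.inl h)))
              · exact Or.inr (Or.inl h)
              · exact Or.inr (Or.inr h)
              · exact Or.inl (Or.inr ((c2 x y).2 (Or.inr (Or.inr h))))
          · rintro x y (h | h)
            · exact ⟨Or.inl (hF x y h).1, Or.inl (hF x y h).2⟩
            · exact ⟨hsub x h.mem.1, hsub y h.mem.2⟩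
          · exact Or.inr ((c2 _ _).2 (Or.inr (Or.inl ⟨rfl, rfl⟩)))
          · rintro (h | h)
            exacts [hwA u ((hmem u).2 (Or.inl rfl)) h, hu h]
          · rintro (h | h)
            exacts [hwA l ((hmem l).2 (Or.inr (Or.inl rfl))) h, hl h]
        · intro x y hxy
          rw [e2] at hxy
          rcases (c2 x y).1 hxy with h | ⟨rfl, rfl⟩ | h
          · have := hchain x y ((c1 x y).2 (Or.inl h))
            exact ⟨Or.inl this.1, Or.inl this.2⟩
          · exact ⟨Or.inr (Or.inl ⟨rfl, rfl⟩), Or.inr (Or.inr ⟨rfl, rfl⟩)⟩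
          · have := hchain x y ((c1 x y).2 (Or.inr (Or.inr (Or.inr h))))
            exact ⟨Or.inl this.1, Or.inl this.2⟩
        · intro v l' hv
          have := hpend v l' (by simp at hv ⊢; tauto)
          exact ⟨Or.inl this.1, Or.inl this.2⟩

/-- Attaching, at `a`, a vertex with a pendant. -/
theorem WeakUpperBound.attach {r r₀ : W → W → Prop} {A : Set W} {F : W → W → Prop} {k : ℕ}
    {a u l : W} (h : WeakUpperBound r₀ A F k) (ha : a ∈ A) (hu : u ∉ A) (hl : l ∉ A) (hul : u ≠ l)
    (hrefl : ∀ x, r x x) (hr₀ : ∀ x ∈ A, ∀ y ∈ A, r₀ x y → r x y)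
    (hF : ∀ x y, F x y → x ∈ A ∧ y ∈ A) (hF' : ∀ x, ¬ F x x)
    (rau : r a u) (rua : r u a) (rul : r u l) (rlu : r l u) :
    UpperBound r (insert u (insert l A)) F (k + 1) := by
  rcases h with h | ⟨rfl, b, rfl⟩
  · exact (h.attach hu hl hul hr₀ hF (hrefl _) (hrefl _) rul rlu).mono_pairs fun x y h => Or.inl h
  · obtain rfl : a = b := ha
    have := UpperBound.path (F := F) (fun h => hu h.symm) hul (fun h => hl h.symm) hrefl rau rua
      rul rlu ?_
    · have e : insert u (insert l {a}) = ({a, u, l} : Set W) := by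
        ext x; simp; tauto
      rwa [e]
    · intro x y h
      have := hF x y h
      simp only [Set.mem_singleton_iff] at this
      rw [this.1, this.2] at h
      exact hF' a h

/-! ### Lower bounds for cycles with pendants -/

/-- The moves on a closed walk through `a` and the spine of `w`, with the pendants of `w`, together
with the moves of `r₀` on `A`. -/
def WordRel (r₀ : W → W → Prop) (A : Set W) (a : W) (w : List (W × Option W)) (x y : W) : Prop :=
  x = y ∨ (x ∈ A ∧ y ∈ A ∧ r₀ x y) ∨ Consec (a :: spine w ++ [a]) x y ∨
    Consec (a :: spine w ++ [a]) y x ∨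
    ∃ v l, (v, some l) ∈ w ∧ ((x = v ∧ y = l) ∨ (x = l ∧ y = v))

theorem spine_subset {A : Set W} {a : W} (ha : a ∈ A) {w : List (W × Option W)} {x : W}
    (hx : x ∈ a :: spine w ++ [a]) : x ∈ A ∪ {y | y ∈ verts w} := by
  simp only [List.cons_append, List.mem_cons, List.mem_append] at hx
  rcases hx with rfl | h | rfl | h
  · exact Or.inl ha
  · exact Or.inr (mem_verts_of_mem_spine h)
  · exact Or.inl ha
  · simp at h

theorem verts_perm_middle {w₁ w₂ : List (W × Option W)} {u l : W} :
    (verts (w₁ ++ (u, some l) :: w₂)).Perm (u :: l :: verts (w₁ ++ w₂)) := by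
  simp only [verts_append, verts_cons, Option.toList_some, List.cons_append, List.nil_append]
  exact (List.perm_middle.trans (List.Perm.cons u List.perm_middle))

/-- The closed neighbourhood of the pendant `l` is `{u, l}`, which therefore always holds a guard.
It is contracted to the predecessor `z` of `u`; everything next to it then lies on `z` or the
successor `z'`, which are adjacent or equal in the shorter closed walk. -/
theorem LowerBound.remove_one {r₀ : W → W → Prop} {A : Set W} {a : W} {k : ℕ} (ha : a ∈ A)
    {w₁ w₂ : List (W × Option W)} {u l : W} (hw : (verts (w₁ ++ (u, some l) :: w₂)).Nodup)
    (hwA : ∀ y ∈ verts (w₁ ++ (u, some l) :: w₂), y ∉ A)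
    (h : LowerBound (WordRel r₀ A a (w₁ ++ w₂)) (A ∪ {y | y ∈ verts (w₁ ++ w₂)}) k) :
    LowerBound (WordRel r₀ A a (w₁ ++ (u, some l) :: w₂))
      (A ∪ {y | y ∈ verts (w₁ ++ (u, some l) :: w₂)}) (k + 1) := by
  classical
  obtain ⟨L₁, z, hL₁⟩ : ∃ L₁ z, a :: spine w₁ = L₁ ++ [z] :=
    ⟨_, _, (List.dropLast_append_getLast (List.cons_ne_nil a (spine w₁))).symm⟩
  obtain ⟨z', L₂, hL₂⟩ : ∃ z' L₂, spine w₂ ++ [a] = z' :: L₂ :=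
    List.exists_cons_of_ne_nil (by simp)
  have e1 : a :: spine (w₁ ++ (u, some l) :: w₂) ++ [a] = L₁ ++ z :: u :: z' :: L₂ := by
    rw [spine_append, spine_cons, ← List.cons_append, hL₁]
    simp [hL₂]
  have e2 : a :: spine (w₁ ++ w₂) ++ [a] = L₁ ++ z :: z' :: L₂ := by
    rw [spine_append, ← List.cons_append, hL₁]
    simp [hL₂]
  set B : Set W := A ∪ {y | y ∈ verts (w₁ ++ w₂)} with hB
  have hnd := verts_perm_middle.nodup_iff.1 hw
  simp only [List.nodup_cons, List.mem_cons, not_or] at hnd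
  have hmem : ∀ x, x ∈ verts (w₁ ++ (u, some l) :: w₂) ↔
      x = u ∨ x = l ∨ x ∈ verts (w₁ ++ w₂) := fun x => by
    rw [verts_perm_middle.mem_iff]; simp
  have huB : u ∉ B := fun h => h.elim (hwA u ((hmem u).2 (Or.inl rfl))) hnd.1.2
  have hlB : l ∉ B := fun h => h.elim (hwA l ((hmem l).2 (Or.inr (Or.inl rfl)))) hnd.2.1
  have hsub : ∀ x ∈ L₁ ++ z :: z' :: L₂, x ∈ B := fun x hx => spine_subset ha (e2 ▸ hx)
  have hzB : z ∈ B := hsub z (by simp)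
  have hzB' : z' ∈ B := hsub z' (by simp)
  -- the moves that do not involve `u` and `l`
  set R := WordRel r₀ A a (w₁ ++ w₂) with hR
  have hzz : R z z' ∧ R z' z := by
    have : Consec (a :: spine (w₁ ++ w₂) ++ [a]) z z' := by
      rw [e2, consec_append_cons]; simp
    exact ⟨Or.inr (Or.inr (Or.inl this)), Or.inr (Or.inr (Or.inr (Or.inl this)))⟩
  have hRr : ∀ x, R x x := fun x => Or.inl rfl
  have hconsec : ∀ x y, Consec (a :: spine (w₁ ++ (u, some l) :: w₂) ++ [a]) x y →
      (R x y ∧ R y x ∧ x ∈ B ∧ y ∈ B) ∨ (x = z ∧ y = u) ∨ (x = u ∧ y = z') := by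
    intro x y h
    have key : Consec (a :: spine (w₁ ++ w₂) ++ [a]) x y → R x y ∧ R y x ∧ x ∈ B ∧ y ∈ B := fun h =>
      ⟨Or.inr (Or.inr (Or.inl h)), Or.inr (Or.inr (Or.inr (Or.inl h))),
        spine_subset ha h.mem.1, spine_subset ha h.mem.2⟩
    rw [e1, consec_append_cons, consec_cons_cons, consec_cons_cons] at h
    rw [e2, consec_append_cons, consec_cons_cons] at key
    tauto
  have hcases : ∀ x y, WordRel r₀ A a (w₁ ++ (u, some l) :: w₂) x y →
      x = y ∨ (R x y ∧ x ∈ B ∧ y ∈ B) ∨ (x = z ∧ y = u) ∨ (x = u ∧ y = z') ∨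
      (x = u ∧ y = z) ∨ (x = z' ∧ y = u) ∨ (x = u ∧ y = l) ∨ (x = l ∧ y = u) := by
    rintro x y (h | ⟨h1, h2, h3⟩ | h | h | ⟨v, l', h, h'⟩)
    · exact Or.inl h
    · exact Or.inr (Or.inl ⟨Or.inr (Or.inl ⟨h1, h2, h3⟩), Or.inl h1, Or.inl h2⟩)
    · rcases hconsec x y h with h | h | h <;> simp only [h, true_and, and_self, true_or, or_true]
    · rcases hconsec y x h with h | h | h <;> simp only [h, true_and, and_self, true_or, or_true]
    · have h : (v = u ∧ l' = l) ∨ (v, some l') ∈ w₁ ++ w₂ := by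
        simp only [List.mem_append, List.mem_cons, Prod.mk.injEq, Option.some.injEq] at h ⊢
        tauto
      rcases h with ⟨rfl, rfl⟩ | h
      · rcases h' with h' | h' <;> simp only [h', and_self, true_or, or_true]
      · have hR' : R x y := Or.inr (Or.inr (Or.inr (Or.inr ⟨v, l', h, h'⟩)))
        have hv : v ∈ B := Or.inr (mem_verts_of_mem_spine (mem_spine.2 ⟨_, h⟩))
        have hl' : l' ∈ B := Or.inr (mem_verts_of_mem h)
        rcases h' with ⟨rfl, rfl⟩ | ⟨rfl, rfl⟩
        exacts [Or.inr (Or.inl ⟨hR', hv, hl'⟩), Or.inr (Or.inl ⟨hR', hl', hv⟩)]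
  have hneu : ∀ x ∈ B, x ≠ u := fun x hx h => huB (h ▸ hx)
  have hnel : ∀ x ∈ B, x ≠ l := fun x hx h => hlB (h ▸ hx)
  have hul : u ≠ l := hnd.1.1
  set f : W → W := fun t => if t = u ∨ t = l then z else t with hf
  have hfu : f u = z := if_pos (Or.inl rfl)
  have hfl : f l = z := if_pos (Or.inr rfl)
  have hfB : ∀ x ∈ B, f x = x := fun x hx => if_neg (not_or.2 ⟨hneu x hx, hnel x hx⟩)
  refine h.contract f {u, l} l ?_ ?_ ?_ ?_ ?_ ?_
  · exact Or.inr ((hmem l).2 (Or.inr (Or.inl rfl)))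
  · intro x _ hx
    rcases hcases x l hx with h | ⟨-, -, h⟩ | ⟨-, h⟩ | ⟨-, h⟩ | ⟨-, h⟩ | ⟨-, h⟩ | ⟨h, -⟩ | ⟨h, -⟩
    exacts [Or.inr h, absurd h hlB, absurd h.symm hul, absurd h.symm (hnel _ hzB'),
      absurd h.symm (hnel _ hzB), absurd h.symm hul, Or.inl h, Or.inr h]
  · rintro x (hx | hx)
    · rw [hfB x (Or.inl hx)]; exact Or.inl hx
    · rcases (hmem x).1 hx with rfl | rfl | hx
      · rw [hfu]; exact hzB
      · rw [hfl]; exact hzB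
      · rw [hfB x (Or.inr hx)]; exact Or.inr hx
  · intro x _ y _ hxy
    rcases hcases x y hxy with rfl | ⟨h, h1, h2⟩ | ⟨rfl, rfl⟩ | ⟨rfl, rfl⟩ | ⟨rfl, rfl⟩ | ⟨rfl, rfl⟩ |
      ⟨rfl, rfl⟩ | ⟨rfl, rfl⟩
    · exact hRr _
    · rwa [hfB x h1, hfB y h2]
    · rw [hfu, hfB _ hzB]; exact hRr _
    · rw [hfu, hfB _ hzB']; exact hzz.1
    · rw [hfu, hfB _ hzB]; exact hRr _
    · rw [hfu, hfB _ hzB']; exact hzz.2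
    · rw [hfu, hfl]; exact hRr _
    · rw [hfu, hfl]; exact hRr _
  · have hnb : ∀ g ∈ ({u, l} : Set W), ∀ y, WordRel r₀ A a (w₁ ++ (u, some l) :: w₂) g y ∨
        WordRel r₀ A a (w₁ ++ (u, some l) :: w₂) y g → f y = z ∨ f y = z' := by
      intro g hg y hy
      have hy : y = u ∨ y = l ∨ y = z ∨ y = z' := by
        have hgB : g ∉ B := by rcases hg with rfl | rfl <;> assumption
        have hg : g = u ∨ g = l := hg
        rcases hy with hy | hy
        · have := hcases g y hy
          grind
        · have := hcases y g hy
          grind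
      rcases hy with rfl | rfl | rfl | rfl
      exacts [Or.inl hfu, Or.inl hfl, Or.inl (hfB _ hzB), Or.inr (hfB _ hzB')]
    intro g hg g' hg' x _ y _ h1 h2
    rcases hnb g hg y (Or.inl h1) with e | e <;> rcases hnb g' hg' x (Or.inr h2) with e' | e' <;>
      rw [e, e']
    exacts [hRr _, hzz.2, hzz.1, hRr _]
  · intro v hv
    refine ⟨v, ?_, ?_, hfB v hv⟩
    · rcases hv with h | h
      exacts [Or.inl h, Or.inr ((hmem v).2 (Or.inr (Or.inr h)))]
    · rintro (h | h)
      exacts [hneu v hv h, hnel v hv h]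

/-- The three vertices form the closed neighbourhood of the middle one and so always hold a guard.
Sending the first two to `a` and the last one to its successor `d` brings all their neighbours to
`a` or `d`, which become consecutive. -/
theorem LowerBound.remove_zeros {r₀ : W → W → Prop} {A : Set W} {a : W} {k : ℕ} (ha : a ∈ A)
    {w : List (W × Option W)} {p q s : W}
    (hw : (verts ((p, none) :: (q, none) :: (s, none) :: w)).Nodup)
    (hwA : ∀ y ∈ verts ((p, none) :: (q, none) :: (s, none) :: w), y ∉ A)
    (h : LowerBound (WordRel r₀ A a w) (A ∪ {y | y ∈ verts w}) k) :
    LowerBound (WordRel r₀ A a ((p, none) :: (q, none) :: (s, none) :: w))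
      (A ∪ {y | y ∈ verts ((p, none) :: (q, none) :: (s, none) :: w)}) (k + 1) := by
  classical
  obtain ⟨d, L, hL⟩ : ∃ d L, spine w ++ [a] = d :: L := List.exists_cons_of_ne_nil (by simp)
  set B : Set W := A ∪ {y | y ∈ verts w} with hB
  simp only [verts_cons, Option.toList_none, List.nil_append, List.nodup_cons, List.mem_cons,
    not_or] at hw
  obtain ⟨⟨hpq, hps, hpw⟩, ⟨hqs, hqw⟩, hsw, -⟩ := hw
  have hpB : p ∉ B := fun h => h.elim (hwA p (by simp)) hpw
  have hqB : q ∉ B := fun h => h.elim (hwA q (by simp)) hqw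
  have hsB : s ∉ B := fun h => h.elim (hwA s (by simp)) hsw
  have haB : a ∈ B := Or.inl ha
  have hdB : d ∈ B := spine_subset ha (w := w) (by rw [List.cons_append, hL]; simp)
  set R := WordRel r₀ A a w with hR
  have hRr : ∀ x, R x x := fun x => Or.inl rfl
  have had : R a d ∧ R d a := by
    have : Consec (a :: spine w ++ [a]) a d := by rw [List.cons_append, hL]; simp
    exact ⟨Or.inr (Or.inr (Or.inl this)), Or.inr (Or.inr (Or.inr (Or.inl this)))⟩
  have hconsec : ∀ x y, Consec (a :: spine ((p, none) :: (q, none) :: (s, none) :: w) ++ [a]) x y →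
      (R x y ∧ R y x ∧ x ∈ B ∧ y ∈ B) ∨ (x = a ∧ y = p) ∨ (x = p ∧ y = q) ∨ (x = q ∧ y = s) ∨
      (x = s ∧ y = d) := by
    intro x y h
    have key : Consec (a :: spine w ++ [a]) x y → R x y ∧ R y x ∧ x ∈ B ∧ y ∈ B := fun h =>
      ⟨Or.inr (Or.inr (Or.inl h)), Or.inr (Or.inr (Or.inr (Or.inl h))),
        spine_subset ha h.mem.1, spine_subset ha h.mem.2⟩
    simp only [spine_cons, List.cons_append, hL, consec_cons_cons] at h key
    rcases h with h | h | h | h | h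
    exacts [Or.inr (Or.inl h), Or.inr (Or.inr (Or.inl h)), Or.inr (Or.inr (Or.inr (Or.inl h))),
      Or.inr (Or.inr (Or.inr (Or.inr h))), Or.inl (key (Or.inr h))]
  have hcases : ∀ x y, WordRel r₀ A a ((p, none) :: (q, none) :: (s, none) :: w) x y →
      x = y ∨ (R x y ∧ x ∈ B ∧ y ∈ B) ∨ ((x = a ∧ y = p) ∨ (x = p ∧ y = q) ∨ (x = q ∧ y = s) ∨
      (x = s ∧ y = d)) ∨ ((y = a ∧ x = p) ∨ (y = p ∧ x = q) ∨ (y = q ∧ x = s) ∨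
      (y = s ∧ x = d)) := by
    rintro x y (h | ⟨h1, h2, h3⟩ | h | h | ⟨v, l', h, h'⟩)
    · exact Or.inl h
    · exact Or.inr (Or.inl ⟨Or.inr (Or.inl ⟨h1, h2, h3⟩), Or.inl h1, Or.inl h2⟩)
    · rcases hconsec x y h with h | h | h | h | h <;>
        simp only [h, true_and, and_self, true_or, or_true]
    · rcases hconsec y x h with h | h | h | h | h <;>
        simp only [h, true_and, and_self, true_or, or_true]
    · have h : (v, some l') ∈ w := by simpa using h
      have hR' : R x y := Or.inr (Or.inr (Or.inr (Or.inr ⟨v, l', h, h'⟩)))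
      have hv : v ∈ B := Or.inr (mem_verts_of_mem_spine (mem_spine.2 ⟨_, h⟩))
      have hl' : l' ∈ B := Or.inr (mem_verts_of_mem h)
      rcases h' with ⟨rfl, rfl⟩ | ⟨rfl, rfl⟩
      exacts [Or.inr (Or.inl ⟨hR', hv, hl'⟩), Or.inr (Or.inl ⟨hR', hl', hv⟩)]
  set f : W → W := fun t => if t = p ∨ t = q then a else if t = s then d else t with hf
  have hfp : f p = a := if_pos (Or.inl rfl)
  have hfq : f q = a := if_pos (Or.inr rfl)
  have hfs : f s = d := by rw [hf]; simp [Ne.symm hps, Ne.symm hqs]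
  have hne : ∀ x ∈ B, x ≠ p ∧ x ≠ q ∧ x ≠ s := fun x hx =>
    ⟨fun h => hpB (h ▸ hx), fun h => hqB (h ▸ hx), fun h => hsB (h ▸ hx)⟩
  have hfB : ∀ x ∈ B, f x = x := fun x hx => by simp [hf, hne x hx]
  have hmem : ∀ x, x ∈ verts ((p, none) :: (q, none) :: (s, none) :: w) ↔
      x = p ∨ x = q ∨ x = s ∨ x ∈ verts w := fun x => by simp
  refine h.contract f {p, q, s} q ?_ ?_ ?_ ?_ ?_ ?_
  · exact Or.inr ((hmem q).2 (by simp))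
  · intro x _ hx
    have h1 := hcases x q hx
    have h2 := hne a haB
    have h3 := hne d hdB
    simp only [Set.mem_insert_iff, Set.mem_singleton_iff]
    grind
  · rintro x (hx | hx)
    · rw [hfB x (Or.inl hx)]; exact Or.inl hx
    · rcases (hmem x).1 hx with rfl | rfl | rfl | hx
      · rw [hfp]; exact haB
      · rw [hfq]; exact haB
      · rw [hfs]; exact hdB
      · rw [hfB x (Or.inr hx)]; exact Or.inr hx
  · intro x _ y _ hxy
    have ha' := hfB a haB
    have hd' := hfB d hdB
    rcases hcases x y hxy with rfl | ⟨h, h1, h2⟩ | (⟨rfl, rfl⟩ | ⟨rfl, rfl⟩ | ⟨rfl, rfl⟩ | ⟨rfl, rfl⟩) |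
      (⟨rfl, rfl⟩ | ⟨rfl, rfl⟩ | ⟨rfl, rfl⟩ | ⟨rfl, rfl⟩)
    · exact hRr _
    · rwa [hfB x h1, hfB y h2]
    · rw [hfp, ha']; exact hRr _
    · rw [hfp, hfq]; exact hRr _
    · rw [hfq, hfs]; exact had.1
    · rw [hfs, hd']; exact hRr _
    · rw [hfp, ha']; exact hRr _
    · rw [hfp, hfq]; exact hRr _
    · rw [hfq, hfs]; exact had.2
    · rw [hfs, hd']; exact hRr _
  · have hnb : ∀ g ∈ ({p, q, s} : Set W), ∀ y,
        WordRel r₀ A a ((p, none) :: (q, none) :: (s, none) :: w) g y ∨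
        WordRel r₀ A a ((p, none) :: (q, none) :: (s, none) :: w) y g → f y = a ∨ f y = d := by
      intro g hg y hy
      have hy : y = p ∨ y = q ∨ y = s ∨ y = a ∨ y = d := by
        have hgB : g ∉ B := by rcases hg with rfl | rfl | rfl <;> assumption
        simp only [Set.mem_insert_iff, Set.mem_singleton_iff] at hg
        rcases hy with hy | hy
        · have := hcases g y hy
          grind
        · have := hcases y g hy
          grind
      rcases hy with rfl | rfl | rfl | rfl | rfl
      exacts [Or.inl hfp, Or.inl hfq, Or.inr hfs, Or.inl (hfB _ haB), Or.inr (hfB _ hdB)]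
    intro g hg g' hg' x _ y _ h1 h2
    rcases hnb g hg y (Or.inl h1) with e | e <;> rcases hnb g' hg' x (Or.inr h2) with e' | e' <;>
      rw [e, e']
    exacts [hRr _, had.2, had.1, hRr _]
  · intro v hv
    refine ⟨v, ?_, ?_, hfB v hv⟩
    · rcases hv with h | h
      exacts [Or.inl h, Or.inr ((hmem v).2 (by simp [show v ∈ verts w from h]))]
    · have := hne v hv
      simp only [Set.mem_insert_iff, Set.mem_singleton_iff]
      tauto

/-- Letters with pendants are removed first, then triples without. One or two remaining letters are
folded onto the pendant `x`; if none remains, the closed walk is a loop at `a`, which is harmless.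
Unlike the upper bound this has no restriction on the length of `w`: a word with one letter
describes a bridge. -/
theorem LowerBound.cycle_word {r₀ : W → W → Prop} {A : Set W} {a : W} {k : ℕ} (ha : a ∈ A)
    (hrefl : ∀ x, r₀ x x) (n : ℕ) (w : List (W × Option W)) (hn : w.length = n)
    (hw : (verts w).Nodup) (hwA : ∀ y ∈ verts w, y ∉ A)
    (h₀ : zeros w % 3 = 0 → LowerBound r₀ A k)
    (h₁ : zeros w % 3 ≠ 0 → ∃ x ∉ A, LowerBound r₀ (insert x A) k ∧ r₀ a x ∧ r₀ x a) :
    LowerBound (WordRel r₀ A a w) (A ∪ {y | y ∈ verts w}) (k + (ones w + zeros w / 3)) := by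
  classical
  induction n using Nat.strong_induction_on generalizing w with
  | _ n ih =>
  by_cases hall : ∀ p ∈ w, p.2 = none
  · match w, hw, hwA, hall with
    | [], hw, hwA, hall =>
      rw [show k + (ones ([] : List (W × Option W)) + zeros ([] : List (W × Option W)) / 3) = k by simp]
      refine LowerBound.of_hom (k := k) (h₀ rfl) id ?_ ?_ ?_
      · rintro x (hx | hx)
        · exact hx
        · simp at hx
      · rintro x - y - (rfl | ⟨-, -, h⟩ | h | h | ⟨v, l, h, -⟩)
        · exact hrefl _
        · exact h
        · simp at h; rw [h.1, h.2]; exact hrefl _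
        · simp at h; rw [h.1, h.2]; exact hrefl _
        · simp at h
      · exact fun v hv => ⟨v, Or.inl hv, rfl⟩
    | [(p, o)], hw, hwA, hall =>
      obtain rfl : o = none := hall (p, o) (by simp)
      obtain ⟨x, hxA, h, h1, h2⟩ := h₁ (by simp)
      have hpA := hwA p (by simp)
      have hfp : (if p = p then x else p) = x := if_pos rfl
      have hf : ∀ t ∈ A, (if t = p then x else t) = t := fun t ht =>
        if_neg fun (h : t = p) => hpA (h ▸ ht)
      rw [show k + (ones [(p, (none : Option W))] + zeros [(p, (none : Option W))] / 3) = k by simp]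
      refine h.of_hom (fun t => if t = p then x else t) ?_ ?_ ?_
      · rintro t (ht | ht)
        · rw [hf t ht]; exact Or.inr ht
        · obtain rfl : t = p := by simpa using ht
          rw [if_pos rfl]; exact Or.inl rfl
      · have hc : ∀ t t', Consec (a :: spine [(p, (none : Option W))] ++ [a]) t t' →
            (t = a ∧ t' = p) ∨ (t = p ∧ t' = a) := by
          intro t t' h; simpa using h
        rintro t - t' - (rfl | ⟨h, h', h''⟩ | h | h | ⟨v, l, h, -⟩)
        · exact hrefl _
        · rwa [hf t h, hf t' h']
        · rcases hc t t' h with ⟨rfl, rfl⟩ | ⟨rfl, rfl⟩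
          · rw [hf t ha, hfp]; exact h1
          · rw [hf t' ha, hfp]; exact h2
        · rcases hc t' t h with ⟨rfl, rfl⟩ | ⟨rfl, rfl⟩
          · rw [hf t' ha, hfp]; exact h2
          · rw [hf t ha, hfp]; exact h1
        · simp at h
      · rintro t (rfl | ht)
        · exact ⟨p, Or.inr (by simp), hfp⟩
        · exact ⟨t, Or.inl ht, hf t ht⟩
    | [(p, o), (q, o')], hw, hwA, hall =>
      obtain rfl : o = none := hall (p, o) (by simp)
      obtain rfl : o' = none := hall (q, o') (by simp)
      obtain ⟨x, hxA, h, h1, h2⟩ := h₁ (by simp)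
      have hpA := hwA p (by simp)
      have hqA := hwA q (by simp)
      have hfp : (if p = p ∨ p = q then x else p) = x := if_pos (Or.inl rfl)
      have hfq : (if q = p ∨ q = q then x else q) = x := if_pos (Or.inr rfl)
      have hf : ∀ t ∈ A, (if t = p ∨ t = q then x else t) = t := fun t ht =>
        if_neg (not_or.2 ⟨fun (h : t = p) => hpA (h ▸ ht), fun (h : t = q) => hqA (h ▸ ht)⟩)
      rw [show k + (ones [(p, (none : Option W)), (q, none)] +
        zeros [(p, (none : Option W)), (q, none)] / 3) = k by simp]
      refine h.of_hom (fun t => if t = p ∨ t = q then x else t) ?_ ?_ ?_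
      · rintro t (ht | ht)
        · rw [hf t ht]; exact Or.inr ht
        · have ht : t = p ∨ t = q := by simpa using ht
          rw [if_pos ht]; exact Or.inl rfl
      · have hc : ∀ t t', Consec (a :: spine [(p, (none : Option W)), (q, none)] ++ [a]) t t' →
            (t = a ∧ t' = p) ∨ (t = p ∧ t' = q) ∨ (t = q ∧ t' = a) := by
          intro t t' h; simpa using h
        rintro t - t' - (rfl | ⟨h, h', h''⟩ | h | h | ⟨v, l, h, -⟩)
        · exact hrefl _
        · rwa [hf t h, hf t' h']
        · rcases hc t t' h with ⟨rfl, rfl⟩ | ⟨rfl, rfl⟩ | ⟨rfl, rfl⟩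
          · rw [hf t ha, hfp]; exact h1
          · rw [hfp, hfq]; exact hrefl _
          · rw [hf t' ha, hfq]; exact h2
        · rcases hc t' t h with ⟨rfl, rfl⟩ | ⟨rfl, rfl⟩ | ⟨rfl, rfl⟩
          · rw [hf t' ha, hfp]; exact h2
          · rw [hfp, hfq]; exact hrefl _
          · rw [hf t ha, hfq]; exact h1
        · simp at h
      · rintro t (rfl | ht)
        · exact ⟨p, Or.inr (by simp), hfp⟩
        · exact ⟨t, Or.inl ht, hf t ht⟩
    | (p, o) :: (q, o') :: (s, o'') :: w, hw, hwA, hall =>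
      obtain rfl : o = none := hall (p, o) (by simp)
      obtain rfl : o' = none := hall (q, o') (by simp)
      obtain rfl : o'' = none := hall (s, o'') (by simp)
      have hz : zeros ((p, none) :: (q, none) :: (s, none) :: w) = zeros w + 3 := by simp
      have := LowerBound.remove_zeros ha hw hwA (ih w.length (by simp at hn; omega) w rfl ?_ ?_ ?_ ?_)
      · have e : k + (ones ((p, none) :: (q, none) :: (s, none) :: w) +
            zeros ((p, none) :: (q, none) :: (s, none) :: w) / 3) =
            k + (ones w + zeros w / 3) + 1 := by
          rw [hz]; simp; omega
        rwa [e]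
      · simp at hw; tauto
      · intro y hy
        exact hwA y (by simp [hy])
      · intro h
        exact h₀ (by omega)
      · intro h
        exact h₁ (by omega)
  · push Not at hall
    obtain ⟨⟨u, o⟩, hp, ho⟩ := hall
    obtain ⟨l, rfl⟩ := Option.ne_none_iff_exists'.1 ho
    obtain ⟨w₁, w₂, rfl⟩ := List.append_of_mem hp
    have hnd := verts_perm_middle.nodup_iff.1 hw
    have := LowerBound.remove_one ha hw hwA (ih (w₁ ++ w₂).length (by simp at hn ⊢; omega) (w₁ ++ w₂)
      rfl ?_ ?_ ?_ ?_)
    · have e : k + (ones (w₁ ++ (u, some l) :: w₂) + zeros (w₁ ++ (u, some l) :: w₂) / 3) =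
          k + (ones (w₁ ++ w₂) + zeros (w₁ ++ w₂) / 3) + 1 := by
        simp; omega
      rwa [e]
    · simp only [List.nodup_cons] at hnd; tauto
    · intro y hy
      exact hwA y (verts_perm_middle.mem_iff.2 (List.mem_cons_of_mem _ (List.mem_cons_of_mem _ hy)))
    · intro h
      exact h₀ (by simpa using h)
    · intro h
      exact h₁ (by simpa using h)

end Guards

/-! ### Cacti -/

namespace SimpleGraph

variable {V : Type*}

/-- `x` and `y` are joined by a walk that avoids `v`. -/
def ConnectedAvoiding (G : SimpleGraph V) (v x y : V) : Prop :=
  ∃ p : G.Walk x y, v ∉ p.support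

theorem ConnectedAvoiding.symm {G : SimpleGraph V} {v x y : V} (h : G.ConnectedAvoiding v x y) :
    G.ConnectedAvoiding v y x := by
  obtain ⟨p, hp⟩ := h
  exact ⟨p.reverse, by simpa using hp⟩

theorem ConnectedAvoiding.trans {G : SimpleGraph V} {v x y z : V} (h : G.ConnectedAvoiding v x y)
    (h' : G.ConnectedAvoiding v y z) : G.ConnectedAvoiding v x z := by
  obtain ⟨p, hp⟩ := h
  obtain ⟨q, hq⟩ := h'
  exact ⟨p.append q, by rw [Walk.mem_support_append_iff]; tauto⟩

theorem connectedAvoiding_of_consec {G : SimpleGraph V} {v : V} {L : List V}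
    (hL : ∀ x y, Guards.Consec L x y → G.Adj x y) (hv : v ∉ L) {x y : V} (hx : x ∈ L) (hy : y ∈ L) :
    G.ConnectedAvoiding v x y := by
  have key : ∀ (L : List V) (a : V), (∀ x y, Guards.Consec (a :: L) x y → G.Adj x y) →
      v ∉ a :: L → ∀ y ∈ a :: L, G.ConnectedAvoiding v a y := by
    intro L
    induction L with
    | nil =>
      intro a _ hv y hy
      obtain rfl : y = a := by simpa using hy
      exact ⟨Walk.nil, by simpa using hv⟩
    | cons b L ih =>
      intro a hL hv y hy
      rcases List.mem_cons.1 hy with rfl | hy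
      · refine ⟨Walk.nil, ?_⟩
        simp at hv ⊢; tauto
      · have hab : G.Adj a b := hL a b (Or.inl ⟨rfl, rfl⟩)
        have h1 : G.ConnectedAvoiding v a b := ⟨hab.toWalk, by simp at hv ⊢; tauto⟩
        exact h1.trans (ih b (fun x y h => hL x y (Or.inr h))
          (fun h => hv (List.mem_cons_of_mem _ h)) y hy)
  cases L with
  | nil => simp at hx
  | cons a L => exact (key L a hL hv x hx).symm.trans (key L a hL hv y hy)

/-- A vertex of a cactus does not have three neighbours that are connected without it. -/
theorem IsCactus.false_of_connectedAvoiding {G : SimpleGraph V} (hG : G.IsCactus) {v x y u : V}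
    (hx : G.Adj v x) (hy : G.Adj v y) (hu : G.Adj v u) (hxy : x ≠ y) (hxu : x ≠ u) (hyu : y ≠ u)
    (h : G.ConnectedAvoiding v x u) (h' : G.ConnectedAvoiding v y u) : False := by
  classical
  -- A path that avoids `v`, closed up through `v`, is a cycle with exactly two known edges at `v`.
  -- The two cycles obtained share the edge to `u` but differ in the other edge at `v`.
  have key : ∀ x, G.Adj v x → x ≠ u → G.ConnectedAvoiding v x u → ∃ c : G.Walk u u, c.IsCycle ∧
      ∀ z, s(v, z) ∈ c.edges ↔ z = u ∨ z = x := by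
    rintro x hx hxu ⟨p, hp⟩
    have hq : v ∉ p.bypass.support := fun h => hp (p.support_bypass_subset_support h)
    have hqe : ∀ z, s(v, z) ∉ p.bypass.edges := fun z h => hq (Walk.fst_mem_support_of_mem_edges _ h)
    refine ⟨Walk.cons hu.symm (Walk.cons hx p.bypass), ?_, ?_⟩
    · rw [Walk.cons_isCycle_iff, Walk.cons_isPath_iff]
      refine ⟨⟨p.bypass_isPath, hq⟩, ?_⟩
      rw [Walk.edges_cons, List.mem_cons, Sym2.eq_swap]
      rintro (h | h)
      · rw [Sym2.congr_right] at h
        exact hxu h.symm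
      · exact hqe _ h
    · intro z
      rw [Walk.edges_cons, Walk.edges_cons, List.mem_cons, List.mem_cons, Sym2.eq_swap (a := u),
        Sym2.congr_right, Sym2.congr_right]
      have := hqe z
      tauto
  obtain ⟨c, hc, hce⟩ := key x hx hxu h
  obtain ⟨d, hd, hde⟩ := key y hy hyu h'
  have := (hG.2 s(v, u) u u c d hc hd ((hce u).2 (Or.inl rfl)) ((hde u).2 (Or.inl rfl)) s(v, x)).1
    ((hce x).2 (Or.inr rfl))
  rcases (hde x).1 this with h | h
  exacts [hxu h, hxy h]

/-- An edge has no articulation of its own, and in a finite graph it extends to a maximal such set.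
-/
theorem exists_isBlock [Finite V] {G : SimpleGraph V} {v x : V} (hx : G.Adj v x) :
    ∃ B, G.IsBlock B ∧ v ∈ B ∧ x ∈ B := by
  have hns : G.IsNonseparable {v, x} := by
    constructor
    · exact induce_pair_connected_of_adj hx
    · rintro w hw
      have : (({v, x} : Set V) \ {w}).Subsingleton := by
        rintro a ⟨ha, ha'⟩ b ⟨hb, hb'⟩
        simp only [Set.mem_insert_iff, Set.mem_singleton_iff] at *
        grind
      intro a b
      have : a = b := Subtype.ext (this a.2 b.2)
      rw [this]
  obtain ⟨B, hB, hmax⟩ := (Set.toFinite {B | G.IsNonseparable B}).exists_le_maximal hns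
  exact ⟨B, hmax, hB (by simp), hB (by simp)⟩

/-- A block stays connected without `v`, and walks that avoid `v` cannot leave `D`. -/
theorem IsBlock.subset_of_closed {G : SimpleGraph V} {B D : Set V} {v x : V} (hB : G.IsBlock B)
    (hv : v ∈ B) (hxB : x ∈ B) (hxv : x ≠ v) (hx : x ∈ D)
    (hD : ∀ z ∈ D, ∀ t, G.Adj z t → t ∈ D ∨ t = v) : B \ {v} ⊆ D := by
  have hpre := hB.prop.2 v hv
  rintro y hy
  obtain ⟨p⟩ := hpre ⟨x, hxB, hxv⟩ ⟨y, hy⟩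
  have key : ∀ {a b : ↥(B \ {v})}, (G.induce (B \ {v})).Walk a b → (a : V) ∈ D → (b : V) ∈ D := by
    intro a b p
    induction p with
    | nil => exact id
    | cons h _ ih =>
      intro ha
      refine ih ((hD _ ha _ h).resolve_right ?_)
      rename_i b' _ _
      exact b'.2.2
  exact key p hx

/-- A vertex that lies in at most two blocks does not have three neighbours in different components
of the rest. -/
theorem false_of_closed [Finite V] {G : SimpleGraph V} {v x y u : V}
    (hv : {B : Set V | G.IsBlock B ∧ v ∈ B}.encard ≤ 2) (hx : G.Adj v x) (hy : G.Adj v y)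
    (hu : G.Adj v u) {D D' : Set V} (hxD : x ∈ D) (hyD : y ∈ D')
    (hD : ∀ z ∈ D, ∀ t, G.Adj z t → t ∈ D ∨ t = v) (hD' : ∀ z ∈ D', ∀ t, G.Adj z t → t ∈ D' ∨ t = v)
    (hyD' : y ∉ D) (huD : u ∉ D) (huD' : u ∉ D') : False := by
  obtain ⟨B₁, h1, hv1, hx1⟩ := exists_isBlock hx
  obtain ⟨B₂, h2, hv2, hy2⟩ := exists_isBlock hy
  obtain ⟨B₃, h3, hv3, hu3⟩ := exists_isBlock hu
  have s1 := h1.subset_of_closed hv1 hx1 hx.ne' hxD hD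
  have s2 := h2.subset_of_closed hv2 hy2 hy.ne' hyD hD'
  have h12 : B₁ ≠ B₂ := by
    rintro rfl
    exact hyD' (s1 ⟨hy2, hy.ne'⟩)
  have h13 : B₁ ≠ B₃ := by
    rintro rfl
    exact huD (s1 ⟨hu3, hu.ne'⟩)
  have h23 : B₂ ≠ B₃ := by
    rintro rfl
    exact huD' (s2 ⟨hu3, hu.ne'⟩)
  have h4 : ({B₁, B₂, B₃} : Set (Set V)) ⊆ {B : Set V | G.IsBlock B ∧ v ∈ B} := by
    rintro B (rfl | rfl | rfl)
    exacts [⟨h1, hv1⟩, ⟨h2, hv2⟩, ⟨h3, hv3⟩]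
  have h5 := (Set.encard_le_encard h4).trans hv
  rw [Set.encard_insert_of_notMem (by simp [h12, h13]), Set.encard_pair h23] at h5
  exact absurd h5 (by norm_num)

/-- The only edge that leaves a set of vertices lies on no cycle. -/
theorem not_isCycleEdge_of_unique {G : SimpleGraph V} {D : Set V} {i p : V} (hi : i ∈ D) (hp : p ∉ D)
    (h : ∀ x ∈ D, ∀ y ∉ D, G.Adj x y → x = i ∧ y = p) : ¬ G.IsCycleEdge s(i, p) := by
  rintro ⟨a, c, hc, hmem⟩
  have hadj : G.Adj i p := c.adj_of_mem_edges hmem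
  have hb : G.IsBridge s(i, p) := by
    rw [isBridge_iff]
    rintro ⟨q⟩
    have key : ∀ {a b : V}, (G.deleteEdges {s(i, p)}).Walk a b → a ∈ D → b ∈ D := by
      intro a b q
      induction q with
      | nil => exact id
      | cons hab _ ih =>
        intro ha
        refine ih ?_
        by_contra hb
        rw [deleteEdges_adj] at hab
        obtain ⟨rfl, rfl⟩ := h _ ha _ hb hab.1
        exact hab.2 (by simp)
    exact hp (key q hi)
  exact (isBridge_iff_forall_cycle_notMem (by exact hadj)).1 hb c hc hmem

end SimpleGraph

/-! ### Depth-first search -/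

namespace Guards

variable {V : Type*}

theorem Consec.append_left {L : List V} (L' : List V) {x y : V} (h : Consec L x y) :
    Consec (L' ++ L) x y := by
  induction L' with
  | nil => exact h
  | cons a L' ih =>
    cases hL : L' ++ L with
    | nil => rw [hL] at ih; exact ih.elim
    | cons b L'' => rw [List.cons_append, hL]; exact Or.inr (hL ▸ ih)

theorem Consec.of_suffix {L L' : List V} (h : L <:+ L') {x y : V} (hx : Consec L x y) :
    Consec L' x y := by
  obtain ⟨L'', rfl⟩ := h
  exact hx.append_left _

/-- The data of a depth-first search in a cactus that removes pieces of the graph as it backs up.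

`st` is the stack, with the current vertex on top, and `fin` the set of finished vertices. `pen s`
lists the pendants that `s` has received. If the search has found an edge from `s` or from below
`s` to a vertex `a` above `s` on the stack, `top s = some a`, and `word s` is the part of the cycle
below `s`. `adj s` lists the edges at `s` not looked at yet, `own` maps a finished vertex to the
last vertex of the stack above it. `dn` records edges on cycles that have been removed, and `c` the
number of guards that have been removed. -/
structure Search (V : Type*) where
  st : List V
  fin : Set V
  pen : V → List V
  top : V → Option V
  word : V → List (V × Option V)
  adj : V → List V
  own : V → V
  dn : V → V → Prop
  c : ℕ

namespace Search

/-- The part of the cycle through `s` that the search has found. -/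
def chain (σ : Search V) (s : V) : List V := s :: spine (σ.word s) ++ (σ.top s).toList

/-- The finished vertices kept at `s`. -/
def Att (σ : Search V) (s x : V) : Prop := x ∈ σ.pen s ∨ x ∈ verts (σ.word s)

/-- The vertices not removed. -/
def live (σ : Search V) : Set V := {x | x ∉ σ.fin ∨ ∃ s, σ.Att s x}

/-- The vertices neither removed nor pendants. -/
def core (σ : Search V) : Set V := {x | x ∉ σ.fin ∨ ∃ s, x ∈ spine (σ.word s)}

/-- The adjacencies of the vertices kept at `s`. -/
def Kept (σ : Search V) (s x y : V) : Prop :=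
  (x ∈ σ.pen s ∧ y = s) ∨ Consec (σ.chain s) x y ∨ Consec (σ.chain s) y x ∨
    ∃ v l, (v, some l) ∈ σ.word s ∧ ((x = v ∧ y = l) ∨ (x = l ∧ y = v))

/-- What the search maintains. -/
structure Inv (G : SimpleGraph V) (root : V) (σ : Search V) : Prop where
  nodup : σ.st.Nodup
  last : [root] <:+ σ.st
  stack : ∀ x y, Consec σ.st x y → G.Adj x y
  disj : ∀ x ∈ σ.st, x ∉ σ.fin
  off : ∀ s, s ∉ σ.st → σ.pen s = [] ∧ σ.top s = none
  word_nil : ∀ s, σ.top s = none → σ.word s = []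
  adj_nodup : ∀ s, (σ.adj s).Nodup
  adj_adj : ∀ s, ∀ x ∈ σ.adj s, G.Adj s x
  adj_new : ∀ s, s ∉ σ.st → s ∉ σ.fin → ∀ x, G.Adj s x → x ∈ σ.adj s
  disc : ∀ s ∈ σ.st, ∀ x, G.Adj s x → x ∈ σ.adj s ∨ x ∈ σ.st ∨ x ∈ σ.fin
  -- An edge to a vertex higher up, apart from the parent, becomes the top of `s` as soon as it is
  -- looked at. By then no cycle has been inherited from below, and none can come later.
  back : ∀ s t, (s :: t) <:+ σ.st → ∀ a ∈ t, G.Adj s a →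
    t.head? = some a ∨ a ∈ σ.adj s ∨ (σ.top s = some a ∧ σ.word s = [])
  top_mem : ∀ s t a, (s :: t) <:+ σ.st → σ.top s = some a →
    a ∈ t ∧ (σ.word s = [] → t.head? ≠ some a ∧ a ∉ σ.adj s)
  att : ∀ s x, σ.Att s x → x ∈ σ.fin ∧ σ.own x = s
  att_nodup : ∀ s, (σ.pen s ++ verts (σ.word s)).Nodup
  own_mem : ∀ x ∈ σ.fin, σ.own x ∈ σ.st
  -- The finished part below a vertex of the stack is joined to the rest only through this vertex
  -- and through the upper end of its open cycle.
  own_adj : ∀ x ∈ σ.fin, ∀ y, G.Adj x y →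
    (y ∈ σ.fin ∧ σ.own y = σ.own x) ∨ y = σ.own x ∨ σ.top (σ.own x) = some y
  kept : ∀ s x y, σ.Att s x → y ∈ σ.live → G.Adj x y → σ.Kept s x y
  adj_of_kept : ∀ s x y, σ.Kept s x y → G.Adj x y
  -- A pendant stands for a finished part of the graph that is cut off by `s`. Parts of different
  -- pendants lie in different blocks at `s`, which bounds the number of pendants.
  pen_closed : ∀ s, ∀ l ∈ σ.pen s, ∃ D : Set V, l ∈ D ∧ D ⊆ σ.fin ∧
    (∀ z ∈ D, ∀ y, G.Adj z y → y ∈ D ∨ y = s) ∧ ∀ l' ∈ σ.pen s, l' ∈ D → l' = l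
  -- Each cycle edge at a finished vertex either can be evicted already or belongs to a cycle that
  -- is still open.
  edge : ∀ x ∈ σ.fin, ∀ y, G.Adj x y → σ.dn x y ∨ σ.dn y x ∨ ¬ G.IsCycleEdge s(x, y) ∨
    ∃ s, Consec (σ.chain s) x y ∨ Consec (σ.chain s) y x
  -- `F` are the pairs that the strategy on the remaining graph evicts. They avoid pendants, because
  -- a pendant may merely represent a removed piece that has to be put back.
  upper : ∀ k F, (∀ x y, F x y → x ∈ σ.core ∧ y ∈ σ.core) → (∀ x, ¬ F x x) →
    WeakUpperBound (fun u v => u = v ∨ G.Adj u v) σ.live F k →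
    WeakUpperBound (fun u v => u = v ∨ G.Adj u v) Set.univ (fun x y => F x y ∨ σ.dn x y) (k + σ.c)
  lower : ∀ k, LowerBound (fun u v => u = v ∨ G.Adj u v) σ.live k →
    LowerBound (fun u v => u = v ∨ G.Adj u v) Set.univ (k + σ.c)

/-- The start of the search. -/
def init (root : V) (adj : V → List V) : Search V where
  st := [root]
  fin := ∅
  pen _ := []
  top _ := none
  word _ := []
  adj := adj
  own _ := root
  dn _ _ := False
  c := 0

variable {G : SimpleGraph V} {root : V} {σ : Search V}

theorem inv_init (adj : V → List V) (h : ∀ s, (adj s).Nodup) (h' : ∀ s x, x ∈ adj s ↔ G.Adj s x) :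
    Inv G root (init root adj) := by
  have hlive : (init root adj).live = Set.univ := by
    ext x; simp [live, init]
  constructor <;> try simp [init, Att, Kept, chain]
  · exact h
  · intro s x; exact (h' s x).1
  · intro s _ x; exact (h' s x).2
  · intro x hx; exact Or.inl ((h' _ _).2 hx)
  · intro s t hs a ha
    obtain ⟨l, hl⟩ := hs
    have := congrArg List.length hl
    simp only [List.length_append, List.length_cons, List.length_nil] at this
    cases t with
    | nil => simp at ha
    | cons b t => simp at this; omega
  · intro k F _ _ h
    have : (init root adj).live = Set.univ := hlive
    rw [init] at this
    rwa [this] at h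
  · intro k h
    have : (init root adj).live = Set.univ := hlive
    rw [init] at this
    rwa [this] at h

theorem Inv.notMem_tail (h : σ.Inv G root) {v : V} {t : List V} (hs : (v :: t) <:+ σ.st) : v ∉ t :=
  (List.nodup_cons.1 (h.nodup.sublist hs.sublist)).1

theorem Inv.mem_st_of_top (h : σ.Inv G root) {s a : V} (hs : σ.top s = some a) : s ∈ σ.st := by
  by_contra h'
  rw [(h.off s h').2] at hs
  exact absurd hs (by simp)

/-- The current vertex is the top of no path below a vertex of the stack. -/
theorem Inv.top_ne (h : σ.Inv G root) {v s : V} {t : List V} (hst : σ.st = v :: t) :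
    σ.top s ≠ some v := by
  intro hs
  have := h.mem_st_of_top hs
  obtain ⟨l, t', he⟩ := List.append_of_mem this
  have hsuf : (s :: t') <:+ σ.st := ⟨l, he.symm⟩
  have hv := (h.top_mem s t' v hsuf hs).1
  have hn := h.nodup
  rw [he] at hn hst
  cases l with
  | nil =>
    obtain ⟨rfl, rfl⟩ := List.cons.inj hst
    exact h.notMem_tail hsuf hv
  | cons b l =>
    obtain ⟨rfl, -⟩ := List.cons.inj hst
    simp at hn
    tauto

/-- The first vertex on the path below `s`. -/
theorem Inv.exists_first (h : σ.Inv G root) {s a : V} {t : List V} (hs : (s :: t) <:+ σ.st)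
    (ha : σ.top s = some a) : ∃ f, G.Adj s f ∧ t.head? ≠ some f ∧ G.ConnectedAvoiding s f a ∧
      (f ∈ σ.fin ∨ f ∈ t ∧ f ∉ σ.adj s) := by
  have hs' : s ∈ σ.st := hs.subset (by simp)
  have hst := h.top_mem s t a hs ha
  have hne : a ≠ s := fun e => h.notMem_tail hs (e ▸ hst.1)
  have hch : ∀ x y, Consec (σ.chain s) x y → G.Adj x y :=
    fun x y hxy => h.adj_of_kept s x y (Or.inr (Or.inl hxy))
  cases hw : σ.word s with
  | nil =>
    refine ⟨a, hch _ _ ?_, (hst.2 hw).1, ⟨.nil, by simpa using hne.symm⟩, Or.inr ⟨hst.1, (hst.2 hw).2⟩⟩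
    simp [chain, hw, ha]
  | cons p w =>
    obtain ⟨f, o⟩ := p
    have hfin : ∀ x ∈ spine (σ.word s), x ∈ σ.fin := fun x hx =>
      (h.att s x (Or.inr (mem_verts_of_mem_spine hx))).1
    have hf : f ∈ σ.fin := hfin f (by rw [hw]; simp)
    refine ⟨f, hch _ _ ?_, ?_, ?_, Or.inl hf⟩
    · simp [chain, hw]
    · intro hh
      exact h.disj f (hs.subset (List.mem_cons_of_mem _ (List.mem_of_mem_head? hh))) hf
    · refine G.connectedAvoiding_of_consec (L := spine (σ.word s) ++ [a]) ?_ ?_ ?_ (by simp)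
      · intro x y hxy
        refine hch x y ?_
        rw [chain, ha, List.cons_append]
        exact hxy.append_left [s]
      · rw [List.mem_append, not_or]
        exact ⟨fun h' => h.disj s hs' (hfin s h'), by simpa using hne.symm⟩
      · simp [hw]

/-- In a cactus a vertex of the stack is on one cycle with the vertex above it. -/
theorem Inv.top_eq_none (h : σ.Inv G root) (hG : G.IsCactus) {s u b : V} {t : List V}
    (hs : (s :: t) <:+ σ.st) (hu : G.Adj s u) (hut : t.head? ≠ some u) (huf : u ∉ σ.fin)
    (hut' : u ∈ t → u ∈ σ.adj s) (hb : b ∈ t) (hub : G.ConnectedAvoiding s u b) :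
    σ.top s = none := by
  rcases ha : σ.top s with _ | a
  · rfl
  obtain ⟨f, hf1, hf2, hf3, hf4⟩ := h.exists_first hs ha
  have hat := (h.top_mem s t a hs ha).1
  cases t with
  | nil => simp at hb
  | cons p t =>
    have hstack : ∀ x ∈ p :: t, ∀ y ∈ p :: t, G.ConnectedAvoiding s x y := fun x hx y hy =>
      G.connectedAvoiding_of_consec (L := p :: t)
        (fun x y hxy => h.stack x y ((hxy.append_left [s]).of_suffix hs)) (h.notMem_tail hs) hx hy
    -- Otherwise `s` has three neighbours, namely `u`, the parent `p` and the first vertex `f` of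
    -- the open cycle, which are joined without `s` since the part of the stack above `s` is a path.
    refine (hG.false_of_connectedAvoiding hu hf1 (h.stack s p (Consec.of_suffix hs (Or.inl ⟨rfl, rfl⟩)))
      ?_ ?_ ?_ (hub.trans (hstack b hb p (by simp))) (hf3.trans (hstack a hat p (by simp)))).elim
    · rintro rfl
      rcases hf4 with hf4 | hf4
      exacts [huf hf4, hf4.2 (hut' hf4.1)]
    · rintro rfl
      simp at hut
    · rintro rfl
      simp at hf2

theorem suffix_unique {s : V} {t t' : List V} (h : (s :: t).Nodup) (h' : (s :: t') <:+ s :: t) :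
    t' = t := by
  rw [List.suffix_cons_iff] at h'
  rcases h' with hs | hs
  · exact (List.cons.inj hs).2
  · exact absurd (hs.subset (by simp)) (List.nodup_cons.1 h).1

/-! ### Steps of the search along an edge -/

section Steps

variable [DecidableEq V]

/-- Drop the next edge at `v`. -/
def skip (σ : Search V) (v : V) (l : List V) : Search V :=
  { σ with adj := Function.update σ.adj v l }

/-- Follow the next edge at `v` to the new vertex `w`. -/
def push (σ : Search V) (v w : V) (l : List V) : Search V :=
  { σ with adj := Function.update σ.adj v l, st := w :: σ.st }

/-- Record that the next edge at `v` goes to `w` further up on the stack. -/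
def setTop (σ : Search V) (v w : V) (l : List V) : Search V :=
  { σ with adj := Function.update σ.adj v l, top := Function.update σ.top v (some w) }

theorem Inv.skip (h : σ.Inv G root) {v w : V} {t l : List V} (hst : σ.st = v :: t)
    (hadj : σ.adj v = w :: l) (hw : w ∈ σ.fin ∨ t.head? = some w) : (σ.skip v l).Inv G root := by
  have hsub : ∀ s x, x ∈ Function.update σ.adj v l s → x ∈ σ.adj s := by
    intro s x
    rcases eq_or_ne s v with rfl | hs
    · rw [Function.update_self, hadj]
      exact List.mem_cons_of_mem _
    · rw [Function.update_of_ne hs]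
      exact id
  have hsub' : ∀ s x, x ∈ σ.adj s → x ∈ Function.update σ.adj v l s ∨ (s = v ∧ x = w) := by
    intro s x hx
    rcases eq_or_ne s v with rfl | hs
    · rw [Function.update_self]
      rw [hadj, List.mem_cons] at hx
      tauto
    · rw [Function.update_of_ne hs]
      exact Or.inl hx
  exact { h with
    adj_nodup := by
      intro s
      rcases eq_or_ne s v with rfl | hs
      · have := h.adj_nodup s
        rw [hadj] at this
        simpa [Search.skip] using (List.nodup_cons.1 this).2
      · simpa [Search.skip, hs] using h.adj_nodup s
    adj_adj := fun s x hx => h.adj_adj s x (hsub s x hx)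
    adj_new := by
      intro s hs hs' x hx
      refine (hsub' s x (h.adj_new s hs hs' x hx)).resolve_right ?_
      rintro ⟨rfl, -⟩
      exact hs (by simp [Search.skip, hst])
    disc := by
      intro s hs x hx
      rcases h.disc s hs x hx with h1 | h1
      · rcases hsub' s x h1 with h2 | ⟨rfl, rfl⟩
        · exact Or.inl h2
        · rcases hw with hw | hw
          · exact Or.inr (Or.inr hw)
          · refine Or.inr (Or.inl ?_)
            change x ∈ σ.st
            rw [hst]
            exact List.mem_cons_of_mem _ (List.mem_of_mem_head? hw)
      · exact Or.inr h1
    back := by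
      intro s t' hs a ha hsa
      rcases h.back s t' hs a ha hsa with h1 | h1 | h1
      · exact Or.inl h1
      · rcases hsub' s a h1 with h2 | ⟨rfl, rfl⟩
        · exact Or.inr (Or.inl h2)
        · rcases hw with hw | hw
          · exact absurd hw (h.disj a (hs.subset (List.mem_cons_of_mem _ ha)))
          · left
            rwa [suffix_unique (hst ▸ h.nodup) (hst ▸ hs : (s :: t') <:+ s :: t)]
      · exact Or.inr (Or.inr h1)
    top_mem := by
      intro s t' a hs ha
      refine (h.top_mem s t' a hs ha).imp_right fun h1 h2 => (h1 h2).imp_right fun h3 h4 => h3 ?_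
      exact hsub s a h4 }

theorem Inv.push (h : σ.Inv G root) {v w : V} {t l : List V} (hst : σ.st = v :: t)
    (hadj : σ.adj v = w :: l) (hw : w ∉ σ.fin) (hw' : w ∉ σ.st) : (σ.push v w l).Inv G root := by
  have hvw : G.Adj v w := h.adj_adj v w (by simp [hadj])
  have hsub : ∀ s x, x ∈ Function.update σ.adj v l s → x ∈ σ.adj s := by
    intro s x
    rcases eq_or_ne s v with rfl | hs
    · rw [Function.update_self, hadj]
      exact List.mem_cons_of_mem _
    · rw [Function.update_of_ne hs]
      exact id
  have hsub' : ∀ s x, x ∈ σ.adj s → x ∈ Function.update σ.adj v l s ∨ (s = v ∧ x = w) := by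
    intro s x hx
    rcases eq_or_ne s v with rfl | hs
    · rw [Function.update_self]
      rw [hadj, List.mem_cons] at hx
      tauto
    · rw [Function.update_of_ne hs]
      exact Or.inl hx
  have hoff := h.off w hw'
  exact { h with
    nodup := List.nodup_cons.2 ⟨hw', h.nodup⟩
    last := h.last.trans (List.suffix_cons _ _)
    stack := by
      intro x y hxy
      simp only [Search.push, hst, consec_cons_cons] at hxy
      rcases hxy with ⟨rfl, rfl⟩ | hxy
      · exact hvw.symm
      · exact h.stack x y (hst ▸ hxy)
    disj := by
      intro x hx
      rcases List.mem_cons.1 hx with rfl | hx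
      · exact hw
      · exact h.disj x hx
    off := fun s hs => h.off s fun hs' => hs (List.mem_cons_of_mem _ hs')
    adj_nodup := by
      intro s
      rcases eq_or_ne s v with rfl | hs
      · have := h.adj_nodup s
        rw [hadj] at this
        simpa [Search.push] using (List.nodup_cons.1 this).2
      · simpa [Search.push, hs] using h.adj_nodup s
    adj_adj := fun s x hx => h.adj_adj s x (hsub s x hx)
    adj_new := by
      intro s hs hs' x hx
      have hs₁ : s ∉ σ.st := fun h => hs (List.mem_cons_of_mem _ h)
      refine (hsub' s x (h.adj_new s hs₁ hs' x hx)).resolve_right ?_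
      rintro ⟨rfl, -⟩
      exact hs₁ (hst ▸ List.mem_cons_self)
    disc := by
      intro s hs x hx
      change x ∈ Function.update σ.adj v l s ∨ x ∈ w :: σ.st ∨ x ∈ σ.fin
      have key : x ∈ σ.adj s → x ∈ Function.update σ.adj v l s ∨ x ∈ w :: σ.st ∨ x ∈ σ.fin := by
        intro h1
        rcases hsub' s x h1 with h2 | ⟨rfl, rfl⟩
        exacts [Or.inl h2, Or.inr (Or.inl (by simp))]
      rcases List.mem_cons.1 hs with rfl | hs
      · exact key (h.adj_new s hw' hw x hx)
      · rcases h.disc s hs x hx with h1 | h1 | h1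
        exacts [key h1, Or.inr (Or.inl (List.mem_cons_of_mem _ h1)), Or.inr (Or.inr h1)]
    back := by
      intro s t' hs a ha hsa
      change t'.head? = some a ∨ a ∈ Function.update σ.adj v l s ∨ _
      rcases List.suffix_cons_iff.1 hs with hs₁ | hs₁
      · obtain ⟨rfl, rfl⟩ := List.cons.inj hs₁
        refine Or.inr (Or.inl ((hsub' s a (h.adj_new s hw' hw a hsa)).resolve_right ?_))
        rintro ⟨rfl, -⟩
        exact hw' (by simp [hst])
      · rcases h.back s t' hs₁ a ha hsa with h1 | h1 | h1
        · exact Or.inl h1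
        · refine Or.inr (Or.inl ((hsub' s a h1).resolve_right ?_))
          rintro ⟨rfl, rfl⟩
          exact hw' (hs₁.subset (List.mem_cons_of_mem _ ha))
        · exact Or.inr (Or.inr h1)
    top_mem := by
      intro s t' a hs ha
      rcases List.suffix_cons_iff.1 hs with hs₁ | hs₁
      · obtain ⟨rfl, rfl⟩ := List.cons.inj hs₁
        have : σ.top s = some a := ha
        rw [hoff.2] at this
        exact absurd this (by simp)
      · refine (h.top_mem s t' a hs₁ ha).imp_right fun h1 h2 => (h1 h2).imp_right fun h3 h4 => h3 ?_
        exact hsub s a h4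
    own_mem := fun x hx => List.mem_cons_of_mem _ (h.own_mem x hx) }

theorem Inv.setTop (h : σ.Inv G root) (hG : G.IsCactus) {v w : V} {t l : List V}
    (hst : σ.st = v :: t) (hadj : σ.adj v = w :: l) (hw : w ∈ t) (hw' : t.head? ≠ some w) :
    (σ.setTop v w l).Inv G root := by
  have hvw : G.Adj v w := h.adj_adj v w (by simp [hadj])
  have hsuf : (v :: t) <:+ σ.st := hst ▸ List.suffix_refl _
  have hwst : w ∈ σ.st := by rw [hst]; exact List.mem_cons_of_mem _ hw
  have hwv : w ≠ v := hvw.ne'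
  -- Two open cycles at `v` would share the edge to its parent, so nothing is overwritten here.
  have htop : σ.top v = none := by
    refine h.top_eq_none hG hsuf hvw hw' (h.disj w hwst) (by simp [hadj]) hw ⟨.nil, ?_⟩
    simpa using hwv.symm
  have hword : σ.word v = [] := h.word_nil v htop
  have hsub : ∀ s x, x ∈ Function.update σ.adj v l s → x ∈ σ.adj s := by
    intro s x
    rcases eq_or_ne s v with rfl | hs
    · rw [Function.update_self, hadj]
      exact List.mem_cons_of_mem _
    · rw [Function.update_of_ne hs]
      exact id
  have hsub' : ∀ s x, x ∈ σ.adj s → x ∈ Function.update σ.adj v l s ∨ (s = v ∧ x = w) := by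
    intro s x hx
    rcases eq_or_ne s v with rfl | hs
    · rw [Function.update_self]
      rw [hadj, List.mem_cons] at hx
      tauto
    · rw [Function.update_of_ne hs]
      exact Or.inl hx
  have hwl : w ∉ l := by
    have := h.adj_nodup v
    rw [hadj] at this
    exact (List.nodup_cons.1 this).1
  have hchain : ∀ s, s ≠ v → (σ.setTop v w l).chain s = σ.chain s := by
    intro s hs
    simp [chain, Search.setTop, hs]
  have hchain' : (σ.setTop v w l).chain v = [v, w] := by
    simp [chain, Search.setTop, hword]
  have hchain'' : σ.chain v = [v] := by
    simp [chain, hword, htop]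
  have hmono : ∀ s x y, Consec (σ.chain s) x y → Consec ((σ.setTop v w l).chain s) x y := by
    intro s x y hxy
    rcases eq_or_ne s v with rfl | hs
    · rw [hchain''] at hxy
      exact hxy.elim
    · rwa [hchain s hs]
  have htop' : ∀ s, s ≠ v → (σ.setTop v w l).top s = σ.top s := by
    intro s hs
    simp [Search.setTop, hs]
  have htopv : (σ.setTop v w l).top v = some w := by
    simp [Search.setTop]
  exact { h with
    off := by
      intro s hs
      have hs₁ : s ∉ σ.st := hs
      rw [htop' s (by rintro rfl; exact hs₁ (hst ▸ List.mem_cons_self))]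
      exact h.off s hs₁
    word_nil := by
      intro s hs
      rcases eq_or_ne s v with rfl | hsv
      · exact hword
      · rw [htop' s hsv] at hs
        exact h.word_nil s hs
    adj_nodup := by
      intro s
      rcases eq_or_ne s v with rfl | hs
      · have := h.adj_nodup s
        rw [hadj] at this
        simpa [Search.setTop] using (List.nodup_cons.1 this).2
      · simpa [Search.setTop, hs] using h.adj_nodup s
    adj_adj := fun s x hx => h.adj_adj s x (hsub s x hx)
    adj_new := by
      intro s hs hs' x hx
      have hs₁ : s ∉ σ.st := hs
      refine (hsub' s x (h.adj_new s hs₁ hs' x hx)).resolve_right ?_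
      rintro ⟨rfl, -⟩
      exact hs₁ (hst ▸ List.mem_cons_self)
    disc := by
      intro s hs x hx
      rcases h.disc s hs x hx with h1 | h1
      · rcases hsub' s x h1 with h2 | ⟨rfl, rfl⟩
        exacts [Or.inl h2, Or.inr (Or.inl hwst)]
      · exact Or.inr h1
    back := by
      intro s t' hs a ha hsa
      rcases h.back s t' hs a ha hsa with h1 | h1 | h1
      · exact Or.inl h1
      · rcases hsub' s a h1 with h2 | ⟨rfl, rfl⟩
        · exact Or.inr (Or.inl h2)
        · exact Or.inr (Or.inr ⟨htopv, hword⟩)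
      · rcases eq_or_ne s v with rfl | hsv
        · rw [htop] at h1
          simp at h1
        · exact Or.inr (Or.inr ⟨by rw [htop' s hsv]; exact h1.1, h1.2⟩)
    top_mem := by
      intro s t' a hs ha
      rcases eq_or_ne s v with rfl | hsv
      · rw [htopv] at ha
        obtain rfl := Option.some.inj ha
        have : t' = t := suffix_unique (hst ▸ h.nodup) (hst ▸ hs : (s :: t') <:+ s :: t)
        subst this
        exact ⟨hw, fun _ => ⟨hw', by simpa [Search.setTop] using hwl⟩⟩
      · rw [htop' s hsv] at ha
        refine (h.top_mem s t' a hs ha).imp_right fun h1 h2 => (h1 h2).imp_right fun h3 h4 => h3 ?_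
        exact hsub s a h4
    own_adj := by
      intro x hx y hxy
      rcases h.own_adj x hx y hxy with h1 | h1 | h1
      · exact Or.inl h1
      · exact Or.inr (Or.inl h1)
      · refine Or.inr (Or.inr ?_)
        have : σ.own x ≠ v := by
          intro e
          rw [e, htop] at h1
          simp at h1
        exact (htop' _ this).trans h1
    kept := by
      intro s x y hx hy hxy
      rcases h.kept s x y hx hy hxy with h1 | h1 | h1 | h1
      · exact Or.inl h1
      · exact Or.inr (Or.inl (hmono _ _ _ h1))
      · exact Or.inr (Or.inr (Or.inl (hmono _ _ _ h1)))
      · exact Or.inr (Or.inr (Or.inr h1))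
    adj_of_kept := by
      intro s x y hxy
      rcases eq_or_ne s v with rfl | hsv
      · rw [Kept, hchain'] at hxy
        rcases hxy with h1 | h1 | h1 | h1
        · exact h.adj_of_kept s x y (Or.inl h1)
        · simp at h1
          obtain ⟨rfl, rfl⟩ := h1
          exact hvw
        · simp at h1
          obtain ⟨rfl, rfl⟩ := h1
          exact hvw.symm
        · exact h.adj_of_kept s x y (Or.inr (Or.inr (Or.inr h1)))
      · rw [Kept, hchain s hsv] at hxy
        exact h.adj_of_kept s x y hxy
    edge := by
      intro x hx y hxy
      rcases h.edge x hx y hxy with h1 | h1 | h1 | ⟨s, h1⟩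
      · exact Or.inl h1
      · exact Or.inr (Or.inl h1)
      · exact Or.inr (Or.inr (Or.inl h1))
      · exact Or.inr (Or.inr (Or.inr ⟨s, h1.imp (hmono s x y) (hmono s y x)⟩)) }

end Steps

end Search

theorem Consec.mem_tail {a x y : V} {L : List V} (h : Consec (a :: L) x y) : y ∈ L := by
  cases L with
  | nil => exact h.elim
  | cons b L =>
    rcases h with ⟨-, rfl⟩ | h
    · simp
    · exact h.mem.2

namespace Search

variable {G : SimpleGraph V} {root : V} {σ : Search V}

theorem Inv.notMem_chain_tail (h : σ.Inv G root) {v : V} {t : List V} (hst : σ.st = v :: t) :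
    v ∉ spine (σ.word v) ++ (σ.top v).toList := by
  have hvst : v ∈ σ.st := by simp [hst]
  rw [List.mem_append, not_or]
  refine ⟨fun h' => h.disj v hvst (h.att v v (Or.inr (mem_verts_of_mem_spine h'))).1, ?_⟩
  rw [Option.mem_toList]
  exact h.top_ne hst

/-- The neighbours of the current vertex when it is finished. -/
theorem Inv.adj_current (h : σ.Inv G root) {v p y : V} {t : List V} (hst : σ.st = v :: p :: t)
    (hadj : σ.adj v = []) (hy : G.Adj v y) :
    (y ∈ σ.fin ∧ σ.own y = v) ∨ y = p ∨ (σ.top v = some y ∧ σ.word v = []) := by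
  have hsuf : (v :: p :: t) <:+ σ.st := hst ▸ List.suffix_refl _
  have hvst : v ∈ σ.st := by simp [hst]
  rcases h.disc v hvst y hy with h1 | h1 | h1
  · simp [hadj] at h1
  · rw [hst, List.mem_cons] at h1
    rcases h.back v _ hsuf y (h1.resolve_left hy.ne') hy with h2 | h2 | h2
    · right; left
      simpa using h2.symm
    · simp [hadj] at h2
    · exact Or.inr (Or.inr h2)
  · left
    refine ⟨h1, ?_⟩
    rcases h.own_adj y h1 v hy.symm with h2 | h2 | h2
    exacts [absurd h2.1 (h.disj v hvst), h2.symm, absurd h2 (h.top_ne hst)]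

/-- A live neighbour that is already finished is kept at `v` itself, so `Inv.kept` says where it is.
The first vertex of the chain cannot come up as the second end, because `v` does not occur again in
the chain. -/
theorem Inv.live_current (h : σ.Inv G root) {v p y : V} {t : List V} (hst : σ.st = v :: p :: t)
    (hadj : σ.adj v = []) (hy : G.Adj v y) (hlive : y ∈ σ.live) :
    y = p ∨ y ∈ σ.pen v ∨ Consec (σ.chain v) v y := by
  have hvst : v ∈ σ.st := by simp [hst]
  rcases h.adj_current hst hadj hy with ⟨h1, h2⟩ | h1 | ⟨h1, h2⟩
  · right
    rcases hlive with h3 | ⟨s, h3⟩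
    · exact absurd h1 h3
    obtain rfl : s = v := (h.att s y h3).2.symm.trans h2
    rcases h.kept s y s h3 (Or.inl (h.disj s hvst)) hy.symm with h4 | h4 | h4 | ⟨u, l, h4, h5⟩
    · exact Or.inl h4.1
    · exact absurd h4.mem_tail (h.notMem_chain_tail hst)
    · exact Or.inr h4
    · have := mem_verts_of_mem h4
      have h6 := h.disj s hvst
      rcases h5 with ⟨rfl, rfl⟩ | ⟨rfl, rfl⟩
      · exact absurd (h.att s s (Or.inr this)).1 h6
      · exact absurd (h.att s s (Or.inr (mem_verts_of_mem_spine (mem_spine.2 ⟨_, h4⟩)))).1 h6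
  · exact Or.inl h1
  · right; right
    simp [chain, h1, h2]

/-! ### Bookkeeping when a vertex is finished -/

section Steps

variable [DecidableEq V]

/-- Finish the current vertex `v` below `p`, where `P`, `T` and `w` are the new pendants, top and
path at `p`. -/
def finish (σ : Search V) (v p : V) (t P : List V) (T : Option V) (w : List (V × Option V))
    (dn : V → V → Prop) (c : ℕ) : Search V where
  st := p :: t
  fin := insert v σ.fin
  pen := Function.update (Function.update σ.pen v []) p P
  top := Function.update (Function.update σ.top v none) p T
  word := Function.update (Function.update σ.word v []) p w
  adj := σ.adj
  own x := if x = v ∨ σ.own x = v then p else σ.own x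
  dn := dn
  c := c

-- The ways to finish a vertex differ only in the new pendants, top and word at the parent and in
-- the two counts of what is done. The invariant is verified here once for all of them; what depends
-- on the case is left as hypotheses.
set_option maxHeartbeats 1000000 in
theorem Inv.finish (h : σ.Inv G root) {v p : V} {t P : List V} {T : Option V}
    {w : List (V × Option V)} {dn : V → V → Prop} {c : ℕ} (hst : σ.st = v :: p :: t)
    (hadj : σ.adj v = []) (hTw : T = none → w = []) (hP : ∀ l ∈ P, l = v ∨ l ∈ σ.pen p)
    (hPw : ∀ x, x ∈ P ∨ x ∈ verts w → x = v ∨ σ.Att p x ∨ σ.Att v x)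
    (hnd : (P ++ verts w).Nodup)
    (hTt : ∀ a, T = some a → a ∈ t ∧ (w = [] → t.head? ≠ some a ∧ a ∉ σ.adj p))
    (hTv : ∀ a, σ.top v = some a → a = p ∨ T = some a) (hTp : ∀ a, σ.top p = some a → T = some a ∧ w = σ.word p)
    (hkept : ∀ x y, x ∈ P ∨ x ∈ verts w → y ∈ σ.live → (y ∈ σ.fin → σ.own y = v →
      y ∈ P ∨ y ∈ verts w) → (y = v → y ∈ P ∨ y ∈ verts w) → G.Adj x y →
      (x ∈ P ∧ y = p) ∨ Consec (p :: spine w ++ T.toList) x y ∨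
      Consec (p :: spine w ++ T.toList) y x ∨
      ∃ v l, (v, some l) ∈ w ∧ ((x = v ∧ y = l) ∨ (x = l ∧ y = v)))
    (hKP : ∀ x ∈ P, G.Adj x p) (hKc : ∀ x y, Consec (p :: spine w ++ T.toList) x y → G.Adj x y)
    (hKw : ∀ v l, (v, some l) ∈ w → G.Adj v l) (hclosed : v ∈ P → ∀ a, σ.top v = some a → a = p)
    (hdn : ∀ x y, σ.dn x y → dn x y)
    (hcv : ∀ x y, Consec (σ.chain v) x y → dn x y ∨ Consec (p :: spine w ++ T.toList) x y)
    (hcp : ∀ x y, Consec (σ.chain p) x y → Consec (p :: spine w ++ T.toList) x y)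
    (hvp : dn p v ∨ ¬ G.IsCycleEdge s(v, p) ∨ Consec (p :: spine w ++ T.toList) p v)
    (hupper : ∀ k F, (∀ x y, F x y → x ∈ (σ.finish v p t P T w dn c).core ∧
        y ∈ (σ.finish v p t P T w dn c).core) → (∀ x, ¬ F x x) →
      WeakUpperBound (fun u v => u = v ∨ G.Adj u v) (σ.finish v p t P T w dn c).live F k →
      WeakUpperBound (fun u v => u = v ∨ G.Adj u v) Set.univ (fun x y => F x y ∨ dn x y) (k + c))
    (hlower : ∀ k, LowerBound (fun u v => u = v ∨ G.Adj u v) (σ.finish v p t P T w dn c).live k →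
      LowerBound (fun u v => u = v ∨ G.Adj u v) Set.univ (k + c)) :
    (σ.finish v p t P T w dn c).Inv G root := by
  have hnodup := h.nodup
  rw [hst, List.nodup_cons] at hnodup
  have hvst : v ∈ σ.st := by simp [hst]
  have hpst : p ∈ σ.st := by simp [hst]
  have hvp' : v ≠ p := fun e => hnodup.1 (by simp [e])
  have hsub : (p :: t) <:+ σ.st := hst ▸ List.suffix_cons _ _
  have hst' : ∀ s, s ∈ p :: t ↔ s ∈ σ.st ∧ s ≠ v := by
    intro s
    rw [hst, List.mem_cons (a := s) (b := v)]
    constructor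
    · exact fun h => ⟨Or.inr h, fun e => hnodup.1 (e ▸ h)⟩
    · tauto
  have hpen : ∀ s, s ≠ v → s ≠ p → (σ.finish v p t P T w dn c).pen s = σ.pen s := by
    intro s h1 h2; simp [Search.finish, h1, h2]
  have htop : ∀ s, s ≠ v → s ≠ p → (σ.finish v p t P T w dn c).top s = σ.top s := by
    intro s h1 h2; simp [Search.finish, h1, h2]
  have hword : ∀ s, s ≠ v → s ≠ p → (σ.finish v p t P T w dn c).word s = σ.word s := by
    intro s h1 h2; simp [Search.finish, h1, h2]
  have hpenv : (σ.finish v p t P T w dn c).pen v = [] := by simp [Search.finish, hvp']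
  have htopv : (σ.finish v p t P T w dn c).top v = none := by simp [Search.finish, hvp']
  have hwordv : (σ.finish v p t P T w dn c).word v = [] := by simp [Search.finish, hvp']
  have hpenp : (σ.finish v p t P T w dn c).pen p = P := by simp [Search.finish]
  have htopp : (σ.finish v p t P T w dn c).top p = T := by simp [Search.finish]
  have hwordp : (σ.finish v p t P T w dn c).word p = w := by simp [Search.finish]
  have hown : ∀ x, σ.own x ≠ v → x ≠ v → (σ.finish v p t P T w dn c).own x = σ.own x := by
    intro x h1 h2; simp [Search.finish, h1, h2]
  have hownv : ∀ x, x = v ∨ σ.own x = v → (σ.finish v p t P T w dn c).own x = p := by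
    intro x h1; simp [Search.finish, h1]
  have hchain : ∀ s, s ≠ v → s ≠ p → (σ.finish v p t P T w dn c).chain s = σ.chain s := by
    intro s h1 h2; rw [chain, chain, htop s h1 h2, hword s h1 h2]
  have hchainp : (σ.finish v p t P T w dn c).chain p = p :: spine w ++ T.toList := by
    rw [chain, htopp, hwordp]
  have hchainv : (σ.finish v p t P T w dn c).chain v = [v] := by
    rw [chain, htopv, hwordv]; rfl
  have hatt : ∀ s, s ≠ v → s ≠ p → ∀ x, (σ.finish v p t P T w dn c).Att s x ↔ σ.Att s x := by
    intro s h1 h2 x; rw [Att, Att, hpen s h1 h2, hword s h1 h2]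
  have hattv : ∀ x, ¬ (σ.finish v p t P T w dn c).Att v x := by
    intro x; rw [Att, hpenv, hwordv]; simp
  have hattp : ∀ x, (σ.finish v p t P T w dn c).Att p x ↔ x ∈ P ∨ x ∈ verts w := by
    intro x; rw [Att, hpenp, hwordp]
  have hattold : ∀ s x, (σ.finish v p t P T w dn c).Att s x →
      x = v ∧ s = p ∨ x ∈ σ.fin ∧ (σ.own x = v ∧ s = p ∨ σ.own x ≠ v ∧ σ.own x = s) := by
    intro s x hx
    rcases eq_or_ne s v with rfl | hsv
    · exact absurd hx (hattv x)
    rcases eq_or_ne s p with rfl | hsp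
    · rcases hPw x ((hattp x).1 hx) with h1 | h1 | h1
      · exact Or.inl ⟨h1, rfl⟩
      · have := h.att _ _ h1
        exact Or.inr ⟨this.1, Or.inr ⟨this.2 ▸ hsv, this.2⟩⟩
      · have := h.att _ _ h1
        exact Or.inr ⟨this.1, Or.inl ⟨this.2, rfl⟩⟩
    · have := h.att _ _ ((hatt s hsv hsp x).1 hx)
      exact Or.inr ⟨this.1, Or.inr ⟨this.2 ▸ hsv, this.2⟩⟩
  have hattlive : ∀ s x, (σ.finish v p t P T w dn c).Att s x → x ∈ σ.live := by
    intro s x hx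
    rcases eq_or_ne s v with rfl | hsv
    · exact absurd hx (hattv x)
    rcases eq_or_ne s p with rfl | hsp
    · rcases hPw x ((hattp x).1 hx) with rfl | h1 | h1
      · exact Or.inl (h.disj _ hvst)
      · exact Or.inr ⟨_, h1⟩
      · exact Or.inr ⟨_, h1⟩
    · exact Or.inr ⟨s, (hatt s hsv hsp x).1 hx⟩
  have hlive : ∀ x ∈ (σ.finish v p t P T w dn c).live, x ∈ σ.live ∧
      (x ∈ σ.fin → σ.own x = v → x ∈ P ∨ x ∈ verts w) ∧ (x = v → x ∈ P ∨ x ∈ verts w) := by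
    rintro x (hx | ⟨s, hx⟩)
    · have hx : ¬ (x = v ∨ x ∈ σ.fin) := hx
      exact ⟨Or.inl fun h' => hx (Or.inr h'), fun h' => absurd (Or.inr h') hx,
        fun h' => absurd (Or.inl h') hx⟩
    · refine ⟨hattlive s x hx, fun h1 h2 => ?_, fun h1 => ?_⟩
      · rcases hattold s x hx with ⟨-, rfl⟩ | ⟨-, ⟨-, rfl⟩ | h3⟩
        · exact (hattp x).1 hx
        · exact (hattp x).1 hx
        · exact absurd h2 h3.1
      · rcases hattold s x hx with ⟨-, rfl⟩ | ⟨h3, -⟩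
        · exact (hattp x).1 hx
        · exact absurd h3 (h1 ▸ h.disj v hvst)
  have hfinmem : ∀ x, x ∈ (σ.finish v p t P T w dn c).fin ↔ x = v ∨ x ∈ σ.fin := fun x => Iff.rfl
  have hfinown : ∀ x ∈ σ.fin, x ≠ v := fun x hx e => h.disj v hvst (e ▸ hx)
  constructor
  · exact hnodup.2
  · have := h.last
    rw [hst, List.suffix_cons_iff] at this
    exact this.resolve_left (by simp)
  · intro x y hxy
    exact h.stack x y (Consec.of_suffix hsub hxy)
  · intro x hx
    rw [hfinmem]
    have := (hst' x).1 hx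
    rintro (h' | h')
    exacts [this.2 h', h.disj x this.1 h']
  · intro s hs
    rcases eq_or_ne s v with rfl | hsv
    · exact ⟨hpenv, htopv⟩
    have hsp : s ≠ p := by
      rintro rfl
      exact hs List.mem_cons_self
    rw [hpen s hsv hsp, htop s hsv hsp]
    exact h.off s fun h' => hs ((hst' s).2 ⟨h', hsv⟩)
  · intro s hs
    rcases eq_or_ne s v with rfl | hsv
    · exact hwordv
    rcases eq_or_ne s p with rfl | hsp
    · rw [hwordp]; exact hTw (htopp ▸ hs)
    rw [hword s hsv hsp]
    exact h.word_nil s (htop s hsv hsp ▸ hs)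
  · exact h.adj_nodup
  · exact h.adj_adj
  · intro s hs hs'
    rw [hfinmem, not_or] at hs'
    exact h.adj_new s (fun h' => hs ((hst' s).2 ⟨h', hs'.1⟩)) hs'.2
  · intro s hs x hx
    have hs := (hst' s).1 hs
    rcases h.disc s hs.1 x hx with h1 | h1 | h1
    · exact Or.inl h1
    · rcases eq_or_ne x v with rfl | hxv
      · exact Or.inr (Or.inr (Or.inl rfl))
      · exact Or.inr (Or.inl ((hst' x).2 ⟨h1, hxv⟩))
    · exact Or.inr (Or.inr (Or.inr h1))
  · intro s t' hs a ha hsa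
    have hs' : (s :: t') <:+ p :: t := hs
    have hsv : s ≠ v := ((hst' s).1 (hs'.subset (by simp))).2
    rcases h.back s t' (hs'.trans hsub) a ha hsa with h1 | h1 | h1
    · exact Or.inl h1
    · exact Or.inr (Or.inl h1)
    · rcases eq_or_ne s p with rfl | hsp
      · obtain ⟨h2, h3⟩ := hTp a h1.1
        exact Or.inr (Or.inr ⟨by rw [htopp, h2], by rw [hwordp, h3, h1.2]⟩)
      · exact Or.inr (Or.inr ⟨by rw [htop s hsv hsp, h1.1], by rw [hword s hsv hsp, h1.2]⟩)
  · intro s t' a hs ha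
    have hs' : (s :: t') <:+ p :: t := hs
    have hsv : s ≠ v := ((hst' s).1 (hs'.subset (by simp))).2
    rcases eq_or_ne s p with rfl | hsp
    · rw [suffix_unique hnodup.2 hs', hwordp]
      exact hTt a (htopp ▸ ha)
    · rw [hword s hsv hsp]
      exact h.top_mem s t' a (hs'.trans hsub) (htop s hsv hsp ▸ ha)
  · intro s x hx
    rcases hattold s x hx with ⟨h1, rfl⟩ | ⟨h1, ⟨h2, rfl⟩ | ⟨h2, h3⟩⟩
    · exact ⟨Or.inl h1, hownv x (Or.inl h1)⟩
    · exact ⟨Or.inr h1, hownv x (Or.inr h2)⟩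
    · exact ⟨Or.inr h1, (hown x h2 (hfinown x h1)).trans h3⟩
  · intro s
    rcases eq_or_ne s v with rfl | hsv
    · rw [hpenv, hwordv]; simp
    rcases eq_or_ne s p with rfl | hsp
    · rw [hpenp, hwordp]; exact hnd
    · rw [hpen s hsv hsp, hword s hsv hsp]
      exact h.att_nodup s
  · rintro x (rfl | hx)
    · rw [hownv x (Or.inl rfl)]; exact List.mem_cons_self
    · rcases eq_or_ne (σ.own x) v with h1 | h1
      · rw [hownv x (Or.inr h1)]; exact List.mem_cons_self
      · rw [hown x h1 (hfinown x hx)]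
        exact (hst' _).2 ⟨h.own_mem x hx, h1⟩
  · intro x hx y hxy
    have hxown : (x = v ∨ σ.own x = v) → (y ∈ σ.fin ∧ σ.own y = v) ∨ y = v ∨ y = p ∨
        σ.top v = some y → (y ∈ (σ.finish v p t P T w dn c).fin ∧
          (σ.finish v p t P T w dn c).own y = (σ.finish v p t P T w dn c).own x) ∨
        y = (σ.finish v p t P T w dn c).own x ∨
        (σ.finish v p t P T w dn c).top ((σ.finish v p t P T w dn c).own x) = some y := by
      intro h1 h2
      rw [hownv x h1, htopp]
      rcases h2 with h2 | h2 | h2 | h2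
      · exact Or.inl ⟨Or.inr h2.1, hownv y (Or.inr h2.2)⟩
      · exact Or.inl ⟨Or.inl h2, hownv y (Or.inl h2)⟩
      · exact Or.inr (Or.inl h2)
      · exact Or.inr (hTv y h2)
    rcases hx with rfl | hx
    · refine hxown (Or.inl rfl) ?_
      rcases h.adj_current hst hadj hxy with h1 | h1 | h1
      exacts [Or.inl h1, Or.inr (Or.inr (Or.inl h1)), Or.inr (Or.inr (Or.inr h1.1))]
    · rcases eq_or_ne (σ.own x) v with h1 | h1
      · refine hxown (Or.inr h1) ?_
        have := h.own_adj x hx y hxy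
        rw [h1] at this
        rcases this with h2 | h2 | h2
        exacts [Or.inl h2, Or.inr (Or.inl h2), Or.inr (Or.inr (Or.inr h2))]
      · rw [hown x h1 (hfinown x hx)]
        rcases h.own_adj x hx y hxy with h2 | h2 | h2
        · left
          rw [hown y (h2.2 ▸ h1) (hfinown y h2.1)]
          exact ⟨Or.inr h2.1, h2.2⟩
        · exact Or.inr (Or.inl h2)
        · right; right
          rcases eq_or_ne (σ.own x) p with h3 | h3
          · rw [h3] at h2 ⊢
            rw [htopp]
            exact (hTp y h2).1
          · rw [htop _ h1 h3, h2]
  · intro s x y hx hy hxy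
    obtain ⟨hy1, hy2, hy3⟩ := hlive y hy
    rcases eq_or_ne s v with rfl | hsv
    · exact absurd hx (hattv x)
    rcases eq_or_ne s p with rfl | hsp
    · rw [Kept, hchainp, hpenp, hwordp]
      exact hkept x y ((hattp x).1 hx) hy1 hy2 hy3 hxy
    · rw [Kept, hchain s hsv hsp, hpen s hsv hsp, hword s hsv hsp]
      exact h.kept s x y ((hatt s hsv hsp x).1 hx) hy1 hxy
  · intro s x y hxy
    rcases eq_or_ne s v with rfl | hsv
    · rw [Kept, hchainv, hpenv, hwordv] at hxy
      simp at hxy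
    rcases eq_or_ne s p with rfl | hsp
    · rw [Kept, hchainp, hpenp, hwordp] at hxy
      rcases hxy with ⟨h1, rfl⟩ | h1 | h1 | ⟨u, l, h1, ⟨rfl, rfl⟩ | ⟨rfl, rfl⟩⟩
      exacts [hKP x h1, hKc x y h1, (hKc y x h1).symm, hKw _ _ h1, (hKw _ _ h1).symm]
    · rw [Kept, hchain s hsv hsp, hpen s hsv hsp, hword s hsv hsp] at hxy
      exact h.adj_of_kept s x y hxy
  · intro s l hl
    rcases eq_or_ne s v with rfl | hsv
    · rw [hpenv] at hl
      simp at hl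
    rcases eq_or_ne s p with rfl | hsp
    · rw [hpenp] at hl ⊢
      rcases hP l hl with rfl | h1
      · refine ⟨{x | x = l ∨ x ∈ σ.fin ∧ σ.own x = l}, Or.inl rfl, ?_, ?_, ?_⟩
        · rintro x (rfl | hx)
          exacts [Or.inl rfl, Or.inr hx.1]
        · rintro z (rfl | ⟨hz, hz'⟩) y hzy
          · rcases h.adj_current hst hadj hzy with h1 | h1 | h1
            · exact Or.inl (Or.inr h1)
            · exact Or.inr h1
            · exact Or.inr (hclosed hl y h1.1)
          · rcases h.own_adj z hz y hzy with h1 | h1 | h1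
            · exact Or.inl (Or.inr ⟨h1.1, h1.2.trans hz'⟩)
            · exact Or.inl (Or.inl (h1.trans hz'))
            · exact Or.inr (hclosed hl y (hz' ▸ h1))
        · rintro l' hl' (h1 | ⟨h1, h2⟩)
          · exact h1
          · rcases hP l' hl' with h3 | h3
            · exact h3
            · exact absurd ((h.att s l' (Or.inl h3)).2.symm.trans h2) hsv
      · obtain ⟨D, h2, h3, h4, h5⟩ := h.pen_closed s l h1
        refine ⟨D, h2, fun x hx => Or.inr (h3 hx), h4, fun l' hl' hl'D => ?_⟩
        rcases hP l' hl' with rfl | h6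
        · exact absurd (h3 hl'D) (h.disj l' hvst)
        · exact h5 l' h6 hl'D
    · rw [hpen s hsv hsp] at hl ⊢
      obtain ⟨D, h2, h3, h4, h5⟩ := h.pen_closed s l hl
      exact ⟨D, h2, fun x hx => Or.inr (h3 hx), h4, h5⟩
  · have key : ∀ x y, (σ.dn x y ∨ σ.dn y x ∨ ¬ G.IsCycleEdge s(x, y) ∨
        ∃ s, Consec (σ.chain s) x y ∨ Consec (σ.chain s) y x) →
        dn x y ∨ dn y x ∨ ¬ G.IsCycleEdge s(x, y) ∨ ∃ s,
        Consec ((σ.finish v p t P T w dn c).chain s) x y ∨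
        Consec ((σ.finish v p t P T w dn c).chain s) y x := by
      intro x y hxy
      have hs : ∀ s x y, Consec (σ.chain s) x y → dn x y ∨
          ∃ s, Consec ((σ.finish v p t P T w dn c).chain s) x y := by
        intro s x y hs
        rcases eq_or_ne s v with rfl | hsv
        · exact (hcv x y hs).imp_right fun h' => ⟨p, hchainp ▸ h'⟩
        rcases eq_or_ne s p with rfl | hsp
        · exact Or.inr ⟨s, hchainp ▸ hcp x y hs⟩
        · exact Or.inr ⟨s, hchain s hsv hsp ▸ hs⟩
      rcases hxy with h1 | h1 | h1 | ⟨s, h1 | h1⟩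
      · exact Or.inl (hdn x y h1)
      · exact Or.inr (Or.inl (hdn y x h1))
      · exact Or.inr (Or.inr (Or.inl h1))
      · rcases hs s x y h1 with h2 | ⟨s', h2⟩
        exacts [Or.inl h2, Or.inr (Or.inr (Or.inr ⟨s', Or.inl h2⟩))]
      · rcases hs s y x h1 with h2 | ⟨s', h2⟩
        exacts [Or.inr (Or.inl h2), Or.inr (Or.inr (Or.inr ⟨s', Or.inr h2⟩))]
    rintro x (rfl | hx) y hxy
    · rcases h.adj_current hst hadj hxy with h1 | rfl | h1
      · refine key x y ?_
        have := h.edge y h1.1 x hxy.symm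
        rw [Sym2.eq_swap] at this
        rcases this with h2 | h2 | h2 | ⟨s, h2⟩
        exacts [Or.inr (Or.inl h2), Or.inl h2, Or.inr (Or.inr (Or.inl h2)),
          Or.inr (Or.inr (Or.inr ⟨s, h2.symm⟩))]
      · rcases hvp with h1 | h1 | h1
        exacts [Or.inr (Or.inl h1), Or.inr (Or.inr (Or.inl h1)),
          Or.inr (Or.inr (Or.inr ⟨y, Or.inr (hchainp ▸ h1)⟩))]
      · exact key x y (Or.inr (Or.inr (Or.inr ⟨x, Or.inl (by simp [chain, h1.1, h1.2])⟩)))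
    · exact key x y (h.edge x hx y hxy)
  · exact hupper
  · exact hlower

end Steps

end Search

theorem WordRel.symm {r : V → V → Prop} (hr : ∀ x y, r x y → r y x) {A : Set V} {a : V}
    {w : List (V × Option V)} {x y : V} (h : WordRel r A a w x y) : WordRel r A a w y x := by
  rcases h with h | ⟨h1, h2, h3⟩ | h | h | ⟨v, l, h1, h2⟩
  · exact Or.inl h.symm
  · exact Or.inr (Or.inl ⟨h2, h1, hr _ _ h3⟩)
  · exact Or.inr (Or.inr (Or.inr (Or.inl h)))
  · exact Or.inr (Or.inr (Or.inl h))
  · exact Or.inr (Or.inr (Or.inr (Or.inr ⟨v, l, h1, by tauto⟩)))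

namespace Search

variable {G : SimpleGraph V} {root : V} {σ : Search V}

/-- A vertex in at most two blocks does not have two pendants and another neighbour. -/
theorem Inv.false_of_pen [Finite V] (h : σ.Inv G root) {s l l' u : V}
    (hs : {B : Set V | G.IsBlock B ∧ s ∈ B}.encard ≤ 2) (hl : l ∈ σ.pen s) (hl' : l' ∈ σ.pen s)
    (hll : l ≠ l') (hu : G.Adj s u) (hul : u ∉ σ.fin ∨ u ∈ σ.pen s ∧ u ≠ l ∧ u ≠ l') : False := by
  obtain ⟨D, h1, h2, h3, h4⟩ := h.pen_closed s l hl
  obtain ⟨D', h1', h2', h3', h4'⟩ := h.pen_closed s l' hl'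
  refine G.false_of_closed hs (h.adj_of_kept s l s (Or.inl ⟨hl, rfl⟩)).symm
    (h.adj_of_kept s l' s (Or.inl ⟨hl', rfl⟩)).symm hu h1 h1' h3 h3' ?_ ?_ ?_
  · exact fun h5 => hll (h4 l' hl' h5).symm
  · rcases hul with h5 | h5
    exacts [fun h6 => h5 (h2 h6), fun h6 => h5.2.1 (h4 u h5.1 h6)]
  · rcases hul with h5 | h5
    exacts [fun h6 => h5 (h2' h6), fun h6 => h5.2.2 (h4' u h5.1 h6)]

/-- Two pendants and the parent would put `v` into three blocks. -/
theorem Inv.pen_eq [Finite V] (h : σ.Inv G root) (hG : G.IsChristmasCactus) {v p : V} {t : List V}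
    (hst : σ.st = v :: p :: t) : σ.pen v = (σ.pen v).head?.toList := by
  rcases hp : σ.pen v with _ | ⟨l, _ | ⟨l', L⟩⟩
  · rfl
  · rfl
  · exfalso
    have hnd := h.att_nodup v
    rw [hp] at hnd
    refine h.false_of_pen (s := v) (l := l) (l' := l') (u := p) (hG.2 v) (by simp [hp])
      (by simp [hp]) ?_ (h.stack v p ?_) (Or.inl (h.disj p ?_))
    · rintro rfl
      simp at hnd
    · simp [hst]
    · simp [hst]

/-- The vertices that are kept when everything below the current vertex `v` is removed. -/
def rest (σ : Search V) (v : V) : Set V := {x | x ∈ σ.live ∧ x ≠ v ∧ (x ∈ σ.fin → σ.own x ≠ v)}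

theorem Inv.att_rest (h : σ.Inv G root) {v s x : V} (hs : s ≠ v) (hv : v ∈ σ.st)
    (hx : σ.Att s x) : x ∈ σ.rest v := by
  have := h.att s x hx
  exact ⟨Or.inr ⟨s, hx⟩, fun e => h.disj v hv (e ▸ this.1), fun _ => this.2 ▸ hs⟩

/-- Everything kept at `v` forms, with `v` as the first letter, the word of the piece below the
parent. -/
theorem Inv.live_eq (h : σ.Inv G root) {v : V} {o : Option V} (hv : v ∈ σ.st)
    (ho : σ.pen v = o.toList) :
    σ.live = σ.rest v ∪ {y | y ∈ verts ((v, o) :: σ.word v)} := by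
  have hvf := h.disj v hv
  ext x
  simp only [Set.mem_union, Set.mem_ofPred_eq, verts_cons, List.mem_cons, List.mem_append, ← ho]
  constructor
  · intro hx
    by_cases hxv : x = v
    · exact Or.inr (Or.inl hxv)
    · by_cases hx' : x ∈ σ.fin → σ.own x ≠ v
      · exact Or.inl ⟨hx, hxv, hx'⟩
      · push Not at hx'
        rcases hx with hx | ⟨s, hx⟩
        · exact absurd hx'.1 hx
        · obtain rfl := (h.att s x hx).2.symm.trans hx'.2
          exact Or.inr (Or.inr hx)
  · rintro (hx | rfl | hx)
    · exact hx.1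
    · exact Or.inl hvf
    · exact Or.inr ⟨v, hx⟩

theorem Inv.notMem_rest (h : σ.Inv G root) {v : V} {o : Option V} (ho : σ.pen v = o.toList) :
    ∀ y ∈ verts ((v, o) :: σ.word v), y ∉ σ.rest v := by
  rintro y hy hy'
  simp only [verts_cons, List.mem_cons, List.mem_append, ← ho] at hy
  rcases hy with rfl | hy
  · exact hy'.2.1 rfl
  · have := h.att v y hy
    exact hy'.2.2 this.1 this.2

theorem Inv.verts_nodup (h : σ.Inv G root) {v : V} {o : Option V} (hv : v ∈ σ.st)
    (ho : σ.pen v = o.toList) : (verts ((v, o) :: σ.word v)).Nodup := by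
  rw [verts_cons, ← ho, List.nodup_cons]
  refine ⟨fun hy => h.disj v hv (h.att v v ?_).1, h.att_nodup v⟩
  rwa [List.mem_append] at hy

/-- The moves among the vertices not removed when the current vertex is finished. -/
theorem Inv.wordRel (h : σ.Inv G root) {v p : V} {t : List V} {o : Option V}
    (hst : σ.st = v :: p :: t) (hadj : σ.adj v = []) (ho : σ.pen v = o.toList)
    (htop : ∀ a, σ.top v = some a → a = p) {x y : V} (hx : x ∈ σ.live) (hy : y ∈ σ.live)
    (hxy : x = y ∨ G.Adj x y) :
    WordRel (fun u v => u = v ∨ G.Adj u v) (σ.rest v) p ((v, o) :: σ.word v) x y := by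
  have hv : v ∈ σ.st := by simp [hst]
  rcases hxy with rfl | hxy
  · exact Or.inl rfl
  have hch : ∀ x y, Consec (σ.chain v) x y →
      Consec (p :: spine ((v, o) :: σ.word v) ++ [p]) x y := by
    intro x y hxy
    rcases ht : σ.top v with _ | a
    · simp [chain, ht, h.word_nil v ht] at hxy
    · rw [chain, ht, htop a ht] at hxy
      rw [spine_cons, List.cons_append]
      exact hxy.append_left [p]
  have key : ∀ x y, x ∈ verts ((v, o) :: σ.word v) → y ∈ σ.live → G.Adj x y →
      WordRel (fun u v => u = v ∨ G.Adj u v) (σ.rest v) p ((v, o) :: σ.word v) x y := by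
    intro x y hx hy hxy
    simp only [verts_cons, List.mem_cons, List.mem_append, ← ho] at hx
    rcases hx with rfl | hx
    · rcases h.live_current hst hadj hxy hy with rfl | h1 | h1
      · exact Or.inr (Or.inr (Or.inr (Or.inl (by simp))))
      · rw [ho, Option.mem_toList] at h1
        obtain rfl := h1
        exact Or.inr (Or.inr (Or.inr (Or.inr ⟨x, y, by simp, Or.inl ⟨rfl, rfl⟩⟩)))
      · exact Or.inr (Or.inr (Or.inl (hch _ _ h1)))
    · rcases h.kept v x y hx hy hxy with ⟨h1, rfl⟩ | h1 | h1 | ⟨u, l, h1, h2⟩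
      · rw [ho, Option.mem_toList] at h1
        obtain rfl := h1
        exact Or.inr (Or.inr (Or.inr (Or.inr ⟨y, x, by simp, Or.inr ⟨rfl, rfl⟩⟩)))
      · exact Or.inr (Or.inr (Or.inl (hch _ _ h1)))
      · exact Or.inr (Or.inr (Or.inr (Or.inl (hch _ _ h1))))
      · exact Or.inr (Or.inr (Or.inr (Or.inr ⟨u, l, List.mem_cons_of_mem _ h1, h2⟩)))
  have hx' := hx
  have hy' := hy
  rw [h.live_eq hv ho] at hx' hy'
  rcases hx' with hx' | hx'
  · rcases hy' with hy' | hy'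
    · exact Or.inr (Or.inl ⟨hx', hy', Or.inr hxy⟩)
    · exact (key y x hy' hx hxy.symm).symm fun x y => Or.imp Eq.symm fun h => h.symm
  · exact key x y hx' hy hxy

theorem Inv.mem_rest (h : σ.Inv G root) {v p : V} {t : List V} (hst : σ.st = v :: p :: t) :
    p ∈ σ.rest v := by
  have hp := h.disj p (by simp [hst])
  refine ⟨Or.inl hp, ?_, fun h' => absurd h' hp⟩
  rintro rfl
  have := h.nodup
  simp [hst] at this

/-- No cycle leads beyond `p`, so the piece at `v` is a closed walk through `p`, degenerate in the
case of a bridge. If a pendant has to remain at `p`, it is represented by `v`. -/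
theorem Inv.lowerBound_finish (h : σ.Inv G root) {v p : V} {t : List V} {o : Option V} {k : ℕ}
    (hst : σ.st = v :: p :: t) (hadj : σ.adj v = []) (ho : σ.pen v = o.toList)
    (htop : ∀ a, σ.top v = some a → a = p)
    (h₀ : zeros ((v, o) :: σ.word v) % 3 = 0 →
      LowerBound (fun u v => u = v ∨ G.Adj u v) (σ.rest v) k)
    (h₁ : zeros ((v, o) :: σ.word v) % 3 ≠ 0 →
      LowerBound (fun u v => u = v ∨ G.Adj u v) (insert v (σ.rest v)) k) :
    LowerBound (fun u v => u = v ∨ G.Adj u v) Set.univ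
      (k + (ones ((v, o) :: σ.word v) + zeros ((v, o) :: σ.word v) / 3) + σ.c) := by
  have hv : v ∈ σ.st := by simp [hst]
  have hvp : G.Adj v p := h.stack v p (by simp [hst])
  refine h.lower _ ?_
  have := LowerBound.cycle_word (r₀ := fun u v => u = v ∨ G.Adj u v) (h.mem_rest hst)
    (fun x => Or.inl rfl) _ ((v, o) :: σ.word v) rfl (h.verts_nodup hv ho) (h.notMem_rest ho) h₀
    (fun hz => ⟨v, fun hv => hv.2.1 rfl, h₁ hz, Or.inr hvp.symm, Or.inr hvp⟩)
  rw [← h.live_eq hv ho] at this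
  exact this.of_hom id (fun x hx => hx) (fun x hx y hy => h.wordRel hst hadj ho htop hx hy)
    fun x hx => ⟨x, hx, rfl⟩

/-- Without a cycle through the edge above it, the edge is a bridge. -/
theorem Inv.not_isCycleEdge (h : σ.Inv G root) {v p : V} {t : List V} (hst : σ.st = v :: p :: t)
    (hadj : σ.adj v = []) (htop : σ.top v = none) : ¬ G.IsCycleEdge s(v, p) := by
  have hp := h.disj p (by simp [hst])
  have hpv : p ≠ v := (h.mem_rest hst).2.1
  refine G.not_isCycleEdge_of_unique (D := {x | x = v ∨ x ∈ σ.fin ∧ σ.own x = v}) (Or.inl rfl) ?_ ?_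
  · rintro (h1 | h1)
    exacts [hpv h1, hp h1.1]
  · rintro x (rfl | hx) y hy hxy
    · rcases h.adj_current hst hadj hxy with h1 | h1 | h1
      · exact absurd (Or.inr h1) hy
      · exact ⟨rfl, h1⟩
      · rw [htop] at h1
        simp at h1
    · rcases h.own_adj x hx.1 y hxy with h1 | h1 | h1
      · exact absurd (Or.inr ⟨h1.1, h1.2.trans hx.2⟩) hy
      · exact absurd (Or.inl (h1.trans hx.2)) hy
      · rw [hx.2, htop] at h1
        simp at h1

/-! ### The reductions at a finished vertex -/

section Steps

variable [DecidableEq V]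

theorem Inv.finish_live (h : σ.Inv G root) {v p : V} {t P : List V} {T : Option V}
    {w : List (V × Option V)} {dn : V → V → Prop} {c : ℕ} (hst : σ.st = v :: p :: t)
    (hP : ∀ x, σ.Att p x → x ∈ P ∨ x ∈ verts w) :
    (σ.finish v p t P T w dn c).live = σ.rest v ∪ {x | x ∈ P ∨ x ∈ verts w} := by
  have hv : v ∈ σ.st := by simp [hst]
  have hpv : p ≠ v := (h.mem_rest hst).2.1
  ext x
  constructor
  · rintro (hx | ⟨s, hx⟩)
    · have hx : ¬ (x = v ∨ x ∈ σ.fin) := hx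
      rw [not_or] at hx
      exact Or.inl ⟨Or.inl hx.2, hx.1, fun h' => absurd h' hx.2⟩
    · rcases eq_or_ne s p with rfl | hsp
      · right
        simpa [Att, Search.finish] using hx
      rcases eq_or_ne s v with rfl | hsv
      · simp [Att, Search.finish, hsp] at hx
      · left
        refine h.att_rest hsv hv ?_
        simpa [Att, Search.finish, hsp, hsv] using hx
  · rintro (⟨hx | ⟨s, hx⟩, h1, h2⟩ | hx)
    · left
      rintro (h3 | h3)
      exacts [h1 h3, hx h3]
    · right
      have := h.att s x hx
      have hsv : s ≠ v := this.2 ▸ h2 this.1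
      rcases eq_or_ne s p with rfl | hsp
      · exact ⟨s, by simpa [Att, Search.finish] using hP x hx⟩
      · exact ⟨s, by simpa [Att, Search.finish, hsp, hsv] using hx⟩
    · exact Or.inr ⟨p, by simpa [Att, Search.finish] using hx⟩

theorem Inv.finish_core (h : σ.Inv G root) {v p x : V} {t P : List V} {T : Option V}
    {dn : V → V → Prop} {c : ℕ} (hst : σ.st = v :: p :: t)
    (hx : x ∈ (σ.finish v p t P T (σ.word p) dn c).core) : x ∈ σ.rest v ∧ x ∈ σ.core := by
  have hv : v ∈ σ.st := by simp [hst]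
  have hpv : p ≠ v := (h.mem_rest hst).2.1
  rcases hx with hx | ⟨s, hx⟩
  · have hx : ¬ (x = v ∨ x ∈ σ.fin) := hx
    rw [not_or] at hx
    exact ⟨⟨Or.inl hx.2, hx.1, fun h' => absurd h' hx.2⟩, Or.inl hx.2⟩
  · rcases eq_or_ne s p with rfl | hsp
    · have hx : x ∈ spine (σ.word s) := by simpa [Search.finish] using hx
      exact ⟨h.att_rest hpv hv (Or.inr (mem_verts_of_mem_spine hx)), Or.inr ⟨s, hx⟩⟩
    rcases eq_or_ne s v with rfl | hsv
    · simp [Search.finish, hsp] at hx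
    · have hx : x ∈ spine (σ.word s) := by simpa [Search.finish, hsp, hsv] using hx
      exact ⟨h.att_rest hsv hv (Or.inr (mem_verts_of_mem_spine hx)), Or.inr ⟨s, hx⟩⟩

/-- A current vertex on no cycle and without a pendant becomes a pendant. -/
theorem Inv.finish_pendant (h : σ.Inv G root) {v p : V} {t : List V} (hst : σ.st = v :: p :: t)
    (hadj : σ.adj v = []) (htop : σ.top v = none) (hpen : σ.pen v = []) :
    (σ.finish v p t (v :: σ.pen p) (σ.top p) (σ.word p) σ.dn σ.c).Inv G root := by
  have hv : v ∈ σ.st := by simp [hst]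
  have hvp : G.Adj v p := h.stack v p (by simp [hst])
  have hpsuf : (p :: t) <:+ σ.st := hst ▸ List.suffix_cons _ _
  have hvatt : ¬ σ.Att p v := fun h' => h.disj v hv (h.att p v h').1
  -- Nothing is removed, so both bounds are inherited unchanged.
  have hlive : (σ.finish v p t (v :: σ.pen p) (σ.top p) (σ.word p) σ.dn σ.c).live = σ.live := by
    rw [h.finish_live hst, h.live_eq hv (o := none) hpen]
    · ext x
      simp only [Set.mem_union, Set.mem_ofPred_eq, verts_cons, h.word_nil v htop, List.mem_cons]
      have : x ∈ σ.pen p ∨ x ∈ verts (σ.word p) → x ∈ σ.rest v :=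
        fun h' => h.att_rest (h.mem_rest hst).2.1 hv h'
      simp
      tauto
    · rintro x (hx | hx)
      exacts [Or.inl (List.mem_cons_of_mem _ hx), Or.inr hx]
  refine h.finish hst hadj (h.word_nil p) ?_ ?_ ?_ (fun a => h.top_mem p t a hpsuf) ?_
    (fun a ha => ⟨ha, rfl⟩) ?_ ?_ ?_ ?_ ?_ (fun _ _ h => h) ?_ (fun _ _ h => h) ?_ ?_ ?_
  · intro l hl
    exact List.mem_cons.1 hl
  · rintro x (hx | hx)
    · rcases List.mem_cons.1 hx with hx | hx
      exacts [Or.inl hx, Or.inr (Or.inl (Or.inl hx))]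
    · exact Or.inr (Or.inl (Or.inr hx))
  · rw [List.cons_append, List.nodup_cons]
    exact ⟨fun h' => hvatt (List.mem_append.1 h'), h.att_nodup p⟩
  · intro a ha
    simp [htop] at ha
  · intro x y hx hy h1 h2 hxy
    have hx : x = v ∨ σ.Att p x := by
      rw [List.mem_cons, or_assoc] at hx
      exact hx
    rcases hx with rfl | hx
    · rcases h.live_current hst hadj hxy hy with h3 | h3 | h3
      · exact Or.inl ⟨by simp, h3⟩
      · simp [hpen] at h3
      · simp [chain, htop, h.word_nil x htop] at h3
    · exact (h.kept p x y hx hy hxy).imp_left fun h3 => ⟨List.mem_cons_of_mem _ h3.1, h3.2⟩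
  · intro x hx
    rcases List.mem_cons.1 hx with rfl | hx
    exacts [hvp, h.adj_of_kept p x p (Or.inl ⟨hx, rfl⟩)]
  · exact fun x y hxy => h.adj_of_kept p x y (Or.inr (Or.inl hxy))
  · exact fun u l hl => h.adj_of_kept p u l (Or.inr (Or.inr (Or.inr ⟨u, l, hl, Or.inl ⟨rfl, rfl⟩⟩)))
  · intro _ a ha
    simp [htop] at ha
  · intro x y hxy
    simp [chain, htop, h.word_nil v htop] at hxy
  · exact Or.inr (Or.inl (h.not_isCycleEdge hst hadj htop))
  · rw [hlive]
    intro k F hF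
    exact h.upper k F fun x y hxy => ⟨(h.finish_core hst (hF x y hxy).1).2,
      (h.finish_core hst (hF x y hxy).2).2⟩
  · rw [hlive]
    exact h.lower

/-- A current vertex on no cycle is removed with its pendant. -/
theorem Inv.finish_remove (h : σ.Inv G root) {v p l : V} {t : List V} (hst : σ.st = v :: p :: t)
    (hadj : σ.adj v = []) (htop : σ.top v = none) (hpen : σ.pen v = [l]) :
    (σ.finish v p t (σ.pen p) (σ.top p) (σ.word p) σ.dn (1 + σ.c)).Inv G root := by
  have hv : v ∈ σ.st := by simp [hst]
  have hvp : G.Adj v p := h.stack v p (by simp [hst])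
  have hpsuf : (p :: t) <:+ σ.st := hst ▸ List.suffix_cons _ _
  have hword := h.word_nil v htop
  have hlv := h.att v l (Or.inl (by simp [hpen]))
  have hlv' : G.Adj l v := h.adj_of_kept v l v (Or.inl ⟨by simp [hpen], rfl⟩)
  have hlive : (σ.finish v p t (σ.pen p) (σ.top p) (σ.word p) σ.dn (1 + σ.c)).live = σ.rest v := by
    rw [h.finish_live hst]
    · ext x
      simp only [Set.mem_union, Set.mem_ofPred_eq]
      have : x ∈ σ.pen p ∨ x ∈ verts (σ.word p) → x ∈ σ.rest v :=
        fun h' => h.att_rest (h.mem_rest hst).2.1 hv h'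
      tauto
    · exact fun x hx => hx
  refine h.finish hst hadj (h.word_nil p) (fun l hl => Or.inr hl) (fun x hx => Or.inr (Or.inl hx))
    (h.att_nodup p) (fun a => h.top_mem p t a hpsuf) ?_
    (fun a ha => ⟨ha, rfl⟩) (fun x y hx hy _ _ hxy => h.kept p x y hx hy hxy) ?_ ?_ ?_ ?_
    (fun _ _ h => h) ?_ (fun _ _ h => h) ?_ ?_ ?_
  · intro a ha
    simp [htop] at ha
  · exact fun x hx => h.adj_of_kept p x p (Or.inl ⟨hx, rfl⟩)
  · exact fun x y hxy => h.adj_of_kept p x y (Or.inr (Or.inl hxy))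
  · exact fun u l hl => h.adj_of_kept p u l (Or.inr (Or.inr (Or.inr ⟨u, l, hl, Or.inl ⟨rfl, rfl⟩⟩)))
  · intro _ a ha
    simp [htop] at ha
  · intro x y hxy
    simp [chain, htop, hword] at hxy
  · exact Or.inr (Or.inl (h.not_isCycleEdge hst hadj htop))
  · rw [hlive]
    intro k F hF hF' hk
    rw [← add_assoc]
    refine h.upper (k + 1) F (fun x y hxy => ⟨(h.finish_core hst (hF x y hxy).1).2,
      (h.finish_core hst (hF x y hxy).2).2⟩) hF' (Or.inl ?_)
    have := hk.attach (r := fun u v => u = v ∨ G.Adj u v) (u := v) (l := l) (h.mem_rest hst)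
      (fun h' => h'.2.1 rfl) (fun h' => h'.2.2 hlv.1 hlv.2) hlv'.ne' (fun _ => Or.inl rfl)
      (fun _ _ _ _ h => h) (fun x y hxy => ⟨(h.finish_core hst (hF x y hxy).1).1,
      (h.finish_core hst (hF x y hxy).2).1⟩) hF' (Or.inr hvp.symm) (Or.inr hvp) (Or.inr hlv'.symm)
      (Or.inr hlv')
    rw [h.live_eq hv (o := some l) hpen, hword]
    convert this using 1
    ext x
    simp
    tauto
  · rw [hlive]
    intro k hk
    -- The bridge with the pendant is a word with one letter. It contains no letter without pendant,
    -- so only the first alternative occurs.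
    have := h.lowerBound_finish (o := some l) (k := k) hst hadj hpen (fun a ha => by simp [htop] at ha)
      (fun _ => hk) (fun hz => absurd (by simp [hword]) hz)
    simpa [hword, add_assoc] using this

end Steps

end Search

/-- Both sides are written with additions, as differences of natural numbers are truncated. -/
theorem sum_update {ι α : Type*} [Fintype ι] [DecidableEq ι] (f : ι → α) (g : α → ℕ) (i : ι) (a : α) :
    ∑ j, g (Function.update f i a j) + g (f i) = ∑ j, g (f j) + g a := by
  rw [← Finset.add_sum_erase _ _ (Finset.mem_univ i),
    ← Finset.add_sum_erase _ (fun j => g (f j)) (Finset.mem_univ i), Function.update_self]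
  have : ∑ j ∈ Finset.univ.erase i, g (Function.update f i a j) =
      ∑ j ∈ Finset.univ.erase i, g (f j) :=
    Finset.sum_congr rfl fun j hj => by rw [Function.update_of_ne (Finset.ne_of_mem_erase hj)]
  omega

namespace Search

variable {G : SimpleGraph V} {root : V} {σ : Search V}

/-- The number of edges and vertices still to be processed. -/
noncomputable def measure [Fintype V] (σ : Search V) : ℕ :=
  ∑ s, (σ.adj s).length + (σ.finᶜ).ncard

theorem measure_lt_finish [Fintype V] {v : V} {σ' : Search V} (hv : v ∉ σ.fin)
    (hfin : σ'.fin = insert v σ.fin) (hadj : σ'.adj = σ.adj) : σ'.measure < σ.measure := by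
  rw [measure, measure, hfin, hadj]
  have : (insert v σ.fin)ᶜ.ncard < σ.finᶜ.ncard := by
    refine Set.ncard_lt_ncard ?_ (Set.toFinite _)
    exact compl_lt_compl_iff_lt.2 (Set.ssubset_insert hv)
  omega

variable [DecidableEq V]

/-- The vertex above the current vertex `v` inherits an unfinished cycle. -/
theorem Inv.finish_path [Finite V] (h : σ.Inv G root) (hG : G.IsChristmasCactus) {v p a : V}
    {t : List V} (hst : σ.st = v :: p :: t) (hadj : σ.adj v = []) (htop : σ.top v = some a)
    (hap : a ≠ p) :
    σ.top p = none ∧ (σ.finish v p t (σ.pen p) (some a) ((v, (σ.pen v).head?) :: σ.word v)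
      σ.dn σ.c).Inv G root := by
  have hv : v ∈ σ.st := by simp [hst]
  have hpv : p ≠ v := (h.mem_rest hst).2.1
  have hp : p ∈ σ.st := by simp [hst]
  have hvp : G.Adj v p := h.stack v p (by simp [hst])
  have hsuf : (v :: p :: t) <:+ σ.st := hst ▸ List.suffix_refl _
  have hpsuf : (p :: t) <:+ σ.st := hst ▸ List.suffix_cons _ _
  have hvt : v ∉ t := fun h' => h.notMem_tail hsuf (List.mem_cons_of_mem _ h')
  have hat : a ∈ t := (List.mem_cons.1 (h.top_mem v _ a hsuf htop).1).resolve_left hap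
  have hchv : σ.chain v = v :: spine (σ.word v) ++ [a] := by simp [chain, htop]
  have hkc : ∀ x y, Consec (σ.chain v) x y → G.Adj x y := fun x y hxy =>
    h.adj_of_kept v x y (Or.inr (Or.inl hxy))
  -- The open cycle reaches the stack above `p` without passing through `p`, so a second open cycle
  -- at `p` would share the edge from `p` to its parent.
  have htopp : σ.top p = none := by
    refine h.top_eq_none hG.1 hpsuf hvp.symm (fun h' => hvt (List.mem_of_mem_head? h'))
      (h.disj v hv) (fun h' => absurd h' hvt) hat ?_
    refine G.connectedAvoiding_of_consec (L := σ.chain v) hkc ?_ (by simp [hchv]) (by simp [hchv])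
    rw [hchv]
    simp only [List.cons_append, List.mem_cons, List.mem_append, List.not_mem_nil, or_false, not_or]
    exact ⟨hpv, fun h' => h.disj p hp (h.att v p (Or.inr (mem_verts_of_mem_spine h'))).1, hap.symm⟩
  refine ⟨htopp, ?_⟩
  have hwp := h.word_nil p htopp
  have ho := h.pen_eq hG hst
  generalize (σ.pen v).head? = o at ho
  have hchain : p :: spine ((v, o) :: σ.word v) ++ (some a).toList = p :: σ.chain v := by
    simp [hchv]
  have hpatt : ∀ x, σ.Att p x → x ∈ σ.pen p := by
    rintro x (hx | hx)
    · exact hx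
    · simp [hwp] at hx
  have hverts : ∀ x, x ∈ verts ((v, o) :: σ.word v) ↔ x = v ∨ σ.Att v x := by
    intro x
    rw [verts_cons, ← ho, List.mem_cons, List.mem_append, Att]
  have hlive : (σ.finish v p t (σ.pen p) (some a) ((v, o) :: σ.word v) σ.dn σ.c).live =
      σ.live := by
    rw [h.finish_live hst, h.live_eq hv ho]
    · ext x
      simp only [Set.mem_union, Set.mem_ofPred_eq]
      have : x ∈ σ.pen p → x ∈ σ.rest v :=
        fun h' => h.att_rest (h.mem_rest hst).2.1 hv (Or.inl h')
      tauto
    · exact fun x hx => Or.inl (hpatt x hx)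
  have hcore : ∀ x, x ∈ (σ.finish v p t (σ.pen p) (some a) ((v, o) :: σ.word v) σ.dn σ.c).core →
      x ∈ σ.core := by
    rintro x (hx | ⟨s, hx⟩)
    · exact Or.inl fun h' => hx (Or.inr h')
    · rcases eq_or_ne s p with rfl | hsp
      · have hx : x ∈ spine ((v, o) :: σ.word v) := by
          simpa only [Search.finish, Function.update_self] using hx
        rw [spine_cons, List.mem_cons] at hx
        rcases hx with rfl | hx
        exacts [Or.inl (h.disj x hv), Or.inr ⟨v, hx⟩]
      rcases eq_or_ne s v with rfl | hsv
      · simp [Search.finish, hsp] at hx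
      · exact Or.inr ⟨s, by simpa [Search.finish, hsp, hsv] using hx⟩
  refine h.finish hst hadj (by simp) (fun l hl => Or.inr hl) ?_ ?_ ?_ ?_ ?_ ?_ ?_ ?_ ?_ ?_
    (fun _ _ h => h) ?_ ?_ ?_ ?_ ?_
  · rintro x (hx | hx)
    · exact Or.inr (Or.inl (Or.inl hx))
    · exact ((hverts x).1 hx).imp_right Or.inr
  · rw [List.nodup_append]
    have h1 := h.att_nodup p
    rw [List.nodup_append] at h1
    refine ⟨h1.1, h.verts_nodup hv ho, ?_⟩
    rintro x hx y hy rfl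
    exact h.notMem_rest ho x hy (h.att_rest hpv hv (Or.inl hx))
  · intro b hb
    obtain rfl := Option.some.inj hb
    exact ⟨hat, by simp⟩
  · exact fun b hb => Or.inr (htop ▸ hb)
  · intro b hb
    simp [htopp] at hb
  · intro x y hx hy h1 h2 hxy
    rw [hchain]
    rcases hx with hx | hx
    · rcases h.kept p x y (Or.inl hx) hy hxy with h3 | h3 | h3 | ⟨u, l, h3, -⟩
      · exact Or.inl h3
      · simp [chain, htopp, hwp] at h3
      · simp [chain, htopp, hwp] at h3
      · simp [hwp] at h3
    · rcases (hverts x).1 hx with rfl | hx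
      · rcases h.live_current hst hadj hxy hy with rfl | h3 | h3
        · exact Or.inr (Or.inr (Or.inl (by simp [hchv])))
        · rw [ho, Option.mem_toList] at h3
          obtain rfl := h3
          exact Or.inr (Or.inr (Or.inr ⟨x, y, by simp, Or.inl ⟨rfl, rfl⟩⟩))
        · exact Or.inr (Or.inl (h3.append_left [p]))
      · rcases h.kept v x y hx hy hxy with ⟨h3, rfl⟩ | h3 | h3 | ⟨u, l, h3, h4⟩
        · rw [ho, Option.mem_toList] at h3
          obtain rfl := h3
          exact Or.inr (Or.inr (Or.inr ⟨y, x, by simp, Or.inr ⟨rfl, rfl⟩⟩))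
        · exact Or.inr (Or.inl (h3.append_left [p]))
        · exact Or.inr (Or.inr (Or.inl (h3.append_left [p])))
        · exact Or.inr (Or.inr (Or.inr ⟨u, l, List.mem_cons_of_mem _ h3, h4⟩))
  · exact fun x hx => h.adj_of_kept p x p (Or.inl ⟨hx, rfl⟩)
  · intro x y hxy
    rw [hchain, hchv, List.cons_append, consec_cons_cons] at hxy
    rcases hxy with ⟨rfl, rfl⟩ | hxy
    · exact hvp.symm
    · refine hkc x y ?_
      rwa [hchv]
  · intro u l hl
    rcases List.mem_cons.1 hl with hl | hl
    · obtain ⟨rfl, rfl⟩ := Prod.mk.inj hl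
      exact (h.adj_of_kept u l u (Or.inl ⟨by simp [ho], rfl⟩)).symm
    · exact h.adj_of_kept v u l (Or.inr (Or.inr (Or.inr ⟨u, l, hl, Or.inl ⟨rfl, rfl⟩⟩)))
  · exact fun h' => absurd (h.att p v (Or.inl h')).1 (h.disj v hv)
  · intro x y hxy
    rw [hchain]
    exact Or.inr (hxy.append_left [p])
  · intro x y hxy
    simp [chain, htopp, hwp] at hxy
  · rw [hchain, hchv]
    exact Or.inr (Or.inr (by simp))
  · rw [hlive]
    intro k F hF
    exact h.upper k F fun x y hxy => ⟨hcore x (hF x y hxy).1, hcore y (hF x y hxy).2⟩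
  · rw [hlive]
    exact h.lower

/-- The current vertex `v` completes a cycle through the vertex above it. -/
theorem Inv.finish_cycle [Finite V] (h : σ.Inv G root) (hG : G.IsChristmasCactus) {v p : V}
    {t : List V} {o : Option V} (ho : (σ.pen v).head? = o) (hst : σ.st = v :: p :: t)
    (hadj : σ.adj v = []) (htop : σ.top v = some p) :
    (σ.finish v p t (if zeros ((v, o) :: σ.word v) % 3 = 0 then σ.pen p else v :: σ.pen p)
      (σ.top p) (σ.word p)
      (fun x y => σ.dn x y ∨ Consec (p :: spine ((v, o) :: σ.word v) ++ [p]) x y)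
      (ones ((v, o) :: σ.word v) + zeros ((v, o) :: σ.word v) / 3 + σ.c)).Inv G root := by
  have ho : σ.pen v = o.toList := ho ▸ h.pen_eq hG hst
  have hv : v ∈ σ.st := by simp [hst]
  have hpv : p ≠ v := (h.mem_rest hst).2.1
  have hp : p ∈ σ.st := by simp [hst]
  have hvp : G.Adj v p := h.stack v p (by simp [hst])
  have hsuf : (v :: p :: t) <:+ σ.st := hst ▸ List.suffix_refl _
  have hpsuf : (p :: t) <:+ σ.st := hst ▸ List.suffix_cons _ _
  have hvatt : ¬ σ.Att p v := fun h' => h.disj v hv (h.att p v h').1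
  have hvrest : v ∉ σ.rest v := fun h' => h'.2.1 rfl
  have hchv : σ.chain v = v :: spine (σ.word v) ++ [p] := by simp [chain, htop]
  have hkc : ∀ x y, Consec (σ.chain v) x y → G.Adj x y := fun x y hxy =>
    h.adj_of_kept v x y (Or.inr (Or.inl hxy))
  -- A top recorded with an empty word is never the parent. So the cycle has at least two vertices
  -- besides `p`.
  have hword : σ.word v ≠ [] := by
    intro h'
    have := ((h.top_mem v _ p hsuf htop).2 h').1
    simp at this
  have hchain : p :: spine ((v, o) :: σ.word v) ++ [p] = p :: σ.chain v := by
    simp [hchv]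
  have hchain' : ∀ x y, Consec (p :: spine ((v, o) :: σ.word v) ++ [p]) x y → G.Adj x y := by
    intro x y hxy
    rw [hchain, hchv, List.cons_append, consec_cons_cons] at hxy
    rcases hxy with ⟨rfl, rfl⟩ | hxy
    · exact hvp.symm
    · refine hkc x y ?_
      rwa [hchv]
  -- One or two leftover vertices of the cycle are worth one pendant at `p`, and `v` is kept in this
  -- role.
  set P := if zeros ((v, o) :: σ.word v) % 3 = 0 then σ.pen p else v :: σ.pen p with hPdef
  have hP : ∀ l ∈ P, l = v ∨ l ∈ σ.pen p := by
    intro l hl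
    rw [hPdef] at hl
    split_ifs at hl
    exacts [Or.inr hl, List.mem_cons.1 hl]
  have hP' : ∀ l ∈ σ.pen p, l ∈ P := by
    intro l hl
    rw [hPdef]
    split_ifs
    exacts [hl, List.mem_cons_of_mem _ hl]
  have hlive : ∀ dn c, (σ.finish v p t P (σ.top p) (σ.word p) dn c).live =
      if zeros ((v, o) :: σ.word v) % 3 = 0 then σ.rest v else insert v (σ.rest v) := by
    intro dn c
    rw [h.finish_live hst]
    · ext x
      have : x ∈ σ.pen p ∨ x ∈ verts (σ.word p) → x ∈ σ.rest v :=
        fun h' => h.att_rest (h.mem_rest hst).2.1 hv h'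
      rw [hPdef]
      split_ifs
      · simp only [Set.mem_union, Set.mem_ofPred_eq]
        tauto
      · simp only [Set.mem_union, Set.mem_ofPred_eq, List.mem_cons, Set.mem_insert_iff]
        tauto
    · rintro x (hx | hx)
      exacts [Or.inl (hP' x hx), Or.inr hx]
  refine h.finish hst hadj (h.word_nil p) hP ?_ ?_ (fun a => h.top_mem p t a hpsuf) ?_
    (fun a ha => ⟨ha, rfl⟩) ?_ ?_ ?_ ?_ ?_ (fun _ _ h => Or.inl h) ?_ (fun _ _ h => h) ?_ ?_ ?_
  · rintro x (hx | hx)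
    · rcases hP x hx with hx | hx
      exacts [Or.inl hx, Or.inr (Or.inl (Or.inl hx))]
    · exact Or.inr (Or.inl (Or.inr hx))
  · rw [hPdef]
    split_ifs
    · exact h.att_nodup p
    · rw [List.cons_append, List.nodup_cons]
      exact ⟨fun h' => hvatt (List.mem_append.1 h'), h.att_nodup p⟩
  · intro a ha
    exact Or.inl (Option.some.inj (ha.symm.trans htop))
  · intro x y hx hy h1 h2 hxy
    have hx' : x = v ∨ σ.Att p x := by
      rcases hx with hx | hx
      exacts [(hP x hx).imp_right Or.inl, Or.inr (Or.inr hx)]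
    rcases hx' with rfl | hx'
    · have hxP : x ∈ P := hx.resolve_right fun h' => hvatt (Or.inr h')
      refine Or.inl ⟨hxP, ?_⟩
      have hyv : ¬ σ.Att x y := by
        intro h3
        have h4 := h.att x y h3
        have h5 : y = x ∨ σ.Att p y := by
          rcases h1 h4.1 h4.2 with h5 | h5
          exacts [(hP y h5).imp_right Or.inl, Or.inr (Or.inr h5)]
        rcases h5 with h5 | h5
        · exact hxy.ne h5.symm
        · exact hpv ((h.att p y h5).2.symm.trans h4.2)
      rcases h.adj_current hst hadj hxy with h3 | h3 | h3
      · rcases hy with hy | ⟨s, hy⟩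
        · exact absurd h3.1 hy
        · obtain rfl := (h.att s y hy).2.symm.trans h3.2
          exact absurd hy hyv
      · exact h3
      · exact absurd h3.2 hword
    · exact (h.kept p x y hx' hy hxy).imp_left fun h3 => ⟨hP' x h3.1, h3.2⟩
  · intro x hx
    rcases hP x hx with rfl | hx
    exacts [hvp, h.adj_of_kept p x p (Or.inl ⟨hx, rfl⟩)]
  · exact fun x y hxy => h.adj_of_kept p x y (Or.inr (Or.inl hxy))
  · exact fun u l hl => h.adj_of_kept p u l (Or.inr (Or.inr (Or.inr ⟨u, l, hl, Or.inl ⟨rfl, rfl⟩⟩)))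
  · exact fun _ a ha => Option.some.inj (ha.symm.trans htop)
  · intro x y hxy
    rw [hchain]
    exact Or.inl (Or.inr (hxy.append_left [p]))
  · left; right
    rw [hchain, hchv]
    simp
  · intro k F hF hF' hk
    rw [hlive] at hk
    have hFr : ∀ x y, F x y → x ∈ σ.rest v ∧ y ∈ σ.rest v := fun x y hxy =>
      ⟨(h.finish_core hst (hF x y hxy).1).1, (h.finish_core hst (hF x y hxy).2).1⟩
    have hred : ReducedBound (fun u v => u = v ∨ G.Adj u v) (σ.rest v) F k p
        (zeros ((v, o) :: σ.word v)) := by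
      refine ⟨fun hz => by rwa [if_pos hz] at hk, fun hz => ⟨v, hvrest, ?_, ?_, ?_⟩⟩
      · rw [if_neg hz] at hk
        -- Both `p` and the new pendant are live, so the exceptional single vertex is excluded.
        refine hk.resolve_right ?_
        rintro ⟨-, b, hb⟩
        have h1 : v ∈ ({b} : Set V) := hb ▸ Set.mem_insert _ _
        have h2 : p ∈ ({b} : Set V) := hb ▸ Set.mem_insert_of_mem _ (h.mem_rest hst)
        exact hpv (h2.trans h1.symm)
      all_goals
        rintro y (rfl | hy) hvy
        · exact Or.inr rfl
        · have hvy : G.Adj v y := by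
            rcases hvy with hvy | hvy
            · exact absurd hy (by simpa [hvy] using hvrest)
            · first | exact hvy | exact hvy.symm
          left
          rcases h.adj_current hst hadj hvy with h1 | h1 | h1
          exacts [absurd h1.2 (hy.2.2 h1.1), h1, absurd h1.2 hword]
    have := UpperBound.cycle_word (r₀ := fun u v => u = v ∨ G.Adj u v) (h.mem_rest hst) hFr hF' _
      ((v, o) :: σ.word v) rfl (by
        have := List.length_pos_of_ne_nil hword
        simp only [List.length_cons]
        omega) (fun u v => u = v ∨ G.Adj u v) (h.verts_nodup hv ho) (h.notMem_rest ho)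
      (fun x => Or.inl rfl) (fun x _ y _ h => h)
      (fun x y hxy => ⟨Or.inr (hchain' x y hxy), Or.inr (hchain' x y hxy).symm⟩) ?_ hred
    · rw [← h.live_eq hv ho] at this
      have := h.upper _ _ ?_ ?_ (Or.inl this)
      · rw [← add_assoc]
        exact this.mono_pairs fun x y hxy => by tauto
      · have hc : ∀ x ∈ p :: spine ((v, o) :: σ.word v) ++ [p], x ∈ σ.core := by
          intro x hx
          simp only [List.cons_append, spine_cons, List.mem_cons, List.mem_append, List.not_mem_nil,
            or_false] at hx
          rcases hx with rfl | rfl | hx | rfl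
          exacts [Or.inl (h.disj _ hp), Or.inl (h.disj _ hv), Or.inr ⟨v, hx⟩, Or.inl (h.disj _ hp)]
        rintro x y (hxy | hxy)
        · exact ⟨(h.finish_core hst (hF x y hxy).1).2, (h.finish_core hst (hF x y hxy).2).2⟩
        · exact ⟨hc x hxy.mem.1, hc y hxy.mem.2⟩
      · rintro x (hx | hx)
        exacts [hF' x hx, (hchain' x x hx).ne rfl]
    · intro u l hl
      have : G.Adj u l := by
        rcases List.mem_cons.1 hl with hl | hl
        · obtain ⟨rfl, rfl⟩ := Prod.mk.inj hl
          exact (h.adj_of_kept u l u (Or.inl ⟨by simp [ho], rfl⟩)).symm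
        · exact h.adj_of_kept v u l (Or.inr (Or.inr (Or.inr ⟨u, l, hl, Or.inl ⟨rfl, rfl⟩⟩)))
      exact ⟨Or.inr this, Or.inr this.symm⟩
  · intro k hk
    rw [hlive] at hk
    rw [← add_assoc]
    refine h.lowerBound_finish hst hadj ho (fun a ha => Option.some.inj (ha.symm.trans htop))
      (fun hz => by rwa [if_pos hz] at hk) fun hz => by rwa [if_neg hz] at hk

/-- The result of the search. -/
theorem Inv.final [Finite V] (h : σ.Inv G root) (hG : G.IsChristmasCactus) (hst : σ.st = [root])
    (hadj : σ.adj root = []) :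
    WeakUpperBound (fun u v => u = v ∨ G.Adj u v) Set.univ σ.dn
      ((if 1 < (σ.pen root).length then 2 else 1) + σ.c) ∧
    LowerBound (fun u v => u = v ∨ G.Adj u v) Set.univ
      ((if 1 < (σ.pen root).length then 2 else 1) + σ.c) ∧
    (∀ x y, G.IsCycleEdge s(x, y) → σ.dn x y ∨ σ.dn y x) ∧ ∀ s, σ.word s = [] := by
  have hsuf : (root :: []) <:+ σ.st := hst ▸ List.suffix_refl _
  have htop : ∀ s, σ.top s = none := by
    intro s
    by_cases hs : s ∈ σ.st
    · obtain rfl : s = root := by simpa [hst] using hs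
      rcases ht : σ.top s with _ | a
      · rfl
      · have := (h.top_mem s [] a hsuf ht).1
        simp at this
    · exact (h.off s hs).2
  have hword : ∀ s, σ.word s = [] := fun s => h.word_nil s (htop s)
  have hchain : ∀ s, σ.chain s = [s] := fun s => by simp [chain, htop, hword]
  have hrf : root ∉ σ.fin := h.disj root (by simp [hst])
  have hown : ∀ x ∈ σ.fin, σ.own x = root := fun x hx => by simpa [hst] using h.own_mem x hx
  -- Only the root is on the stack and it has no open cycle, so no edge leads out of the root and
  -- the finished vertices; the graph is connected.
  have hall : ∀ x, x = root ∨ x ∈ σ.fin := by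
    intro x
    obtain ⟨q⟩ := hG.1.1.preconnected root x
    have key : ∀ {a b : V}, G.Walk a b → (a = root ∨ a ∈ σ.fin) → (b = root ∨ b ∈ σ.fin) := by
      intro a b q
      induction q with
      | nil => exact id
      | @cons a b _ hab _ ih =>
        intro ha
        refine ih ?_
        rcases ha with rfl | ha
        · rcases h.disc a (by simp [hst]) b hab with h1 | h1 | h1
          · simp [hadj] at h1
          · left; simpa [hst] using h1
          · exact Or.inr h1
        · rcases h.own_adj a ha b hab with h1 | h1 | h1
          · exact Or.inr h1.1
          · exact Or.inl (h1.trans (hown a ha))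
          · simp [htop] at h1
    exact key q (Or.inl rfl)
  have hlive : ∀ x, x ∈ σ.live ↔ x = root ∨ x ∈ σ.pen root := by
    intro x
    constructor
    · rintro (hx | ⟨s, hx⟩)
      · exact Or.inl ((hall x).resolve_right hx)
      · have hx' : x ∈ σ.pen s := by simpa [Att, hword] using hx
        have := h.att s x hx
        rw [← this.2, hown x this.1] at hx'
        exact Or.inr hx'
    · rintro (rfl | hx)
      exacts [Or.inl hrf, Or.inr ⟨root, Or.inl hx⟩]
  have hpadj : ∀ l ∈ σ.pen root, G.Adj l root := fun l hl =>
    h.adj_of_kept root l root (Or.inl ⟨hl, rfl⟩)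
  have hpadj' : ∀ l ∈ σ.pen root, ∀ y ∈ σ.live, G.Adj l y → y = root := by
    intro l hl y hy hly
    rcases h.kept root l y (Or.inl hl) hy hly with h1 | h1 | h1 | ⟨u, l, h1, -⟩
    · exact h1.2
    · simp [hchain] at h1
    · simp [hchain] at h1
    · simp [hword] at h1
  have hnd : (σ.pen root).Nodup := by
    have := h.att_nodup root
    simpa [hword] using this
  have hedge : ∀ x y, G.IsCycleEdge s(x, y) → σ.dn x y ∨ σ.dn y x := by
    intro x y hxy
    have hxy' : G.Adj x y := by
      obtain ⟨a, c, -, hm⟩ := hxy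
      exact c.adj_of_mem_edges hm
    have key : ∀ x y, G.Adj x y → x ∈ σ.fin → G.IsCycleEdge s(x, y) → σ.dn x y ∨ σ.dn y x := by
      intro x y hadj hx hxy
      rcases h.edge x hx y hadj with h1 | h1 | h1 | ⟨s, h1⟩
      · exact Or.inl h1
      · exact Or.inr h1
      · exact absurd hxy h1
      · simp [hchain] at h1
    rcases hall x with rfl | hx
    · rcases hall y with rfl | hy
      · exact absurd rfl hxy'.ne
      · exact (key y x hxy'.symm hy (by rwa [Sym2.eq_swap])).symm
    · exact key x y hxy' hx hxy
  have hup : ∀ k, WeakUpperBound (fun u v => u = v ∨ G.Adj u v) σ.live (fun _ _ => False) k →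
      WeakUpperBound (fun u v => u = v ∨ G.Adj u v) Set.univ σ.dn (k + σ.c) := fun k hk =>
    (h.upper k _ (fun _ _ h => h.elim) (fun _ h => h) hk).mono_pairs fun _ _ h => Or.inr h
  refine ⟨hup _ ?_, h.lower _ ?_, hedge, hword⟩
  -- What remains is a vertex, an edge or a path on three vertices; three pendants would put the
  -- root into three blocks.
  · rcases hp : σ.pen root with _ | ⟨l, _ | ⟨l', _ | ⟨l'', L⟩⟩⟩
    · right
      refine ⟨by simp, root, ?_⟩
      ext x
      rw [hlive, hp]
      simp
    · left
      have hl : l ∈ σ.pen root := by simp [hp]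
      have := UpperBound.edge (r := fun u v => u = v ∨ G.Adj u v) (F := fun _ _ => False)
        (hpadj l hl).ne' (fun _ => Or.inl rfl) (Or.inr (hpadj l hl).symm) (Or.inr (hpadj l hl))
        (fun _ _ h => h)
      convert this using 1
      swap
      · simp
      ext x
      rw [hlive, hp]
      simp
    · left
      have hl : l ∈ σ.pen root := by simp [hp]
      have hl' : l' ∈ σ.pen root := by simp [hp]
      have hll : l ≠ l' := by
        rintro rfl
        simp [hp] at hnd
      have := UpperBound.path (r := fun u v => u = v ∨ G.Adj u v) (F := fun _ _ => False)
        (hpadj l hl).ne (hpadj l' hl').ne' hll (fun _ => Or.inl rfl) (Or.inr (hpadj l hl))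
        (Or.inr (hpadj l hl).symm) (Or.inr (hpadj l' hl').symm) (Or.inr (hpadj l' hl'))
        (fun _ _ h => h.elim)
      convert this using 1
      swap
      · simp
      ext x
      rw [hlive, hp]
      simp
      tauto
    · exfalso
      simp only [hp, List.nodup_cons, List.mem_cons, not_or] at hnd
      have hl'' : l'' ∈ σ.pen root := by simp [hp]
      exact h.false_of_pen (hG.2 root) (s := root) (l := l) (l' := l') (u := l'') (by simp [hp])
        (by simp [hp]) hnd.1.1 (hpadj l'' hl'').symm (Or.inr ⟨hl'', Ne.symm hnd.1.2.1,
          Ne.symm hnd.2.1.1⟩)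
  · split_ifs with h1
    · rcases hp : σ.pen root with _ | ⟨l, _ | ⟨l', L⟩⟩
      · simp [hp] at h1
      · simp [hp] at h1
      · have hl : l ∈ σ.pen root := by simp [hp]
        have hl' : l' ∈ σ.pen root := by simp [hp]
        have hll : l ≠ l' := by
          rintro rfl
          simp [hp] at hnd
        -- One guard is always on `l` or the root. When it is dropped and all else is contracted to
        -- the other pendant, that one still needs a guard.
        have hcon := LowerBound.contract (r := fun x y => x = l' ∧ y = l') (r' := fun u v => u = v ∨ G.Adj u v)
          (A := {l'}) (A' := σ.live) (k := 1) (LowerBound.one rfl) (fun _ => l') {l, root} l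
          ((hlive l).2 (Or.inr hl)) ?_ ?_ ?_ ?_ ?_
        · exact hcon
        · rintro x hx (rfl | hxl)
          · simp
          · rw [hpadj' l hl x hx hxl.symm]
            simp
        · simp
        · simp
        · simp
        · rintro x rfl
          refine ⟨x, (hlive x).2 (Or.inr hl'), ?_, rfl⟩
          rintro (h2 | h2)
          · exact hll h2.symm
          · exact (hpadj x hl').ne h2
    · exact LowerBound.one ((hlive root).2 (Or.inl rfl))

/-! ### Termination of the search -/

section Measure

variable [Fintype V]

theorem measure_lt {v w : V} {l : List V} {σ' : Search V} (h : σ.adj v = w :: l)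
    (hfin : σ'.fin = σ.fin) (hadj : σ'.adj = Function.update σ.adj v l) :
    σ'.measure < σ.measure := by
  have := sum_update σ.adj List.length v l
  rw [measure, measure, hfin, hadj]
  rw [h, List.length_cons] at this
  omega

theorem Inv.exists_step (h : σ.Inv G root) (hG : G.IsChristmasCactus)
    (hend : ¬ (σ.st = [root] ∧ σ.adj root = [])) :
    ∃ σ' : Search V, σ'.Inv G root ∧ σ'.measure < σ.measure := by
  rcases hst : σ.st with _ | ⟨v, t⟩
  · have := h.last
    simp [hst] at this
  have hv : v ∈ σ.st := by simp [hst]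
  have hvf := h.disj v hv
  rcases hadj : σ.adj v with _ | ⟨w, l⟩
  · rcases t with _ | ⟨p, t⟩
    · obtain rfl : root = v := by
        have := h.last
        rw [hst] at this
        simpa [List.suffix_cons_iff] using this
      exact absurd ⟨hst, hadj⟩ hend
    · rcases ht : σ.top v with _ | a
      · have hp := h.pen_eq hG hst
        rcases ho : (σ.pen v).head? with _ | l
        · exact ⟨_, h.finish_pendant hst hadj ht (by rw [hp, ho]; rfl),
            measure_lt_finish hvf rfl rfl⟩
        · exact ⟨_, h.finish_remove hst hadj ht (l := l) (by rw [hp, ho]; rfl),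
            measure_lt_finish hvf rfl rfl⟩
      · by_cases hap : a = p
        · exact ⟨_, h.finish_cycle hG rfl hst hadj (hap ▸ ht), measure_lt_finish hvf rfl rfl⟩
        · exact ⟨_, (h.finish_path hG hst hadj ht hap).2, measure_lt_finish hvf rfl rfl⟩
  · by_cases hskip : w ∈ σ.fin ∨ t.head? = some w
    · exact ⟨_, h.skip hst hadj hskip, measure_lt hadj rfl rfl⟩
    rw [not_or] at hskip
    by_cases hw : w ∈ σ.st
    · refine ⟨_, h.setTop hG.1 hst hadj ?_ hskip.2, measure_lt hadj rfl rfl⟩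
      rw [hst, List.mem_cons] at hw
      exact hw.resolve_left (h.adj_adj v w (by simp [hadj])).ne'
    · exact ⟨_, h.push hst hadj hskip.1 hw, measure_lt hadj rfl rfl⟩

theorem Inv.exists_final (h : σ.Inv G root) (hG : G.IsChristmasCactus) :
    ∃ σ' : Search V, σ'.Inv G root ∧ σ'.st = [root] ∧ σ'.adj root = [] := by
  induction hk : σ.measure using Nat.strong_induction_on generalizing σ with
  | _ k ih =>
    by_cases hend : σ.st = [root] ∧ σ.adj root = []
    · exact ⟨σ, h, hend⟩
    · obtain ⟨σ', h', hlt⟩ := h.exists_step hG hend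
      exact ih _ (hk ▸ hlt) h' rfl

end Measure

end Search

end Guards

/-! ### Programs without loops -/

namespace RAM

/-- The final state of a program without loops. -/
noncomputable def Program.eval : Program → State → State
  | .instr i, σ => i.apply σ
  | .seq P Q, σ => Q.eval (P.eval σ)
  | .ite b P Q, σ => open Classical in if b.Holds σ then P.eval σ else Q.eval σ
  | .while _ _, σ => σ

/-- A bound on the number of steps of a program without loops. -/
def Program.cost : Program → ℕ
  | .instr _ => 1
  | .seq P Q => P.cost + Q.cost
  | .ite _ P Q => 1 + (P.cost + Q.cost)
  | .while _ _ => 0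

/-- The program has no loops. -/
def Program.LoopFree : Program → Prop
  | .instr _ => True
  | .seq P Q => P.LoopFree ∧ Q.LoopFree
  | .ite _ P Q => P.LoopFree ∧ Q.LoopFree
  | .while _ _ => False

theorem Program.LoopFree.exec {P : Program} (h : P.LoopFree) (σ : State) :
    ∃ t ≤ P.cost, Exec P σ t (P.eval σ) := by
  induction P generalizing σ with
  | instr i => exact ⟨1, le_rfl, .instr i σ⟩
  | seq P Q ihP ihQ =>
    obtain ⟨t, ht, h1⟩ := ihP h.1 σ
    obtain ⟨u, hu, h2⟩ := ihQ h.2 (P.eval σ)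
    exact ⟨t + u, add_le_add ht hu, .seq h1 h2⟩
  | ite b P Q ihP ihQ =>
    by_cases hb : b.Holds σ
    · obtain ⟨t, ht, h1⟩ := ihP h.1 σ
      refine ⟨1 + t, by simp only [cost]; omega, ?_⟩
      rw [eval, if_pos hb]
      exact .ite_true hb h1
    · obtain ⟨t, ht, h1⟩ := ihQ h.2 σ
      refine ⟨1 + t, by simp only [cost]; omega, ?_⟩
      rw [eval, if_neg hb]
      exact .ite_false hb h1
  | _ => exact h.elim

/-- A sequence of instructions. -/
def block : List Instr → Program
  -- There is no empty program; copying a register to itself changes nothing and costs one step.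
  | [] => .instr (.copy 0 0)
  | i :: l => .seq (.instr i) (block l)

theorem loopFree_block (l : List Instr) : (block l).LoopFree := by
  induction l with
  | nil => trivial
  | cons i l ih => exact ⟨trivial, ih⟩

@[simp] theorem eval_block_nil (σ : State) : (block []).eval σ = σ := by
  simp [block, Program.eval, Instr.apply, State.setReg]

@[simp] theorem eval_block_cons (i : Instr) (l : List Instr) (σ : State) :
    (block (i :: l)).eval σ = (block l).eval (i.apply σ) := rfl

/-! ### The program -/

/-- Add an edge from the number in register `u` to the number in register `w`. -/
def addArc (u w : ℕ) : List Instr :=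
  -- Adjacency lists are linked lists: array 2 holds the first cell for each vertex, arrays 3 and 4
  -- hold the next cell and the end of the edge. Register 11 is the last cell in use. Cells start at
  -- 1, so 0 marks the end of a list.
  [.inc 11, .load 7 2 u, .store 3 11 7, .store 4 11 w, .store 2 u 11]

/-- Read the next edge of the input. -/
def readEdge : Program :=
  block ([.load 4 0 10, .load 5 1 10] ++ addArc 4 5 ++ addArc 5 4 ++ [.inc 10])

/-- Give the number in register `6` a pendant. -/
def addPendant : List Instr :=
  [.load 7 7 6, .inc 7, .store 7 6 7]

/-- Back up from a vertex on a cycle. -/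
def finishCycle : Program :=
  .seq (block [.load 16 9 2, .copy 17 6, .inc 17]) <|
  -- Register 16 counts modulo three the letters without pendant. A vertex without pendant adds one
  -- to it and costs a guard when a triple is complete; a vertex with a pendant costs a guard at
  -- once.
  .seq (.ite (.eq 7 12)
    (.seq (block [.inc 16]) (.ite (.eq 16 15) (block [.const 16 0, .inc 8]) (block [])))
    (block [.inc 8])) <|
  -- If the cycle closes at the parent, a nonzero residue leaves a pendant there; otherwise the
  -- parent inherits top and residue.
  .ite (.eq 5 17) (.ite (.eq 16 12) (block []) (block addPendant))
    (block [.store 8 6 5, .store 9 6 16])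

/-- Finish the current vertex. -/
def finishVertex : Program :=
  .seq (block [.store 5 2 14]) <|
  -- Vertex 0 is the root. Register 9 is the flag that ends the search.
  .ite (.eq 2 12) (block [.const 9 1]) <|
  .seq (block [.load 6 6 2, .load 5 8 2, .load 7 7 2]) <|
  .seq (.ite (.eq 5 12) (.ite (.eq 7 12) (block addPendant) (block [.inc 8])) finishCycle)
    (block [.copy 2 6])

/-- Follow the next edge. -/
def followEdge : Program :=
  -- The edge is taken off the list. Register 4 gets its other end and register 7 the state of that
  -- end: 0 for new, 1 for on the stack, 2 for finished.
  .seq (block [.load 7 3 3, .store 2 2 7, .load 4 4 3, .load 7 5 4]) <|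
  .ite (.eq 7 12) (block [.store 5 4 13, .store 6 4 2, .copy 2 4]) <|
  .ite (.eq 7 13)
    (.seq (block [.load 7 6 2])
      -- Array 6 holds parents. Tops are stored in array 8 increased by one, so that 0 means none.
      (.ite (.eq 7 4) (block []) (block [.copy 7 4, .inc 7, .store 8 2 7])))
    (block [])

/-- One step of the search. -/
def searchStep : Program :=
  .seq (block [.load 3 2 2]) (.ite (.eq 3 12) finishVertex followEdge)

/-- Set up constants and mark the root. -/
def prepare : Program :=
  block [.const 13 1, .const 14 2, .const 15 3, .store 5 12 13]

/-- Write the answer to register `0`. -/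
def answer : Program :=
  .seq (block [.load 7 7 12]) <|
  .seq (.ite (.lt 13 7) (block [.inc 8, .inc 8]) (block [.inc 8])) (block [.copy 0 8])

/-- The whole program. -/
def cactusProgram : Program :=
  .seq prepare <| .seq (.while (.lt 10 1) readEdge) <| .seq (.while (.eq 9 12) searchStep) answer

theorem loopFree_prepare : prepare.LoopFree := loopFree_block _

theorem loopFree_answer : answer.LoopFree := by
  simp [answer, Program.LoopFree, loopFree_block]

theorem loopFree_readEdge : readEdge.LoopFree := loopFree_block _

theorem loopFree_searchStep : searchStep.LoopFree := by
  simp [searchStep, finishVertex, followEdge, finishCycle, Program.LoopFree, loopFree_block]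

/-- `j` is the first cell of a linked list that holds `l`. -/
def Linked {n : ℕ} (nxt tgt : ℕ → ℕ) : ℕ → List (Fin n) → Prop
  | j, [] => j = 0
  | j, w :: l => j ≠ 0 ∧ tgt j = w ∧ Linked nxt tgt (nxt j) l

/-! ### The effect of one step on the memory -/

section

variable {τ : State}

theorem eval_skip (h : τ.arr 2 (τ.reg 2) ≠ 0) (h12 : τ.reg 12 = 0) (h13 : τ.reg 13 = 1)
    (h' : τ.arr 5 (τ.arr 4 (τ.arr 2 (τ.reg 2))) = 2 ∨
      τ.arr 5 (τ.arr 4 (τ.arr 2 (τ.reg 2))) = 1 ∧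
      τ.arr 6 (τ.reg 2) = τ.arr 4 (τ.arr 2 (τ.reg 2))) :
    (searchStep.eval τ).arr = Function.update τ.arr 2 (Function.update (τ.arr 2) (τ.reg 2)
      (τ.arr 3 (τ.arr 2 (τ.reg 2)))) ∧
    ∀ r, r = 2 ∨ 8 ≤ r → (searchStep.eval τ).reg r = τ.reg r := by
  rcases h' with h' | ⟨h', h''⟩
  · simp [searchStep, Program.eval, followEdge, Instr.apply, State.setReg, State.setArr, Test.Holds, h, h12, h13, h']
    grind
  · simp [searchStep, Program.eval, followEdge, Instr.apply, State.setReg, State.setArr, Test.Holds, h, h12, h13, h', h'']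
    grind

theorem eval_push (h : τ.arr 2 (τ.reg 2) ≠ 0) (h12 : τ.reg 12 = 0) (h13 : τ.reg 13 = 1)
    (h' : τ.arr 5 (τ.arr 4 (τ.arr 2 (τ.reg 2))) = 0) :
    (searchStep.eval τ).arr = Function.update (Function.update (Function.update τ.arr
      2 (Function.update (τ.arr 2) (τ.reg 2) (τ.arr 3 (τ.arr 2 (τ.reg 2)))))
      5 (Function.update (τ.arr 5) (τ.arr 4 (τ.arr 2 (τ.reg 2))) 1))
      6 (Function.update (τ.arr 6) (τ.arr 4 (τ.arr 2 (τ.reg 2))) (τ.reg 2)) ∧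
    (searchStep.eval τ).reg 2 = τ.arr 4 (τ.arr 2 (τ.reg 2)) ∧
    ∀ r, 8 ≤ r → (searchStep.eval τ).reg r = τ.reg r := by
  simp [searchStep, Program.eval, followEdge, Instr.apply, State.setReg, State.setArr, Test.Holds,
    h, h12, h13, h']
  grind

theorem eval_setTop (h : τ.arr 2 (τ.reg 2) ≠ 0) (h12 : τ.reg 12 = 0) (h13 : τ.reg 13 = 1)
    (h' : τ.arr 5 (τ.arr 4 (τ.arr 2 (τ.reg 2))) = 1)
    (h'' : τ.arr 6 (τ.reg 2) ≠ τ.arr 4 (τ.arr 2 (τ.reg 2))) :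
    (searchStep.eval τ).arr = Function.update (Function.update τ.arr
      2 (Function.update (τ.arr 2) (τ.reg 2) (τ.arr 3 (τ.arr 2 (τ.reg 2)))))
      8 (Function.update (τ.arr 8) (τ.reg 2) (τ.arr 4 (τ.arr 2 (τ.reg 2)) + 1)) ∧
    ∀ r, r = 2 ∨ 8 ≤ r → (searchStep.eval τ).reg r = τ.reg r := by
  simp [searchStep, Program.eval, followEdge, Instr.apply, State.setReg, State.setArr, Test.Holds,
    h, h12, h13, h', h'']
  grind

theorem eval_root (h : τ.arr 2 (τ.reg 2) = 0) (h12 : τ.reg 12 = 0) (h14 : τ.reg 14 = 2)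
    (hv : τ.reg 2 = 0) :
    (searchStep.eval τ).arr = Function.update τ.arr 5 (Function.update (τ.arr 5) 0 2) ∧
    (searchStep.eval τ).reg 9 = 1 ∧
    ∀ r, r = 8 ∨ 10 ≤ r → (searchStep.eval τ).reg r = τ.reg r := by
  rw [hv] at h
  simp [searchStep, Program.eval, finishVertex, Instr.apply, State.setReg, State.setArr, Test.Holds,
    h, h12, h14, hv]
  grind

theorem eval_pendant (h : τ.arr 2 (τ.reg 2) = 0) (h12 : τ.reg 12 = 0) (h14 : τ.reg 14 = 2)
    (hv : τ.reg 2 ≠ 0) (htop : τ.arr 8 (τ.reg 2) = 0) (ht : τ.arr 7 (τ.reg 2) = 0) :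
    (searchStep.eval τ).arr = Function.update (Function.update τ.arr
      5 (Function.update (τ.arr 5) (τ.reg 2) 2))
      7 (Function.update (τ.arr 7) (τ.arr 6 (τ.reg 2)) (τ.arr 7 (τ.arr 6 (τ.reg 2)) + 1)) ∧
    (searchStep.eval τ).reg 2 = τ.arr 6 (τ.reg 2) ∧
    ∀ r, 8 ≤ r → (searchStep.eval τ).reg r = τ.reg r := by
  simp [searchStep, Program.eval, finishVertex, Instr.apply, State.setReg, State.setArr, Test.Holds,
    h, h12, h14, hv, htop, ht, addPendant]
  grind

theorem eval_remove (h : τ.arr 2 (τ.reg 2) = 0) (h12 : τ.reg 12 = 0) (h14 : τ.reg 14 = 2)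
    (hv : τ.reg 2 ≠ 0) (htop : τ.arr 8 (τ.reg 2) = 0) (ht : τ.arr 7 (τ.reg 2) ≠ 0) :
    (searchStep.eval τ).arr = Function.update τ.arr 5 (Function.update (τ.arr 5) (τ.reg 2) 2) ∧
    (searchStep.eval τ).reg 2 = τ.arr 6 (τ.reg 2) ∧
    (searchStep.eval τ).reg 8 = τ.reg 8 + 1 ∧
    ∀ r, 9 ≤ r → (searchStep.eval τ).reg r = τ.reg r := by
  simp [searchStep, Program.eval, finishVertex, Instr.apply, State.setReg, State.setArr, Test.Holds,
    h, h12, h14, hv, htop, ht]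
  grind

theorem eval_cycle (h : τ.arr 2 (τ.reg 2) = 0) (h12 : τ.reg 12 = 0) (h14 : τ.reg 14 = 2)
    (h15 : τ.reg 15 = 3) (hv : τ.reg 2 ≠ 0) (htop : τ.arr 8 (τ.reg 2) ≠ 0) {y d : ℕ}
    (hyd : τ.arr 7 (τ.reg 2) = 0 ∧ τ.arr 9 (τ.reg 2) + 1 ≠ 3 ∧ y = τ.arr 9 (τ.reg 2) + 1 ∧ d = 0 ∨
      τ.arr 7 (τ.reg 2) = 0 ∧ τ.arr 9 (τ.reg 2) + 1 = 3 ∧ y = 0 ∧ d = 1 ∨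
      τ.arr 7 (τ.reg 2) ≠ 0 ∧ y = τ.arr 9 (τ.reg 2) ∧ d = 1) :
    (searchStep.eval τ).arr = (if τ.arr 8 (τ.reg 2) = τ.arr 6 (τ.reg 2) + 1 then
      if y = 0 then Function.update τ.arr 5 (Function.update (τ.arr 5) (τ.reg 2) 2) else
      Function.update (Function.update τ.arr 5 (Function.update (τ.arr 5) (τ.reg 2) 2))
        7 (Function.update (τ.arr 7) (τ.arr 6 (τ.reg 2)) (τ.arr 7 (τ.arr 6 (τ.reg 2)) + 1))
      else
      Function.update (Function.update (Function.update τ.arr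
        5 (Function.update (τ.arr 5) (τ.reg 2) 2))
        8 (Function.update (τ.arr 8) (τ.arr 6 (τ.reg 2)) (τ.arr 8 (τ.reg 2))))
        9 (Function.update (τ.arr 9) (τ.arr 6 (τ.reg 2)) y)) ∧
    (searchStep.eval τ).reg 2 = τ.arr 6 (τ.reg 2) ∧
    (searchStep.eval τ).reg 8 = τ.reg 8 + d ∧
    (searchStep.eval τ).reg 9 = τ.reg 9 ∧ (searchStep.eval τ).reg 12 = τ.reg 12 ∧
    (searchStep.eval τ).reg 13 = τ.reg 13 ∧ (searchStep.eval τ).reg 14 = τ.reg 14 ∧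
    (searchStep.eval τ).reg 15 = τ.reg 15 := by
  by_cases ha : τ.arr 8 (τ.reg 2) = τ.arr 6 (τ.reg 2) + 1
  · by_cases hy : y = 0
    · rcases hyd with ⟨h1, h2, rfl, rfl⟩ | ⟨h1, h2, rfl, rfl⟩ | ⟨h1, rfl, rfl⟩
      · omega
      · simp [searchStep, Program.eval, finishVertex, finishCycle, Instr.apply, State.setReg,
          State.setArr, Test.Holds, h, h12, h14, h15, hv, ha, h1, h2]
      · simp [searchStep, Program.eval, finishVertex, finishCycle, Instr.apply, State.setReg,
          State.setArr, Test.Holds, h, h12, h14, hv, ha, h1, hy]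
    · rcases hyd with ⟨h1, h2, rfl, rfl⟩ | ⟨h1, h2, rfl, rfl⟩ | ⟨h1, rfl, rfl⟩
      · simp [searchStep, Program.eval, finishVertex, finishCycle, Instr.apply, State.setReg,
          State.setArr, Test.Holds, h, h12, h14, h15, hv, ha, h1, h2, addPendant]
      · omega
      · simp [searchStep, Program.eval, finishVertex, finishCycle, Instr.apply, State.setReg,
          State.setArr, Test.Holds, h, h12, h14, hv, ha, h1, hy, addPendant]
  · rcases hyd with ⟨h1, h2, rfl, rfl⟩ | ⟨h1, h2, rfl, rfl⟩ | ⟨h1, rfl, rfl⟩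
    all_goals
      simp [searchStep, Program.eval, finishVertex, finishCycle, Instr.apply, State.setReg,
        State.setArr, Test.Holds, *]

end

end RAM

/-! ### The search as represented in the memory -/

namespace RAM

open Guards

/-- The number of guards for the cycles along `w`. -/
def weight {W : Type*} (w : List (W × Option W)) : ℕ := ones w + zeros w / 3

/-- The memory `τ` holds the data of the search `σ`. -/
structure Holds {n : ℕ} (σ : Search (Fin n)) (τ : State) : Prop where
  current : ∀ v t, σ.st = v :: t → τ.reg 2 = v
  -- The machine counts the guards of an open cycle letter by letter, while `σ.c` takes them into
  -- account when the cycle is closed.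
  count : τ.reg 8 = σ.c + ∑ s, weight (σ.word s)
  reg9 : τ.reg 9 = 0
  reg12 : τ.reg 12 = 0
  reg13 : τ.reg 13 = 1
  reg14 : τ.reg 14 = 2
  reg15 : τ.reg 15 = 3
  adj : ∀ s : Fin n, Linked (τ.arr 3) (τ.arr 4) (τ.arr 2 s) (σ.adj s)
  disc_new : ∀ s : Fin n, s ∉ σ.st → s ∉ σ.fin → τ.arr 5 s = 0
  disc_st : ∀ s ∈ σ.st, τ.arr 5 s = 1
  disc_fin : ∀ s ∈ σ.fin, τ.arr 5 s = 2
  par : ∀ x y : Fin n, Consec σ.st x y → τ.arr 6 x = y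
  -- Entries of finished vertices are out of date. They are not read again, since the machine only
  -- consults the current vertex and its parent.
  pen : ∀ s : Fin n, s ∉ σ.fin → τ.arr 7 s = (σ.pen s).length
  top : ∀ s : Fin n, s ∉ σ.fin → τ.arr 8 s = (σ.top s).elim 0 fun a => (a : ℕ) + 1
  zero : ∀ s : Fin n, s ∉ σ.fin → τ.arr 9 s = zeros (σ.word s) % 3

variable {n : ℕ} {G : SimpleGraph (Fin n)} {root : Fin n} {σ : Search (Fin n)} {τ : State}

/-- Passes from arrays indexed by numbers to functions on vertices, where updates at different
vertices are easily told apart. -/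
theorem update_val {f : ℕ → ℕ} {v s : Fin n} {x : ℕ} :
    Function.update f (v : ℕ) x (s : ℕ) = Function.update (fun s : Fin n => f s) v x s := by
  rcases eq_or_ne s v with rfl | h
  · simp
  · rw [Function.update_of_ne h, Function.update_of_ne (by simpa [Fin.ext_iff] using h)]

theorem linked_update {nxt tgt f : ℕ → ℕ} {adj : Fin n → List (Fin n)} {v w : Fin n}
    {l : List (Fin n)} (h : ∀ s : Fin n, Linked nxt tgt (f s) (adj s)) (hv : adj v = w :: l)
    (s : Fin n) :
    Linked nxt tgt (Function.update f (v : ℕ) (nxt (f v)) s) (Function.update adj v l s) := by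
  rw [update_val]
  rcases eq_or_ne s v with rfl | hs
  · have := h s
    rw [hv] at this
    simpa using this.2.2
  · simpa [hs] using h s

/-- The memory after following an edge. -/
theorem Holds.follow (hG : G.IsCactus) (h : σ.Inv G root) (hr : Holds σ τ) {v w : Fin n}
    {t l : List (Fin n)} (hst : σ.st = v :: t) (hadj : σ.adj v = w :: l) :
    ∃ σ' : Search (Fin n), σ'.Inv G root ∧ Holds σ' (searchStep.eval τ) ∧ σ'.measure < σ.measure := by
  have h2 := hr.current v t hst
  have hl := hr.adj v
  rw [hadj] at hl
  obtain ⟨h3, h4, h5⟩ := hl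
  have hvst : v ∈ σ.st := by simp [hst]
  rw [← h2] at h3 h4 h5
  have hwst : w ∈ σ.st → w ∈ t := fun hw => by
    rw [hst, List.mem_cons] at hw
    exact hw.resolve_left (h.adj_adj v w (by simp [hadj])).ne'
  have hpar : w ∈ t → (τ.arr 6 v = w ↔ t.head? = some w) := by
    intro hw
    cases t with
    | nil => simp at hw
    | cons p t =>
      rw [hr.par v p (by simp [hst])]
      simp [Fin.ext_iff]
  by_cases hskip : w ∈ σ.fin ∨ t.head? = some w
  · refine ⟨σ.skip v l, h.skip hst hadj hskip, ?_, Search.measure_lt hadj rfl rfl⟩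
    obtain ⟨e1, e2⟩ := eval_skip (τ := τ) h3 hr.reg12 hr.reg13 (by
      rw [h4, h2]
      rcases hskip with hw | hw
      · exact Or.inl (hr.disc_fin w hw)
      · have hwt := List.mem_of_mem_head? hw
        exact Or.inr ⟨hr.disc_st w (by rw [hst]; exact List.mem_cons_of_mem _ hwt),
          (hpar hwt).2 hw⟩)
    rw [h2] at e1
    constructor
    · intro v' t' hst'
      rw [e2 2 (by simp)]
      exact hr.current v' t' hst'
    · rw [e2 8 (by simp)]; exact hr.count
    · rw [e2 9 (by simp)]; exact hr.reg9
    · rw [e2 12 (by simp)]; exact hr.reg12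
    · rw [e2 13 (by simp)]; exact hr.reg13
    · rw [e2 14 (by simp)]; exact hr.reg14
    · rw [e2 15 (by simp)]; exact hr.reg15
    · intro s
      simpa [e1, Search.skip] using linked_update hr.adj hadj s
    all_goals simp only [e1, ne_eq, Nat.reduceEqDiff, not_false_eq_true,
      Function.update_of_ne]
    exacts [hr.disc_new, hr.disc_st, hr.disc_fin, hr.par, hr.pen, hr.top, hr.zero]
  rw [not_or] at hskip
  by_cases hw : w ∈ σ.st
  · have hwt := hwst hw
    refine ⟨σ.setTop v w l, h.setTop hG hst hadj hwt hskip.2, ?_, Search.measure_lt hadj rfl rfl⟩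
    obtain ⟨e1, e2⟩ := eval_setTop (τ := τ) h3 hr.reg12 hr.reg13 (by
      rw [h4]; exact hr.disc_st w hw) (by
      rw [h4, h2]; exact fun e => hskip.2 ((hpar hwt).1 e))
    rw [h4, h2] at e1
    constructor
    · intro v' t' hst'
      rw [e2 2 (by simp)]
      exact hr.current v' t' hst'
    · rw [e2 8 (by simp)]; exact hr.count
    · rw [e2 9 (by simp)]; exact hr.reg9
    · rw [e2 12 (by simp)]; exact hr.reg12
    · rw [e2 13 (by simp)]; exact hr.reg13
    · rw [e2 14 (by simp)]; exact hr.reg14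
    · rw [e2 15 (by simp)]; exact hr.reg15
    · intro s
      simpa [e1, Search.setTop] using linked_update hr.adj hadj s
    all_goals simp only [e1, ne_eq, Nat.reduceEqDiff, not_false_eq_true,
      Function.update_of_ne, Function.update_self]
    · exact hr.disc_new
    · exact hr.disc_st
    · exact hr.disc_fin
    · exact hr.par
    · exact hr.pen
    · intro s hs
      rw [update_val]
      rcases eq_or_ne s v with rfl | hsv
      · simp [Search.setTop]
      · simpa [Search.setTop, hsv] using hr.top s hs
    · exact hr.zero
  · refine ⟨σ.push v w l, h.push hst hadj hskip.1 hw, ?_, Search.measure_lt hadj rfl rfl⟩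
    obtain ⟨e1, e3, e2⟩ := eval_push (τ := τ) h3 hr.reg12 hr.reg13 (by
      rw [h4]; exact hr.disc_new w hw hskip.1)
    rw [h4] at e1 e3
    rw [h2] at e1
    constructor
    · intro v' t' hst'
      rw [e3]
      exact congrArg _ (List.cons.inj hst').1
    · rw [e2 8 (by simp)]; exact hr.count
    · rw [e2 9 (by simp)]; exact hr.reg9
    · rw [e2 12 (by simp)]; exact hr.reg12
    · rw [e2 13 (by simp)]; exact hr.reg13
    · rw [e2 14 (by simp)]; exact hr.reg14
    · rw [e2 15 (by simp)]; exact hr.reg15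
    · intro s
      simpa [e1, Search.push] using linked_update hr.adj hadj s
    all_goals simp only [e1, ne_eq, Nat.reduceEqDiff, not_false_eq_true,
      Function.update_of_ne, Function.update_self]
    · intro s hs hs'
      have hs : ¬ s ∈ w :: σ.st := hs
      rw [List.mem_cons, not_or] at hs
      rw [update_val, Function.update_of_ne hs.1]
      exact hr.disc_new s hs.2 hs'
    · intro s hs
      rw [update_val]
      rcases eq_or_ne s w with rfl | hsw
      · simp
      · rw [Function.update_of_ne hsw]
        exact hr.disc_st s ((List.mem_cons.1 hs).resolve_left hsw)
    · intro s hs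
      rw [update_val, Function.update_of_ne (by rintro rfl; exact hskip.1 hs)]
      exact hr.disc_fin s hs
    · intro x y hxy
      have hxy' : Consec (w :: σ.st) x y := hxy
      rw [hst, consec_cons_cons] at hxy'
      rcases hxy' with ⟨rfl, rfl⟩ | hxy'
      · simp
      · rw [← hst] at hxy'
        rw [update_val, Function.update_of_ne (by rintro rfl; exact hw hxy'.mem.1)]
        exact hr.par x y hxy'
    · exact hr.pen
    · exact hr.top
    · exact hr.zero

/-- The memory after finishing a vertex. -/
theorem Holds.finish (h : σ.Inv G root) (hr : Holds σ τ) {v p : Fin n} {t P : List (Fin n)}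
    {T : Option (Fin n)} {w : List (Fin n × Option (Fin n))} {dn : Fin n → Fin n → Prop} {c : ℕ}
    (hst : σ.st = v :: p :: t) {τ' : State} (h2 : τ'.reg 2 = p)
    (h8 : τ'.reg 8 + weight (σ.word v) + weight (σ.word p) + σ.c = τ.reg 8 + weight w + c)
    (h9 : τ'.reg 9 = τ.reg 9) (h12 : τ'.reg 12 = τ.reg 12) (h13 : τ'.reg 13 = τ.reg 13)
    (h14 : τ'.reg 14 = τ.reg 14) (h15 : τ'.reg 15 = τ.reg 15)
    (a2 : τ'.arr 2 = τ.arr 2) (a3 : τ'.arr 3 = τ.arr 3) (a4 : τ'.arr 4 = τ.arr 4)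
    (a5 : τ'.arr 5 = Function.update (τ.arr 5) v 2) (a6 : τ'.arr 6 = τ.arr 6)
    (a7 : τ'.arr 7 = Function.update (τ.arr 7) p P.length)
    (a8 : τ'.arr 8 = Function.update (τ.arr 8) p (T.elim 0 fun a => (a : ℕ) + 1))
    (a9 : τ'.arr 9 = Function.update (τ.arr 9) p (zeros w % 3)) :
    Holds (σ.finish v p t P T w dn c) τ' := by
  have hnodup := h.nodup
  rw [hst, List.nodup_cons] at hnodup
  have hvst : v ∈ σ.st := by simp [hst]
  have hpv : p ≠ v := fun e => hnodup.1 (by simp [e])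
  have hfin : ∀ s, s ∉ (σ.finish v p t P T w dn c).fin → s ≠ v ∧ s ∉ σ.fin := by
    intro s hs
    have hs : ¬ (s = v ∨ s ∈ σ.fin) := hs
    rwa [not_or] at hs
  constructor
  · intro v' t' hst'
    rw [h2]
    exact congrArg _ (List.cons.inj hst').1
  -- Only the words at `v` and `p` change, so the sum of weights is adjusted in these two places.
  · have e1 := sum_update (Function.update σ.word v []) weight p w
    have e2 := sum_update σ.word weight v []
    rw [Function.update_of_ne hpv] at e1
    have e3 := hr.count
    have e4 : weight ([] : List (Fin n × Option (Fin n))) = 0 := by simp [weight]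
    change τ'.reg 8 = c + ∑ s, weight (Function.update (Function.update σ.word v []) p w s)
    omega
  · rw [h9, hr.reg9]
  · rw [h12, hr.reg12]
  · rw [h13, hr.reg13]
  · rw [h14, hr.reg14]
  · rw [h15, hr.reg15]
  · rw [a2, a3, a4]; exact hr.adj
  · intro s hs hs'
    have hs : s ∉ p :: t := hs
    obtain ⟨h3, h4⟩ := hfin s hs'
    rw [a5, update_val, Function.update_of_ne h3]
    exact hr.disc_new s (by rw [hst, List.mem_cons]; tauto) h4
  · intro s hs
    have hs : s ∈ p :: t := hs
    rw [a5, update_val, Function.update_of_ne (by rintro rfl; exact hnodup.1 hs)]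
    exact hr.disc_st s (by rw [hst]; exact List.mem_cons_of_mem _ hs)
  · intro s hs
    rw [a5, update_val]
    rcases eq_or_ne s v with rfl | hsv
    · simp
    · rw [Function.update_of_ne hsv]
      exact hr.disc_fin s (hs.resolve_left hsv)
  · intro x y hxy
    rw [a6]
    exact hr.par x y (hst ▸ Or.inr hxy)
  · intro s hs
    rw [a7, update_val]
    rcases eq_or_ne s p with rfl | hsp
    · simp [Search.finish]
    · simpa [Search.finish, hsp, (hfin s hs).1] using hr.pen s (hfin s hs).2
  · intro s hs
    rw [a8, update_val]
    rcases eq_or_ne s p with rfl | hsp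
    · simp [Search.finish]
    · simpa [Search.finish, hsp, (hfin s hs).1] using hr.top s (hfin s hs).2
  · intro s hs
    rw [a9, update_val]
    rcases eq_or_ne s p with rfl | hsp
    · simp [Search.finish]
    · simpa [Search.finish, hsp, (hfin s hs).1] using hr.zero s (hfin s hs).2

theorem Holds.finishVertex (hG : G.IsChristmasCactus) (h : σ.Inv G root) (hr : Holds σ τ)
    (hroot : (root : ℕ) = 0) {v p : Fin n} {t : List (Fin n)} (hst : σ.st = v :: p :: t)
    (hadj : σ.adj v = []) :
    ∃ σ' : Search (Fin n), σ'.Inv G root ∧ Holds σ' (searchStep.eval τ) ∧ σ'.measure < σ.measure := by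
  have h2 := hr.current v _ hst
  have hvst : v ∈ σ.st := by simp [hst]
  have hpst : p ∈ σ.st := by simp [hst]
  have hvf := h.disj v hvst
  have hpf := h.disj p hpst
  have hnodup := h.nodup
  have hl : τ.arr 2 (τ.reg 2) = 0 := by
    have := hr.adj v
    rw [hadj] at this
    rw [h2]
    exact this
  have hv : τ.reg 2 ≠ 0 := by
    rw [h2]
    intro e
    have hvr : v = root := Fin.ext (e.trans hroot.symm)
    have := h.last
    rw [hst, List.suffix_cons_iff] at this
    rw [hst, List.nodup_cons] at hnodup
    rcases this with h3 | h3
    · simp at h3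
    · exact hnodup.1 (hvr ▸ h3.subset (by simp))
  have hpar : τ.arr 6 (τ.reg 2) = p := by rw [h2]; exact hr.par v p (by simp [hst])
  have htop := hr.top v hvf
  have hpen := hr.pen v hvf
  have hz := hr.zero v hvf
  have hpen' := h.pen_eq hG hst
  have hself7 : Function.update (τ.arr 7) p (σ.pen p).length = τ.arr 7 := by
    rw [← hr.pen p hpf, Function.update_eq_self]
  have hself8 : Function.update (τ.arr 8) p ((σ.top p).elim 0 fun a => (a : ℕ) + 1) = τ.arr 8 := by
    rw [← hr.top p hpf, Function.update_eq_self]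
  have hself9 : Function.update (τ.arr 9) p (zeros (σ.word p) % 3) = τ.arr 9 := by
    rw [← hr.zero p hpf, Function.update_eq_self]
  rcases ht : σ.top v with _ | a
  · have hword := h.word_nil v ht
    have hw0 : weight (σ.word v) = 0 := by simp [hword, weight]
    rw [ht] at htop
    rcases hp : σ.pen v with _ | ⟨l, L⟩
    · refine ⟨_, h.finish_pendant hst hadj ht hp, ?_, Search.measure_lt_finish hvf rfl rfl⟩
      obtain ⟨e1, e2, e3⟩ := eval_pendant hl hr.reg12 hr.reg14 hv (by rw [h2, htop]; rfl)
        (by rw [h2, hpen, hp]; rfl)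
      rw [h2] at e1 e2
      rw [h2] at hpar
      rw [hpar] at e1 e2
      refine hr.finish h hst e2 (by rw [e3 8 (by simp)]; omega) (e3 9 (by simp)) (e3 12 (by simp))
        (e3 13 (by simp)) (e3 14 (by simp)) (e3 15 (by simp)) ?_ ?_ ?_ ?_ ?_ ?_ ?_ ?_
      all_goals simp [e1, hself8, hself9, hr.pen p hpf]
    · obtain rfl : L = [] := by
        rw [hp] at hpen'
        simpa using hpen'
      refine ⟨_, h.finish_remove hst hadj ht hp, ?_, Search.measure_lt_finish hvf rfl rfl⟩
      obtain ⟨e1, e2, e3, e4⟩ := eval_remove hl hr.reg12 hr.reg14 hv (by rw [h2, htop]; rfl)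
        (by rw [h2, hpen, hp]; simp)
      rw [h2] at e1 e2
      rw [h2] at hpar
      rw [hpar] at e2
      refine hr.finish h hst e2 (by rw [e3]; omega) (e4 9 (by simp)) (e4 12 (by simp))
        (e4 13 (by simp)) (e4 14 (by simp)) (e4 15 (by simp)) ?_ ?_ ?_ ?_ ?_ ?_ ?_ ?_
      all_goals simp [e1, hself7, hself8, hself9]
  · rw [ht] at htop
    obtain ⟨o, ho⟩ : ∃ o, (σ.pen v).head? = o := ⟨_, rfl⟩
    have hpo : σ.pen v = o.toList := ho ▸ hpen'
    -- `d` is the number of guards by which the letter `v` raises the weight of the word: one for a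
    -- pendant or for a completed triple, otherwise none.
    obtain ⟨d, hd, hyd⟩ : ∃ d, d + weight (σ.word v) = weight ((v, o) :: σ.word v) ∧
        (τ.arr 7 (τ.reg 2) = 0 ∧ τ.arr 9 (τ.reg 2) + 1 ≠ 3 ∧
          zeros ((v, o) :: σ.word v) % 3 = τ.arr 9 (τ.reg 2) + 1 ∧ d = 0 ∨
        τ.arr 7 (τ.reg 2) = 0 ∧ τ.arr 9 (τ.reg 2) + 1 = 3 ∧
          zeros ((v, o) :: σ.word v) % 3 = 0 ∧ d = 1 ∨
        τ.arr 7 (τ.reg 2) ≠ 0 ∧ zeros ((v, o) :: σ.word v) % 3 = τ.arr 9 (τ.reg 2) ∧ d = 1) := by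
      rw [h2, hpen, hz, hpo]
      rcases o with _ | l
      · simp only [Option.toList_none, List.length_nil, zeros_cons_none, ones_cons_none, weight]
        by_cases h3 : zeros (σ.word v) % 3 + 1 = 3
        · exact ⟨1, by omega, Or.inr (Or.inl ⟨trivial, h3, by omega, rfl⟩)⟩
        · exact ⟨0, by omega, Or.inl ⟨trivial, h3, by omega, rfl⟩⟩
      · simp only [Option.toList_some, List.length_singleton, zeros_cons_some, ones_cons_some,
          weight]
        exact ⟨1, by omega, Or.inr (Or.inr ⟨by simp, trivial, rfl⟩)⟩
    obtain ⟨e1, e2, e3, e4, e5, e6, e7, e8⟩ := eval_cycle hl hr.reg12 hr.reg14 hr.reg15 hv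
      (by rw [h2, htop]; simp) hyd
    rw [h2] at e1 e2
    rw [h2] at hpar
    rw [hpar] at e1 e2
    rw [htop] at e1
    by_cases hap : a = p
    · subst hap
      refine ⟨_, h.finish_cycle hG ho hst hadj ht, ?_, Search.measure_lt_finish hvf rfl rfl⟩
      simp only [Option.elim_some, if_true] at e1
      refine hr.finish h hst e2 ?_ e4 e5 e6 e7 e8 ?_ ?_ ?_ ?_ ?_ ?_ ?_ ?_
      · rw [e3]
        simp only [weight] at hd ⊢
        omega
      all_goals
        by_cases hz3 : zeros ((v, o) :: σ.word v) % 3 = 0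
        · simp [e1, hz3, hself7, hself8, hself9]
        · simp [e1, hz3, hself8, hself9, hr.pen a hpf]
    · obtain ⟨htp, hinv⟩ := h.finish_path hG hst hadj ht hap
      rw [ho] at hinv
      refine ⟨_, hinv, ?_, Search.measure_lt_finish hvf rfl rfl⟩
      have hne : ¬ ((a : ℕ) + 1 = p + 1) := fun e => hap (Fin.ext (Nat.succ.inj e))
      simp only [Option.elim_some] at e1
      replace e1 := e1.trans (if_neg hne)
      refine hr.finish h hst e2 ?_ e4 e5 e6 e7 e8 ?_ ?_ ?_ ?_ ?_ ?_ ?_ ?_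
      · have : weight (σ.word p) = 0 := by simp [h.word_nil p htp, weight]
        rw [e3]
        omega
      all_goals simp [e1, hself7]

/-- Each pass of the loop carries out one step of the search, except for the last one, which raises
the flag and preserves everything that the answer is read from. -/
theorem Holds.step (hG : G.IsChristmasCactus) (h : σ.Inv G root) (hr : Holds σ τ)
    (hroot : (root : ℕ) = 0) :
    (∃ σ' : Search (Fin n), σ'.Inv G root ∧ Holds σ' (searchStep.eval τ) ∧ σ'.measure < σ.measure) ∨
    (σ.st = [root] ∧ σ.adj root = [] ∧ (searchStep.eval τ).reg 9 = 1 ∧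
      (searchStep.eval τ).reg 8 = τ.reg 8 ∧ (searchStep.eval τ).arr 7 = τ.arr 7 ∧
      (searchStep.eval τ).reg 12 = 0 ∧ (searchStep.eval τ).reg 13 = 1) := by
  rcases hst : σ.st with _ | ⟨v, t⟩
  · have := h.last
    simp [hst] at this
  rcases hadj : σ.adj v with _ | ⟨w, l⟩
  · rcases t with _ | ⟨p, t⟩
    · right
      obtain rfl : root = v := by
        have := h.last
        rw [hst] at this
        simpa [List.suffix_cons_iff] using this
      have h2 := (hr.current _ _ hst).trans hroot
      have hl : τ.arr 2 (τ.reg 2) = 0 := by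
        have := hr.adj root
        rw [hadj] at this
        rw [hr.current _ _ hst]
        exact this
      obtain ⟨e1, e2, e3⟩ := eval_root hl hr.reg12 hr.reg14 h2
      refine ⟨rfl, hadj, e2, e3 8 (by simp), by simp [e1], ?_, ?_⟩
      · rw [e3 12 (by simp), hr.reg12]
      · rw [e3 13 (by simp), hr.reg13]
    · exact Or.inl (hr.finishVertex hG h hroot hst hadj)
  · exact Or.inl (hr.follow hG.1 h hst hadj)

/-- The search in the memory of the machine. -/
theorem Holds.exec (hG : G.IsChristmasCactus) (hroot : (root : ℕ) = 0) (k : ℕ) (h : σ.Inv G root)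
    (hr : Holds σ τ) (hk : σ.measure ≤ k) :
    ∃ (t : ℕ) (τ' : State) (σ' : Search (Fin n)), Exec (.while (.eq 9 12) searchStep) τ t τ' ∧
      t ≤ (1 + searchStep.cost) * (k + 1) + 1 ∧ σ'.Inv G root ∧ σ'.st = [root] ∧
      σ'.adj root = [] ∧ τ'.reg 8 = σ'.c + ∑ s, weight (σ'.word s) ∧
      τ'.arr 7 0 = (σ'.pen root).length ∧ τ'.reg 12 = 0 ∧ τ'.reg 13 = 1 := by
  induction k using Nat.strong_induction_on generalizing σ τ with
  | _ k ih =>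
    obtain ⟨t, ht, he⟩ := loopFree_searchStep.exec τ
    have hb : (Test.eq 9 12).Holds τ := by rw [Test.Holds, hr.reg9, hr.reg12]
    rcases hr.step hG h hroot with ⟨σ', h1, h2, h3⟩ | ⟨h1, h2, h3, h4, h5, h6, h7⟩
    · obtain ⟨u, τ', σ'', h4, h5, h6⟩ := ih (σ'.measure) (by omega) h1 h2 le_rfl
      refine ⟨1 + t + u, τ', σ'', .while_true hb he h4, ?_, h6⟩
      have : (1 + searchStep.cost) * (σ'.measure + 1 + 1) ≤ (1 + searchStep.cost) * (k + 1) :=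
        Nat.mul_le_mul_left _ (by omega)
      rw [mul_add (1 + searchStep.cost) (σ'.measure + 1) 1] at this
      omega
    · refine ⟨1 + t + 1, _, σ, .while_true hb he (.while_false ?_), ?_, h, h1, h2, ?_, ?_, h6, h7⟩
      · rw [Test.Holds, h3, h6]; simp
      · have : (1 + searchStep.cost) * 1 ≤ (1 + searchStep.cost) * (k + 1) :=
          Nat.mul_le_mul_left _ (by omega)
        omega
      · rw [h4]; exact hr.count
      · rw [h5, ← hr.pen root (h.disj root (by simp [h1])), hroot]

end RAM

/-! ### The three numbers -/

namespace SimpleGraph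

open Guards

variable {V : Type*} {G : SimpleGraph V} {k : ℕ}

theorem le_mEternalGuardNumber
    (h : LowerBound (fun u v => u = v ∨ G.Adj u v) Set.univ k) : (k : ℕ∞) ≤ G.mEternalGuardNumber := by
  refine le_iInf₂ ?_
  rintro j ⟨S, ⟨hne, hcard⟩, hdef⟩
  exact Nat.cast_le.2 (h S j hne hcard (fun _ _ _ _ => trivial) fun C hC v _ => hdef C hC v)

theorem mEternalGuardNumber_le : G.mEternalGuardNumber ≤ G.mEternalDominationNumber :=
  le_iInf₂ fun j ⟨S, h1, _, h3⟩ => iInf₂_le j ⟨S, h1, h3⟩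

theorem mEternalDominationNumber_le : G.mEternalDominationNumber ≤ G.mEternalEvictionNumber :=
  le_iInf₂ fun j ⟨S, h1, h2, h3, _⟩ => iInf₂_le j ⟨S, h1, h2, h3⟩

theorem mEternalEvictionNumber_le {F : V → V → Prop}
    (h : UpperBound (fun u v => u = v ∨ G.Adj u v) Set.univ F k)
    (hF : ∀ x y, G.IsCycleEdge s(x, y) → F x y ∨ F y x) : G.mEternalEvictionNumber ≤ k := by
  obtain ⟨S, hS⟩ := h
  refine iInf₂_le k ⟨S, ⟨hS.nonempty, hS.card⟩, hS.nodup, fun C hC v => hS.defend C hC v trivial,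
    fun C hC v => hS.evict C hC v trivial, fun C hC u v huv => ?_⟩
  rcases hF u v huv with h | h
  · exact hS.evictPair C hC u v h
  · obtain ⟨C', h1, h2, h3, h4⟩ := hS.evictPair C hC v u h
    exact ⟨C', h1, h2, h4, h3⟩

/-- The three numbers lie between the lower and the upper bound, which agree. On a single vertex the
last number is left out, and one guard that stands still settles the others. -/
theorem numbers_eq {F : V → V → Prop}
    (h : WeakUpperBound (fun u v => u = v ∨ G.Adj u v) Set.univ F k)
    (h' : LowerBound (fun u v => u = v ∨ G.Adj u v) Set.univ k)
    (hF : ∀ x y, G.IsCycleEdge s(x, y) → F x y ∨ F y x) :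
    (k : ℕ∞) = G.mEternalGuardNumber ∧ (k : ℕ∞) = G.mEternalDominationNumber ∧
      (Nontrivial V → (k : ℕ∞) = G.mEternalEvictionNumber) := by
  have h1 := le_mEternalGuardNumber h'
  have h2 := G.mEternalGuardNumber_le
  have h3 := G.mEternalDominationNumber_le
  rcases h with h | ⟨rfl, a, ha⟩
  · have h4 := mEternalEvictionNumber_le h hF
    exact ⟨h1.antisymm (h2.trans (h3.trans h4)), (h1.trans h2).antisymm (h3.trans h4),
      fun _ => (h1.trans (h2.trans h3)).antisymm h4⟩
  · have hall : ∀ x : V, x = a := fun x => by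
      have : x ∈ (Set.univ : Set V) := trivial
      rwa [ha] at this
    have h4 : G.mEternalDominationNumber ≤ (1 : ℕ) := by
      refine iInf₂_le 1 ⟨{{a}}, ⟨Set.singleton_nonempty _, ?_⟩, ?_, ?_⟩
      · rintro C rfl
        simp
      · rintro C rfl
        simp
      · rintro C rfl v
        refine ⟨{a}, rfl, Multiset.rel_refl_of_refl_on fun _ _ => Or.inl rfl, ?_⟩
        rw [hall v]
        simp
    refine ⟨h1.antisymm (h2.trans h4), (h1.trans h2).antisymm h4, fun hV => ?_⟩
    obtain ⟨x, y, hxy⟩ := hV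
    exact absurd ((hall x).trans (hall y).symm) hxy

/-- A strategy with eviction that is as small as any strategy. -/
theorem IsChristmasCactus.exists_numbers_eq [Finite V] (hG : G.IsChristmasCactus) :
    ∃ k : ℕ, (k : ℕ∞) = G.mEternalGuardNumber ∧ (k : ℕ∞) = G.mEternalDominationNumber ∧
      (Nontrivial V → (k : ℕ∞) = G.mEternalEvictionNumber) := by
  classical
  have := Fintype.ofFinite V
  obtain ⟨root⟩ := hG.1.1.nonempty
  have h := Search.inv_init (G := G) (root := root) (fun s => (G.neighborFinset s).toList)
    (fun s => Finset.nodup_toList _) (fun s x => by simp)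
  obtain ⟨σ, hσ, h1, h2⟩ := h.exists_final hG
  obtain ⟨h3, h4, h5, -⟩ := hσ.final hG h1 h2
  exact ⟨_, numbers_eq h3 h4 h5⟩

end SimpleGraph

/-! ### Reading the input and the running time -/

namespace RAM

open Guards

section

variable {τ : State}

/-- Distinct ends are essential: for a loop the second new cell would have to point to the first one
rather than to the old list. -/
theorem eval_readEdge {u w : ℕ} (hu : τ.arr 0 (τ.reg 10) = u) (hw : τ.arr 1 (τ.reg 10) = w)
    (huw : u ≠ w) :
    (readEdge.eval τ).arr = Function.update (Function.update (Function.update τ.arr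
      2 (Function.update (Function.update (τ.arr 2) u (τ.reg 11 + 1)) w (τ.reg 11 + 2)))
      3 (Function.update (Function.update (τ.arr 3) (τ.reg 11 + 1) (τ.arr 2 u))
        (τ.reg 11 + 2) (τ.arr 2 w)))
      4 (Function.update (Function.update (τ.arr 4) (τ.reg 11 + 1) w) (τ.reg 11 + 2) u) ∧
    (readEdge.eval τ).reg 10 = τ.reg 10 + 1 ∧ (readEdge.eval τ).reg 11 = τ.reg 11 + 2 ∧
    ∀ r, r < 4 ∨ r = 8 ∨ r = 9 ∨ 12 ≤ r → (readEdge.eval τ).reg r = τ.reg r := by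
  have huw' := huw.symm
  refine ⟨?_, ?_, ?_, ?_⟩
  · funext a
    simp [readEdge, addArc, Instr.apply, State.setReg, State.setArr, hu, hw, huw']
    grind
  · simp [readEdge, addArc, Instr.apply, State.setReg, State.setArr]
  · simp [readEdge, addArc, Instr.apply, State.setReg, State.setArr]
  · intro r hr
    have h1 : r ≠ 4 := by omega
    have h2 : r ≠ 5 := by omega
    have h3 : r ≠ 7 := by omega
    have h4 : r ≠ 10 := by omega
    have h5 : r ≠ 11 := by omega
    simp [readEdge, addArc, Instr.apply, State.setReg, State.setArr, *]

end

variable {n : ℕ} {G : SimpleGraph (Fin n)} {root : Fin n}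

/-- The edges `l₁` of `l` have been read, and `adj` are the adjacency lists. -/
structure Built (l l₁ : List (Fin n × Fin n)) (adj : Fin n → List (Fin n)) (τ : State) : Prop where
  arr0 : τ.arr 0 = (input n l).arr 0
  arr1 : τ.arr 1 = (input n l).arr 1
  arr5 : τ.arr 5 = Function.update (fun _ => 0) 0 1
  zero : ∀ a, 6 ≤ a → τ.arr a = fun _ => 0
  reg1 : τ.reg 1 = l.length
  reg2 : τ.reg 2 = 0
  reg8 : τ.reg 8 = 0
  reg9 : τ.reg 9 = 0
  reg10 : τ.reg 10 = l₁.length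
  reg12 : τ.reg 12 = 0
  reg13 : τ.reg 13 = 1
  reg14 : τ.reg 14 = 2
  reg15 : τ.reg 15 = 3
  -- Later writes go only to cells beyond register 11. Quantifying over all contents that agree up
  -- to there makes the lists survive them.
  linked : ∀ nxt tgt : ℕ → ℕ, (∀ i ≤ τ.reg 11, nxt i = τ.arr 3 i ∧ tgt i = τ.arr 4 i) →
    ∀ s : Fin n, Linked nxt tgt (τ.arr 2 s) (adj s)
  mem_adj : ∀ s x, x ∈ adj s ↔ s(s, x) ∈ l₁.map fun e => s(e.1, e.2)
  nodup : ∀ s, (adj s).Nodup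
  sum : ∑ s, (adj s).length = 2 * l₁.length

theorem Built.step {l l₁ l₂ : List (Fin n × Fin n)} {adj : Fin n → List (Fin n)} {τ : State}
    {u w : Fin n} (hl : l = l₁ ++ (u, w) :: l₂) (huw : u ≠ w)
    (hnd : (l.map fun e => s(e.1, e.2)).Nodup) (h : Built l l₁ adj τ) :
    ∃ adj', Built l (l₁ ++ [(u, w)]) adj' (readEdge.eval τ) := by
  have h0 : τ.arr 0 (τ.reg 10) = u := by
    rw [h.arr0, h.reg10, hl]
    simp [input]
  have h1 : τ.arr 1 (τ.reg 10) = w := by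
    rw [h.arr1, h.reg10, hl]
    simp [input]
  have huw' : (u : ℕ) ≠ w := fun e => huw (Fin.ext e)
  obtain ⟨e1, e2, e3, e4⟩ := eval_readEdge h0 h1 huw'
  have hnew : s(u, w) ∉ l₁.map fun e => s(e.1, e.2) := by
    rw [hl, List.map_append, List.nodup_append] at hnd
    intro h'
    exact hnd.2.2 _ h' _ (by simp) rfl
  refine ⟨Function.update (Function.update adj u (w :: adj u)) w (u :: adj w), ?_⟩
  constructor
  · simp [e1, h.arr0]
  · simp [e1, h.arr1]
  · simp [e1, h.arr5]
  · intro a ha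
    rw [e1, Function.update_of_ne (by omega), Function.update_of_ne (by omega),
      Function.update_of_ne (by omega)]
    exact h.zero a ha
  · rw [e4 1 (by simp), h.reg1]
  · rw [e4 2 (by simp), h.reg2]
  · rw [e4 8 (by simp), h.reg8]
  · rw [e4 9 (by simp), h.reg9]
  · rw [e2, h.reg10]; simp
  · rw [e4 12 (by simp), h.reg12]
  · rw [e4 13 (by simp), h.reg13]
  · rw [e4 14 (by simp), h.reg14]
  · rw [e4 15 (by simp), h.reg15]
  · intro nxt tgt hnt s
    rw [e3] at hnt
    have hold := h.linked nxt tgt (fun i hi => by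
      have := hnt i (by omega)
      rwa [e1, Function.update_of_ne (by simp), Function.update_self, Function.update_self,
        Function.update_of_ne (by omega), Function.update_of_ne (by omega),
        Function.update_of_ne (by omega), Function.update_of_ne (by omega)] at this)
    have hk1 := hnt (τ.reg 11 + 1) (by omega)
    have hk2 := hnt (τ.reg 11 + 2) (by omega)
    simp [e1] at hk1 hk2
    have e5 : (readEdge.eval τ).arr 2 s = Function.update (Function.update (fun s : Fin n => τ.arr 2 s)
        u (τ.reg 11 + 1)) w (τ.reg 11 + 2) s := by
      simp only [e1, ne_eq, Nat.reduceEqDiff, not_false_eq_true, Function.update_of_ne,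
        Function.update_self]
      rcases eq_or_ne s w with rfl | hsw
      · simp
      · rw [Function.update_of_ne hsw, Function.update_of_ne (by simpa [Fin.ext_iff] using hsw),
          update_val]
    rw [e5]
    rcases eq_or_ne s w with rfl | hsw
    · rw [Function.update_self, Function.update_self]
      exact ⟨by omega, hk2.2, hk2.1 ▸ hold s⟩
    · rw [Function.update_of_ne hsw, Function.update_of_ne hsw]
      rcases eq_or_ne s u with rfl | hsu
      · rw [Function.update_self, Function.update_self]
        exact ⟨by omega, hk1.2, hk1.1 ▸ hold s⟩
      · rw [Function.update_of_ne hsu, Function.update_of_ne hsu]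
        exact hold s
  · intro s x
    have := h.mem_adj s x
    rw [List.map_append, List.mem_append, ← this]
    simp only [List.map_cons, List.map_nil, List.mem_singleton, Sym2.eq_iff]
    rcases eq_or_ne s w with rfl | hsw
    · rw [Function.update_self, List.mem_cons]
      have := huw.symm
      tauto
    · rw [Function.update_of_ne hsw]
      rcases eq_or_ne s u with rfl | hsu
      · rw [Function.update_self, List.mem_cons]
        tauto
      · rw [Function.update_of_ne hsu]
        tauto
  · intro s
    rcases eq_or_ne s w with rfl | hsw
    · rw [Function.update_self, List.nodup_cons, h.mem_adj, Sym2.eq_swap]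
      exact ⟨hnew, h.nodup _⟩
    · rw [Function.update_of_ne hsw]
      rcases eq_or_ne s u with rfl | hsu
      · rw [Function.update_self, List.nodup_cons, h.mem_adj]
        exact ⟨hnew, h.nodup _⟩
      · rw [Function.update_of_ne hsu]
        exact h.nodup _
  · have s1 := sum_update (Function.update adj u (w :: adj u)) List.length w (u :: adj w)
    have s2 := sum_update adj List.length u (w :: adj u)
    have s3 := h.sum
    rw [Function.update_of_ne huw.symm] at s1
    simp only [List.length_cons, List.length_append, List.length_nil] at *
    omega

theorem Built.exec {l : List (Fin n × Fin n)} (hl : IsEdgeList G l) (l₂ l₁ : List (Fin n × Fin n))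
    (h12 : l = l₁ ++ l₂) {adj : Fin n → List (Fin n)} {τ : State} (h : Built l l₁ adj τ) :
    ∃ (t : ℕ) (τ' : State) (adj' : Fin n → List (Fin n)),
      Exec (.while (.lt 10 1) readEdge) τ t τ' ∧ t ≤ (1 + readEdge.cost) * l₂.length + 1 ∧
      Built l l adj' τ' := by
  induction l₂ generalizing l₁ adj τ with
  | nil =>
    rw [List.append_nil] at h12
    subst h12
    refine ⟨1, τ, adj, .while_false ?_, by simp, h⟩
    rw [Test.Holds, h.reg10, h.reg1]
    simp
  | cons e l₂ ih =>
    obtain ⟨u, w⟩ := e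
    have huw : u ≠ w := by
      have : G.Adj u w := (hl.2 u w).2 (by rw [h12]; simp)
      exact this.ne
    obtain ⟨adj', h'⟩ := h.step h12 huw hl.1
    obtain ⟨t, ht, he⟩ := loopFree_readEdge.exec τ
    obtain ⟨t', τ', adj'', h1, h2, h3⟩ := ih (l₁ ++ [(u, w)]) (by simp [h12]) h'
    refine ⟨1 + t + t', τ', adj'', .while_true ?_ he h1, ?_, h3⟩
    · rw [Test.Holds, h.reg10, h.reg1, h12]
      simp
    · rw [List.length_cons, mul_add]
      omega

theorem Built.holds {l : List (Fin n × Fin n)} {adj : Fin n → List (Fin n)} {τ : State}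
    (h : Built l l adj τ) (hroot : (root : ℕ) = 0) : Holds (Search.init root adj) τ := by
  have h5 : ∀ s : Fin n, τ.arr 5 s = if s = root then 1 else 0 := by
    intro s
    rw [h.arr5, ← hroot, update_val, Function.update_apply]
  constructor
  · intro v t hst
    rw [h.reg2, ← hroot]
    exact congrArg _ (List.cons.inj hst).1
  · simp [h.reg8, Search.init, weight]
  · exact h.reg9
  · exact h.reg12
  · exact h.reg13
  · exact h.reg14
  · exact h.reg15
  · exact h.linked _ _ fun _ _ => ⟨rfl, rfl⟩
  · intro s hs _
    rw [h5, if_neg (by simpa [Search.init] using hs)]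
  · intro s hs
    rw [h5, if_pos (by simpa [Search.init] using hs)]
  · intro s hs
    exact hs.elim
  · intro x y hxy
    exact hxy.elim
  · intro s _
    rw [h.zero 7 (by norm_num)]
    rfl
  · intro s _
    rw [h.zero 8 (by norm_num)]
    rfl
  · intro s _
    rw [h.zero 9 (by norm_num)]
    rfl

/-- The program computes the three numbers in linear time. -/
theorem exec_cactusProgram (hG : G.IsChristmasCactus) {l : List (Fin n × Fin n)}
    (hl : IsEdgeList G l) :
    ∃ (t : ℕ) (τ : State), Exec cactusProgram (input n l) t τ ∧ t ≤ 1000 * (n + l.length) ∧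
      (τ.reg 0 : ℕ∞) = G.mEternalGuardNumber ∧ (τ.reg 0 : ℕ∞) = G.mEternalDominationNumber ∧
      (Nontrivial (Fin n) → (τ.reg 0 : ℕ∞) = G.mEternalEvictionNumber) := by
  obtain ⟨v⟩ := hG.1.1.nonempty
  have hn : 0 < n := v.pos
  let root : Fin n := ⟨0, hn⟩
  have hroot : (root : ℕ) = 0 := rfl
  obtain ⟨t₁, ht₁, he₁⟩ := loopFree_prepare.exec (input n l)
  have hb : Built l [] (fun _ => []) (prepare.eval (input n l)) := by
    constructor <;> try simp [prepare, Instr.apply, State.setReg, State.setArr, input, Linked]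
    intro a ha
    rw [Function.update_of_ne (by omega)]
    funext i
    match a, ha with
    | a + 2, _ => rfl
  obtain ⟨t₂, τ₂, adj, he₂, ht₂, hb₂⟩ := hb.exec hl l [] rfl
  have hinv : (Search.init root adj).Inv G root := Search.inv_init adj hb₂.nodup fun s x =>
    (hb₂.mem_adj s x).trans (hl.2 s x).symm
  -- Each edge occurs in two adjacency lists, and no vertex is finished yet.
  have hmeasure : (Search.init root adj).measure ≤ 2 * l.length + n := by
    have : ((∅ : Set (Fin n))ᶜ).ncard = n := by simp [Set.ncard_univ]
    have h' := hb₂.sum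
    rw [Search.measure]
    change ∑ s, (adj s).length + ((∅ : Set (Fin n))ᶜ).ncard ≤ _
    omega
  obtain ⟨t₃, τ₃, σ, he₃, ht₃, hσ, hst, hadj, h8, h7, h12, h13⟩ :=
    (hb₂.holds hroot).exec hG hroot _ hinv hmeasure
  obtain ⟨hup, hlow, hcyc, hword⟩ := hσ.final hG hst hadj
  have hw : ∑ s, weight (σ.word s) = 0 := by simp [hword, weight]
  obtain ⟨t₄, ht₄, he₄⟩ := loopFree_answer.exec τ₃
  refine ⟨_, _, .seq he₁ (.seq he₂ (.seq he₃ he₄)), ?_, ?_⟩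
  -- With `m` edges the four phases take at most `149 * m + 67 * n + 84` steps, and `n` is positive;
  -- the constant 1000 is generous.
  · have c1 : readEdge.cost = 14 := rfl
    have c2 : searchStep.cost = 66 := rfl
    have c3 : prepare.cost = 5 := rfl
    have c4 : answer.cost = 10 := rfl
    rw [c3] at ht₁
    rw [c1] at ht₂
    rw [c2] at ht₃
    rw [c4] at ht₄
    omega
  · have hreg : (answer.eval τ₃).reg 0 = (if 1 < (σ.pen root).length then 2 else 1) + σ.c := by
      by_cases hp : 1 < (σ.pen root).length
      · simp [answer, Program.eval, Instr.apply, State.setReg, Test.Holds, h12, h13, h7, hp, h8, hw]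
        omega
      · simp [answer, Program.eval, Instr.apply, State.setReg, Test.Holds, h12, h13, h7, hp, h8, hw]
        omega
    rw [hreg]
    exact SimpleGraph.numbers_eq hup hlow hcyc

end RAM

theorem theorem1 :
    -- The three numbers coincide. On a single vertex no strategy with a guard can evict the vertex.
    (∀ (V : Type*) [Finite V] (G : SimpleGraph V), G.IsChristmasCactus →
      G.mEternalGuardNumber = G.mEternalDominationNumber ∧
      (Nontrivial V → G.mEternalDominationNumber = G.mEternalEvictionNumber)) ∧
    -- One program computes them, with the result in register 0, in time linear in `n + m`.
    (∃ (P : RAM.Program) (c : ℕ), ∀ (n : ℕ) (G : SimpleGraph (Fin n)) (l : List (Fin n × Fin n)),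
      G.IsChristmasCactus → RAM.IsEdgeList G l →
      ∃ (t : ℕ) (τ : RAM.State), RAM.Exec P (RAM.input n l) t τ ∧ t ≤ c * (n + l.length) ∧
        (τ.reg 0 : ℕ∞) = G.mEternalGuardNumber ∧
        (τ.reg 0 : ℕ∞) = G.mEternalDominationNumber ∧
        (2 ≤ n → (τ.reg 0 : ℕ∞) = G.mEternalEvictionNumber)) := by
  refine ⟨fun V _ G hG => ?_, RAM.cactusProgram, 1000, fun n G l hG hl => ?_⟩
  · obtain ⟨k, h1, h2, h3⟩ := hG.exists_numbers_eq
    exact ⟨h1.symm.trans h2, fun hV => h2.symm.trans (h3 hV)⟩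
  · obtain ⟨t, τ, h1, h2, h3, h4, h5⟩ := RAM.exec_cactusProgram hG hl
    exact ⟨t, τ, h1, h2, h3, h4, fun hn => h5 (Fin.nontrivial_iff_two_le.2 hn)⟩
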